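/- Let $d$ be a dimension, $\alpha\in(0,1)$ and $\Lambda\ge 1$, and let $Q_1=(-1,0]\times B_1\times B_1\subset\mathbb R\times\mathbb R^d\times\mathbb R^d$, where $B_1$ is the open unit ball centred at $0$. For $\beta,\alpha_1,\alpha_2\in(0,1]$ and a function $h$ on $Q_1$ put $$[h]_{C_x^{\alpha_1}C_v^{\alpha_2}(Q_1)}=\sup\frac{|h(t,x,v)-h(t,x',v')|}{|x-x'|^{\alpha_1}+|v-v'|^{\alpha_2}},\qquad [h]_{C_x^{\beta}(Q_1)}=\sup\frac{|h(t,x,v)-h(t,x',v)|}{|x-x'|^{\beta}},$$ where the suprema are over pairs of distinct points of $Q_1$ of the indicated form (same $t$, and in the second case also same $v$) with $|x-x'|<1/2$ and $|v-v'|<1/2$; let $C_x^{\alpha_1}C_v^{\alpha_2}(Q_1)$ be the space of those $h\in L^\infty(Q_1)$ for which the first seminorm is finite. There is a constant $C$, depending only on $d$, $\alpha$ and $\Lambda$, such that the following holds. Let $a:\mathbb R\to\mathbb R^{d\times d}$ be measurable with $\Lambda^{-1}\,\mathrm{Id}\le a(t)\le\Lambda\,\mathrm{Id}$, in the sense of quadratic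 forms, for all $t$. Let $f$ be a function on $Q_1$ such that $f$, $(\partial_t+v\cdot\nabla_x)f$ and $D_v^2f$ exist and are continuous on $Q_1$, where $(\partial_t+v\cdot\nabla_x)f$ is the derivative of $f$ along the curves $s\mapsto(t+s,x+sv,v)$ (one-sided at $t=0$). Let $g\in C_x^{\alpha/3}C_v^{\alpha}(Q_1)$. Assume that $f$ and $g$ have compact support in $Q_1$ (they need not vanish at $t=0$), and that $$(\partial_t+v\cdot\nabla_x)f=\mathrm{Tr}\big(a(t)D_v^2f\big)+g\qquad\text{for almost every } t\in(-1,0]\text{ and all }(x,v)\in B_1\times B_1 .$$ Then $$[f]_{C_x^{(2+\alpha)/3}(Q_1)}+[D_v^2f]_{C_x^{\alpha/3}C_v^{\alpha}(Q_1)}\le C\,[g]_{C_x^{\alpha/3}C_v^{\alpha}(Q_1)} .$$ -/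

import Mathlib

open MeasureTheory Set
open scoped ENNReal NNReal

/-- Euclidean space `ℝᵈ`. -/
abbrev Vec (d : ℕ) : Type := EuclideanSpace ℝ (Fin d)

/-- Points `z = (t, x, v)` of `ℝ × ℝᵈ × ℝᵈ`. -/
abbrev Phase (d : ℕ) : Type := ℝ × Vec d × Vec d

/-- The kinetic cylinder `Q_r = (-r², 0] × B_{r³} × B_r`. -/
def kineticCylinder (d : ℕ) (r : ℝ) : Set (Phase d) :=
  Ioc (-r ^ 2) 0 ×ˢ (Metric.ball (0 : Vec d) (r ^ 3) ×ˢ Metric.ball (0 : Vec d) r)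

section Holder

variable {d : ℕ} {F : Type*} [NormedAddCommGroup F]

/-- The seminorm `[f]_{C_x^{α₁} C_v^{α₂}(Q)}`: the supremum, over pairs of distinct points of `Q`
at the same time and with `|x - x'|, |v - v'| < 1/2`, of
`|f(t,x,v) - f(t,x',v')| / (|x - x'|^{α₁} + |v - v'|^{α₂})`. It takes values in `[0, ∞]`. -/
noncomputable def holderXV (α₁ α₂ : ℝ) (Q : Set (Phase d)) (f : Phase d → F) : ℝ≥0∞ :=
  ⨆ (t : ℝ) (x : Vec d) (v : Vec d) (x' : Vec d) (v' : Vec d)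
    (_ : (t, x, v) ∈ Q) (_ : (t, x', v') ∈ Q) (_ : (x, v) ≠ (x', v'))
    (_ : ‖x - x'‖ < 1 / 2) (_ : ‖v - v'‖ < 1 / 2),
    ENNReal.ofReal (‖f (t, x, v) - f (t, x', v')‖ / (‖x - x'‖ ^ α₁ + ‖v - v'‖ ^ α₂))

/-- The seminorm `[f]_{C_x^β(Q)}`: the supremum, over pairs of distinct points of `Q` with the same
time and velocity and with `|x - x'| < 1/2`, of `|f(t,x,v) - f(t,x',v)| / |x - x'|^β`. -/
noncomputable def holderX (β : ℝ) (Q : Set (Phase d)) (f : Phase d → F) : ℝ≥0∞ :=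
  ⨆ (t : ℝ) (x : Vec d) (x' : Vec d) (v : Vec d)
    (_ : (t, x, v) ∈ Q) (_ : (t, x', v) ∈ Q) (_ : x ≠ x') (_ : ‖x - x'‖ < 1 / 2),
    ENNReal.ofReal (‖f (t, x, v) - f (t, x', v)‖ / ‖x - x'‖ ^ β)

/-- The space `C_x^{α₁} C_v^{α₂}(Q)`. -/
def MemHolderXV (α₁ α₂ : ℝ) (Q : Set (Phase d)) (f : Phase d → F) : Prop :=
  MemLp f ∞ (volume.restrict Q) ∧ holderXV α₁ α₂ Q f < ∞

end Holder

/-- `f`, as a function on `Q`, has compact support contained in `Q` (values off `Q` are ignored). -/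
def CompactSupportIn {d : ℕ} (Q : Set (Phase d)) (f : Phase d → ℝ) : Prop :=
  ∃ K : Set (Phase d), IsCompact K ∧ K ⊆ Q ∧ ∀ z ∈ Q, z ∉ K → f z = 0

/-- The integral curve `s ↦ (t + s, x + s v, v)` of the field `∂_t + v·∇_x` through `(t, x, v)`. -/
noncomputable def transportCurve {d : ℕ} (z : Phase d) (s : ℝ) : Phase d :=
  (z.1 + s, z.2.1 + s • z.2.2, z.2.2)

/-- `f` has a derivative in the direction `∂_t + v·∇_x` at `z`, relative to `Q`
(so one-sided at the final time of a cylinder). -/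
def TransportDifferentiableAt {d : ℕ} (Q : Set (Phase d)) (f : Phase d → ℝ) (z : Phase d) : Prop :=
  DifferentiableWithinAt ℝ (fun s => f (transportCurve z s)) {s | transportCurve z s ∈ Q} 0

/-- `(∂_t + v·∇_x) f` at `z`, relative to `Q`. -/
noncomputable def transportDeriv {d : ℕ} (Q : Set (Phase d)) (f : Phase d → ℝ) (z : Phase d) : ℝ :=
  derivWithin (fun s => f (transportCurve z s)) {s | transportCurve z s ∈ Q} 0

/-- `D²_v f` at `z`, as a bilinear form on `ℝᵈ` (with the operator norm). -/
noncomputable def hessV {d : ℕ} (f : Phase d → ℝ) (z : Phase d) : Vec d →L[ℝ] Vec d →L[ℝ] ℝ :=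
  fderiv ℝ (fun v => fderiv ℝ (fun w => f (z.1, z.2.1, w)) v) z.2.2

/-- The matrix `(∂_{v_i} ∂_{v_j} f(z))_{ij}` of `D²_v f(z)`. -/
noncomputable def hessVMatrix {d : ℕ} (f : Phase d → ℝ) (z : Phase d) :
    Matrix (Fin d) (Fin d) ℝ :=
  Matrix.of fun i j => hessV f z (EuclideanSpace.single i 1) (EuclideanSpace.single j 1)

/-- `f`, `(∂_t + v·∇_x) f` and `D²_v f` exist and are continuous on `Q_r`. -/
structure KineticC2 {d : ℕ} (r : ℝ) (f : Phase d → ℝ) : Prop where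
  continuousOn : ContinuousOn f (kineticCylinder d r)
  transport_differentiable :
    ∀ z ∈ kineticCylinder d r, TransportDifferentiableAt (kineticCylinder d r) f z
  transport_continuousOn :
    ContinuousOn (transportDeriv (kineticCylinder d r) f) (kineticCylinder d r)
  contDiffOn_v : ∀ t ∈ Ioc (-r ^ 2) 0, ∀ x ∈ Metric.ball (0 : Vec d) (r ^ 3),
    ContDiffOn ℝ 2 (fun v => f (t, x, v)) (Metric.ball (0 : Vec d) r)
  hess_continuousOn : ContinuousOn (hessV f) (kineticCylinder d r)

/-- `a` is (Lebesgue) measurable and `Λ⁻¹ Id ≤ a(t) ≤ Λ Id` for all `t` as quadratic forms. -/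
def IsEllipticCoeff {d : ℕ} (Λ : ℝ) (a : ℝ → Matrix (Fin d) (Fin d) ℝ) : Prop :=
  (∀ i j, AEMeasurable (fun t => a t i j) volume) ∧
    ∀ t, ∀ ξ : Fin d → ℝ,
      Λ⁻¹ * (ξ ⬝ᵥ ξ) ≤ ξ ⬝ᵥ (a t).mulVec ξ ∧ ξ ⬝ᵥ (a t).mulVec ξ ≤ Λ * (ξ ⬝ᵥ ξ)

/-- `(∂_t + v·∇_x) f = Tr(a(t) D²_v f) + g` in `Q_r`, for almost every time `t`
and every `(x, v)`. -/
def SolvesHomogeneousKFP {d : ℕ} (r : ℝ) (a : ℝ → Matrix (Fin d) (Fin d) ℝ)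
    (f g : Phase d → ℝ) : Prop :=
  ∀ᵐ t : ℝ, ∀ x v : Vec d, (t, x, v) ∈ kineticCylinder d r →
    transportDeriv (kineticCylinder d r) f (t, x, v) =
      (a t * hessVMatrix f (t, x, v)).trace + g (t, x, v)

/-!
Fix a final time `t ≤ 0` and straighten along transport: `F τ (x, v) = f (t - τ, x - τ v, v)`
satisfies `-∂_τ F = Tr (a D²F) + G`, where the second derivatives are taken in the directions
`(τ e, e)`. By ellipticity `a = Λ⁻¹ Id + ∑ₖ uₖ ⊗ uₖ`. The average of `F τ` against the Kolmogorov
kernel at time `τ` with diffusivity `Λ⁻¹` has a `τ`-derivative in which the kernel cancels the term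
`Λ⁻¹ Δ`; what remains besides the averaged source are the second derivatives along the `uₖ`, which
are nonpositive at a maximum. So the maximum of the averaged solution varies at most at the rate of
the averaged source, whatever the dependence of `a` on time.

This is applied to a difference of `F` in `x`, respectively to a second difference in `v` of a
difference in `(x, v)`. For times below the square of the scale `ρ` of the increment, the Hölder
bound on the source suffices; beyond, the derivatives of the kernel gain negative powers of `τ`.
Integrating the two rates gives `ρ ^ (2 + α)`, respectively `ρ ^ α`.
-/

open Filter Topology

/-- Pairs `(x, v)` of a position and a velocity. -/
abbrev Slice (d : ℕ) : Type := Vec d × Vec d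

section SecondDifference

open fwdDiff

variable {E : Type*} [AddCommGroup E]

/-- The centred second difference of `H` with increment `w`. -/
def secondDiff (w : E) (H : E → ℝ) (y : E) : ℝ := H (y + w) + H (y - w) - 2 * H y

lemma secondDiff_eq_fwdDiff_fwdDiff (w : E) (H : E → ℝ) (y : E) :
    secondDiff w H y = Δ_[w] (Δ_[w] H) (y - w) := by
  simp only [secondDiff, fwdDiff, sub_add_cancel]
  ring

lemma secondDiff_fwdDiff (w h : E) (H : E → ℝ) (y : E) :
    secondDiff w (Δ_[h] H) y = secondDiff w H (y + h) - secondDiff w H y := by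
  simp only [secondDiff, fwdDiff, add_right_comm y w, sub_add_eq_add_sub]
  ring

lemma secondDiff_neg (w : E) (H : E → ℝ) (y : E) : secondDiff (-w) H y = secondDiff w H y := by
  simp only [secondDiff, sub_neg_eq_add, ← sub_eq_add_neg, add_comm (H (y + w))]

variable [Module ℝ E] {H H₁ H₂ : E → ℝ} {w : E}

lemma hasDerivAt_comp_line (h : ∀ y, HasLineDerivAt ℝ H (H₁ y) y w) (y : E) (r : ℝ) :
    HasDerivAt (fun r : ℝ => H (y + r • w)) (H₁ (y + r • w)) r := by
  have hr := h (y + r • w)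
  rw [HasLineDerivAt, ← sub_self r] at hr
  simpa [sub_smul] using hr.comp_sub_const r r

lemma exists_fwdDiff_eq (h₁ : ∀ y, HasLineDerivAt ℝ H (H₁ y) y w) (y : E) :
    ∃ ξ ∈ Ioo (0 : ℝ) 1, Δ_[w] H y = H₁ (y + ξ • w) := by
  have hline := hasDerivAt_comp_line h₁ y
  obtain ⟨ξ, hξ, hξeq⟩ := exists_hasDerivAt_eq_slope _ _ (zero_lt_one' ℝ)
    (fun r _ => (hline r).continuousAt.continuousWithinAt) (fun r _ => hline r)
  exact ⟨ξ, hξ, by simpa [fwdDiff] using hξeq.symm⟩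

lemma hasLineDerivAt_secondDiff (h₁ : ∀ y, HasLineDerivAt ℝ H (H₁ y) y w) (a y : E) :
    HasLineDerivAt ℝ (secondDiff a H) (secondDiff a H₁ y) y w := by
  have hadd : HasDerivAt _ _ _ := h₁ (y + a)
  have hsub : HasDerivAt _ _ _ := h₁ (y - a)
  have hy : HasDerivAt _ _ _ := h₁ y
  simpa only [HasLineDerivAt, secondDiff, add_right_comm y _ a, sub_add_eq_add_sub y a] using
    (hadd.fun_add hsub).fun_sub (hy.const_mul 2)

lemma exists_secondDiff_eq (h₁ : ∀ y, HasLineDerivAt ℝ H (H₁ y) y w)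
    (h₂ : ∀ y, HasLineDerivAt ℝ H₁ (H₂ y) y w) (y : E) {ε : ℝ} (hε : 0 < ε) :
    ∃ ξ ∈ Ioo (-ε) ε, secondDiff (ε • w) H y = ε ^ 2 * H₂ (y + ξ • w) := by
  have hline₁ := hasDerivAt_comp_line h₁ y
  have hline₂ := hasDerivAt_comp_line h₂ y
  have heven : ∀ r : ℝ, HasDerivAt (fun r : ℝ => H (y + r • w) + H (y + -r • w))
      (H₁ (y + r • w) - H₁ (y + -r • w)) r := fun r =>
    ((hline₁ r).add ((hline₁ (-r)).comp r (hasDerivAt_neg r))).congr_deriv (by ring)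
  have hsq : ∀ r : ℝ, HasDerivAt (fun r : ℝ => r ^ 2) (2 * r) r := fun r => by
    simpa using hasDerivAt_pow 2 r
  obtain ⟨c, ⟨hc0, hcε⟩, hceq⟩ := exists_ratio_hasDerivAt_eq_ratio_slope _ _ hε
    (fun r _ => (heven r).continuousAt.continuousWithinAt) (fun r _ => heven r) _ _
    (fun r _ => (hsq r).continuousAt.continuousWithinAt) (fun r _ => hsq r)
  obtain ⟨ξ, ⟨hξl, hξr⟩, hξeq⟩ := exists_hasDerivAt_eq_slope _ _ (by linarith : -c < c)
    (fun r _ => (hline₂ r).continuousAt.continuousWithinAt) (fun r _ => hline₂ r)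
  refine ⟨ξ, ⟨by linarith, by linarith⟩, mul_right_cancel₀ (by linarith : 2 * c ≠ 0) ?_⟩
  rw [eq_div_iff (by linarith)] at hξeq
  simp only [neg_zero, zero_smul, add_zero] at hceq
  rw [secondDiff, sub_eq_add_neg y, ← neg_smul]
  linear_combination (norm := ring_nf) -hceq - ε ^ 2 * hξeq

lemma abs_secondDiff_le (h₁ : ∀ y, HasLineDerivAt ℝ H (H₁ y) y w)
    (h₂ : ∀ y, HasLineDerivAt ℝ H₁ (H₂ y) y w) {C : ℝ} (hC : ∀ y, |H₂ y| ≤ C) (y : E) (ε : ℝ) :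
    |secondDiff (ε • w) H y| ≤ C * ε ^ 2 := by
  have hpos : ∀ ε : ℝ, 0 < ε → |secondDiff (ε • w) H y| ≤ C * ε ^ 2 := fun ε hε => by
    obtain ⟨ξ, -, hξ⟩ := exists_secondDiff_eq h₁ h₂ y hε
    rw [hξ, abs_mul, abs_of_nonneg (sq_nonneg ε), mul_comm]
    exact mul_le_mul_of_nonneg_right (hC _) (sq_nonneg ε)
  rcases lt_trichotomy ε 0 with hε | rfl | hε
  · simpa only [neg_smul, secondDiff_neg, neg_sq] using hpos (-ε) (neg_pos.mpr hε)
  · simp [secondDiff, two_mul]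
  · exact hpos ε hε

lemma tendsto_secondDiff (h₁ : ∀ y, HasLineDerivAt ℝ H (H₁ y) y w)
    (h₂ : ∀ y, HasLineDerivAt ℝ H₁ (H₂ y) y w) {y : E}
    (hc : ContinuousAt (fun r : ℝ => H₂ (y + r • w)) 0) :
    Tendsto (fun ε : ℝ => secondDiff (ε • w) H y / ε ^ 2) (𝓝[>] 0) (𝓝 (H₂ y)) := by
  rw [Metric.tendsto_nhdsWithin_nhds]
  intro δ hδ
  obtain ⟨η, hη, hηδ⟩ := Metric.continuousAt_iff.mp hc δ hδ
  refine ⟨η, hη, fun {ε} (hε : 0 < ε) hεη => ?_⟩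
  obtain ⟨ξ, hξ, heq⟩ := exists_secondDiff_eq h₁ h₂ y hε
  rw [Real.dist_eq, sub_zero, abs_of_pos hε] at hεη
  have hξη : dist ξ 0 < η := by
    rw [Real.dist_eq, sub_zero]
    exact (abs_lt.mpr hξ).trans hεη
  rw [heq, mul_div_cancel_left₀ _ (by positivity)]
  simpa using hηδ hξη

end SecondDifference

section Gaussian

lemma integrable_exp_neg_mul_sq_norm {V : Type*} [NormedAddCommGroup V] [InnerProductSpace ℝ V]
    [FiniteDimensional ℝ V] [MeasurableSpace V] [BorelSpace V] {b : ℝ} (hb : 0 < b) :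
    Integrable (fun v : V => Real.exp (-b * ‖v‖ ^ 2)) := by
  apply Integrable.of_integral_ne_zero
  rw [GaussianFourier.integral_rexp_neg_mul_sq_norm hb]
  positivity

variable {d : ℕ}

lemma integrable_exp_neg_mul_sq_add_sq {b : ℝ} (hb : 0 < b) :
    Integrable (fun z : Slice d => Real.exp (-b * (‖z.1‖ ^ 2 + ‖z.2‖ ^ 2))) := by
  simp only [mul_add, Real.exp_add]
  exact (integrable_exp_neg_mul_sq_norm hb).mul_prod (integrable_exp_neg_mul_sq_norm hb)

/-- The Gaussian probability density `π⁻ᵈ exp(-|z₁|² - |z₂|²)` on `ℝᵈ × ℝᵈ`. -/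
noncomputable def gaussDensity (z : Slice d) : ℝ :=
  (Real.pi ^ d)⁻¹ * Real.exp (-(‖z.1‖ ^ 2 + ‖z.2‖ ^ 2))

lemma gaussDensity_pos (z : Slice d) : 0 < gaussDensity z := by
  unfold gaussDensity; positivity

lemma norm_mul_gaussDensity_le {a B : ℝ} (ha : |a| ≤ B) (z : Slice d) :
    ‖a * gaussDensity z‖ ≤ B * gaussDensity z := by
  rw [norm_mul, Real.norm_of_nonneg (gaussDensity_pos z).le]
  exact mul_le_mul_of_nonneg_right ha (gaussDensity_pos z).le

@[fun_prop]
lemma continuous_gaussDensity : Continuous (gaussDensity (d := d)) := by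
  unfold gaussDensity; fun_prop

lemma integrable_gaussDensity : Integrable (gaussDensity (d := d)) := by
  unfold gaussDensity
  simpa only [neg_one_mul] using
    (integrable_exp_neg_mul_sq_add_sq (d := d) one_pos).const_mul (Real.pi ^ d)⁻¹

lemma integral_gaussDensity : ∫ z : Slice d, gaussDensity z = 1 := by
  have hprod : ∀ z : Slice d, gaussDensity z
      = (Real.pi ^ d)⁻¹ * (Real.exp (-1 * ‖z.1‖ ^ 2) * Real.exp (-1 * ‖z.2‖ ^ 2)) := fun z => by
    rw [gaussDensity, ← Real.exp_add]
    ring_nf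
  calc ∫ z : Slice d, gaussDensity z
      = (Real.pi ^ d)⁻¹ *
          ((∫ v : Vec d, Real.exp (-1 * ‖v‖ ^ 2)) * ∫ v : Vec d, Real.exp (-1 * ‖v‖ ^ 2)) := by
        simp_rw [hprod]
        rw [integral_const_mul]
        congr 1
        exact integral_prod_mul (μ := (volume : Measure (Vec d))) (ν := (volume : Measure (Vec d)))
          (fun v => Real.exp (-1 * ‖v‖ ^ 2)) (fun v => Real.exp (-1 * ‖v‖ ^ 2))
    _ = 1 := by
        rw [GaussianFourier.integral_rexp_neg_mul_sq_norm one_pos, ← Real.rpow_add (by positivity)]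
        simp only [div_one, finrank_euclideanSpace, Fintype.card_fin, add_halves,
          Real.rpow_natCast]
        exact inv_mul_cancel₀ (by positivity)

lemma integrable_mul_gaussDensity {H : Slice d → ℝ} (hH : Continuous H) {B : ℝ}
    (hB : ∀ y, |H y| ≤ B) : Integrable (fun z => H z * gaussDensity z) :=
  integrable_gaussDensity.bdd_mul hH.aestronglyMeasurable (ae_of_all _ hB)

end Gaussian

section Mollification

open fwdDiff

variable {d : ℕ}

/-- The linear map carrying the standard Gaussian to the law of the Kolmogorov diffusion with
diffusivity `ν` at time `τ`, in coordinates straightened along the transport field. -/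
noncomputable def spread (ν τ : ℝ) : Slice d →L[ℝ] Slice d :=
  ((τ * √(ν * τ)) • ContinuousLinearMap.fst ℝ (Vec d) (Vec d) +
      (τ * √(ν * τ / 3)) • ContinuousLinearMap.snd ℝ (Vec d) (Vec d)).prod
    ((2 * √(ν * τ)) • ContinuousLinearMap.fst ℝ (Vec d) (Vec d))

lemma spread_apply (ν τ : ℝ) (z : Slice d) : spread ν τ z =
    ((τ * √(ν * τ)) • z.1 + (τ * √(ν * τ / 3)) • z.2, (2 * √(ν * τ)) • z.1) := rfl

/-- Averaging against the Kolmogorov kernel with diffusivity `ν` at time `τ`. -/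
noncomputable def mollify (ν τ : ℝ) (H : Slice d → ℝ) (y : Slice d) : ℝ :=
  ∫ z, H (y - spread ν τ z) * gaussDensity z

lemma integrable_mollify {H : Slice d → ℝ} (hH : Continuous H) {B : ℝ} (hB : ∀ y, |H y| ≤ B)
    (ν τ : ℝ) (y : Slice d) : Integrable (fun z => H (y - spread ν τ z) * gaussDensity z) :=
  integrable_mul_gaussDensity (H := fun z => H (y - spread ν τ z)) (by fun_prop) fun _ => hB _

lemma abs_mollify_le {H : Slice d → ℝ} {B : ℝ} (hB : ∀ y, |H y| ≤ B) (ν τ : ℝ) (y : Slice d) :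
    |mollify ν τ H y| ≤ B := by
  have h : ‖mollify ν τ H y‖ ≤ ∫ z : Slice d, B * gaussDensity z :=
    norm_integral_le_of_norm_le (integrable_gaussDensity.const_mul B)
      (ae_of_all _ fun z => norm_mul_gaussDensity_le (hB _) z)
  rwa [integral_const_mul, integral_gaussDensity, mul_one] at h

lemma mollify_sub {H K : Slice d → ℝ} (hH : Continuous H) (hK : Continuous K) {B B' : ℝ}
    (hB : ∀ y, |H y| ≤ B) (hB' : ∀ y, |K y| ≤ B') (ν τ : ℝ) (y : Slice d) :
    mollify ν τ (fun y => H y - K y) y = mollify ν τ H y - mollify ν τ K y := by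
  unfold mollify
  rw [← integral_sub (integrable_mollify hH hB ν τ y) (integrable_mollify hK hB' ν τ y)]
  simp only [sub_mul]

lemma mollify_translate (ν τ : ℝ) (H : Slice d → ℝ) (h y : Slice d) :
    mollify ν τ (fun y => H (y + h)) y = mollify ν τ H (y + h) := by
  simp only [mollify, sub_add_eq_add_sub]

lemma mollify_fwdDiff {H : Slice d → ℝ} (hH : Continuous H) {B : ℝ} (hB : ∀ y, |H y| ≤ B)
    (ν τ : ℝ) (h : Slice d) : mollify ν τ (Δ_[h] H) = Δ_[h] (mollify ν τ H) := by
  ext y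
  have hsub := mollify_sub (H := fun y => H (y + h)) (by fun_prop) hH (fun y => hB _) hB ν τ y
  rwa [mollify_translate] at hsub

lemma mollify_secondDiff {H : Slice d → ℝ} (hH : Continuous H) {B : ℝ} (hB : ∀ y, |H y| ≤ B)
    (ν τ : ℝ) (w y : Slice d) :
    mollify ν τ (secondDiff w H) y = secondDiff w (mollify ν τ H) y := by
  have hHw : Continuous (Δ_[w] H) := (hH.comp (continuous_add_const w)).sub hH
  have hBw : ∀ y, |Δ_[w] H y| ≤ B + B := fun y => (abs_sub _ _).trans (add_le_add (hB _) (hB _))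
  simp only [funext (secondDiff_eq_fwdDiff_fwdDiff w H), sub_eq_add_neg, mollify_translate,
    mollify_fwdDiff hHw hBw, mollify_fwdDiff hH hB, secondDiff_eq_fwdDiff_fwdDiff]

/-- The fundamental solution of `∂_τ = ν |∇_v + τ ∇_x|²`. -/
noncomputable def kolmogorovKernel (ν τ : ℝ) (y : Slice d) : ℝ :=
  (√3 / (2 * Real.pi * ν * τ ^ 2)) ^ d *
    Real.exp (-(‖y.2‖ ^ 2 / τ - 3 * inner ℝ y.2 y.1 / τ ^ 2 + 3 * ‖y.1‖ ^ 2 / τ ^ 3) / ν)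

lemma continuous_kolmogorovKernel (ν τ : ℝ) : Continuous (kolmogorovKernel (d := d) ν τ) := by
  unfold kolmogorovKernel; fun_prop

lemma kolmogorovKernel_spread {ν τ : ℝ} (hν : 0 < ν) (hτ : 0 < τ) (z : Slice d) :
    ((2 * √(ν * τ)) * (τ * √(ν * τ / 3))) ^ d * kolmogorovKernel ν τ (spread ν τ z)
      = gaussDensity z := by
  have h3 : √(ν * τ / 3) = √(ν * τ) / √3 := Real.sqrt_div (by positivity) _
  have hs3 : √(3 : ℝ) ^ 2 = 3 := Real.sq_sqrt (by positivity)
  have hs : 0 < √(ν * τ) := by positivity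
  have hνs : ν = √(ν * τ) ^ 2 / τ := by
    rw [Real.sq_sqrt (by positivity)]
    field_simp
  rw [kolmogorovKernel, gaussDensity, spread_apply, ← mul_assoc, ← mul_pow, ← inv_pow, h3]
  generalize √(ν * τ) = s at *
  congr 2
  · rw [hνs]
    field_simp
  · simp only [inner_smul_left, inner_smul_right, inner_add_right, real_inner_self_eq_norm_sq,
      norm_smul, norm_add_sq_real, Real.norm_eq_abs, mul_pow, sq_abs, conj_trivial, div_pow, hs3]
    rw [hνs]
    field_simp
    ring

instance : (volume : Measure (Slice d)).IsAddHaarMeasure :=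
  inferInstanceAs ((volume : Measure (Vec d)).prod (volume : Measure (Vec d))).IsAddHaarMeasure

instance : (volume : Measure (Slice d)).IsNegInvariant :=
  ⟨((Measure.measurePreserving_neg (volume : Measure (Vec d))).prod
    (Measure.measurePreserving_neg (volume : Measure (Vec d)))).map_eq⟩

lemma integral_comp_blockTriangular {φ : Slice d → ℝ} (hφ : Integrable φ) {p q r : ℝ}
    (hφ' : Integrable fun z : Slice d => φ (q • z.1 + r • z.2, p • z.1)) :
    ∫ z : Slice d, φ (q • z.1 + r • z.2, p • z.1) = (|p * r| ^ d)⁻¹ * ∫ y, φ y := by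
  have hfiber : ∀ z₁ : Vec d, ∫ z₂ : Vec d, φ (q • z₁ + r • z₂, p • z₁)
      = (|r| ^ d)⁻¹ * ∫ x : Vec d, φ (x, p • z₁) := fun z₁ => by
    rw [Measure.integral_comp_smul volume (fun w => φ (q • z₁ + w, p • z₁)),
      integral_add_left_eq_self (fun w => φ (w, p • z₁))]
    simp [abs_inv]
  calc ∫ z : Slice d, φ (q • z.1 + r • z.2, p • z.1)
      = ∫ z₁ : Vec d, ∫ z₂ : Vec d, φ (q • z₁ + r • z₂, p • z₁) := integral_prod _ hφ'
    _ = (|p * r| ^ d)⁻¹ * ∫ v : Vec d, ∫ x : Vec d, φ (x, v) := by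
        simp_rw [hfiber]
        rw [integral_const_mul,
          Measure.integral_comp_smul volume (fun v => ∫ x : Vec d, φ (x, v))]
        simp [abs_inv, abs_mul, mul_pow]
        ring
    _ = (|p * r| ^ d)⁻¹ * ∫ y, φ y := by
        congr 1
        exact (integral_prod_symm _ hφ).symm

lemma mollify_eq_integral_kernel {ν τ : ℝ} (hν : 0 < ν) (hτ : 0 < τ) {H : Slice d → ℝ}
    (hH : Continuous H) (hs : HasCompactSupport H) (y : Slice d) :
    mollify ν τ H y = ∫ y', H y' * kolmogorovKernel ν τ (y - y') := by
  have hK := continuous_kolmogorovKernel (d := d) ν τ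
  obtain ⟨B, hB⟩ := hs.exists_bound_of_continuous hH
  set c := ((2 * √(ν * τ)) * (τ * √(ν * τ / 3))) ^ d with hc
  have hc0 : 0 < c := by positivity
  set φ : Slice d → ℝ := fun y' => H (y - y') * kolmogorovKernel ν τ y' with hφ
  have hφi : Integrable φ :=
    Continuous.integrable_of_hasCompactSupport (by fun_prop)
      (hs.comp_homeomorph (Homeomorph.subLeft y)).mul_right
  have hφs : ∀ z, H (y - spread ν τ z) * gaussDensity z = c * φ (spread ν τ z) := fun z => by
    rw [← kolmogorovKernel_spread hν hτ z, mul_left_comm]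
  have hφsi : Integrable (fun z => φ (spread ν τ z)) := by
    have := (integrable_mollify hH hB ν τ y).const_mul c⁻¹
    simpa only [hφs, inv_mul_cancel_left₀ hc0.ne'] using this
  calc mollify ν τ H y = c * ∫ z, φ (spread ν τ z) := by
        simp_rw [mollify, hφs, integral_const_mul]
    _ = c * ((|2 * √(ν * τ) * (τ * √(ν * τ / 3))| ^ d)⁻¹ * ∫ y', φ y') := by
        congr 1
        exact integral_comp_blockTriangular hφi hφsi
    _ = ∫ y', φ y' := by
        rw [abs_of_pos (by positivity), ← hc, mul_inv_cancel_left₀ hc0.ne']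
    _ = ∫ y', H y' * kolmogorovKernel ν τ (y - y') := by
        rw [← integral_sub_left_eq_self φ volume y]
        simp only [hφ, sub_sub_cancel]

end Mollification

section SecondLineDerivative

open fwdDiff

variable {d : ℕ} {H H₂ : Slice d → ℝ} {w : Slice d}

/-- `H₂` is the second derivative of `H` in direction `w`, in the sense of second difference
quotients that are uniformly bounded and converge. -/
structure HasSecondDiff (H : Slice d → ℝ) (w : Slice d) (H₂ : Slice d → ℝ) : Prop where
  bound : ∃ C, ∀ y (ε : ℝ), |secondDiff (ε • w) H y| ≤ C * ε ^ 2
  tendsto : ∀ y, Tendsto (fun ε : ℝ => secondDiff (ε • w) H y / ε ^ 2) (𝓝[>] 0) (𝓝 (H₂ y))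

lemma HasSecondDiff.of_hasLineDerivAt {H₁ : Slice d → ℝ} (h₁ : ∀ y, HasLineDerivAt ℝ H (H₁ y) y w)
    (h₂ : ∀ y, HasLineDerivAt ℝ H₁ (H₂ y) y w) (hc : Continuous H₂) (hb : ∃ C, ∀ y, |H₂ y| ≤ C) :
    HasSecondDiff H w H₂ where
  bound := let ⟨C, hC⟩ := hb; ⟨C, abs_secondDiff_le h₁ h₂ hC⟩
  tendsto _ := tendsto_secondDiff h₁ h₂ (by fun_prop)

lemma HasSecondDiff.fwdDiff (h : HasSecondDiff H w H₂) (a : Slice d) :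
    HasSecondDiff (Δ_[a] H) w (Δ_[a] H₂) := by
  obtain ⟨C, hC⟩ := h.bound
  refine ⟨⟨C + C, fun y ε => ?_⟩, fun y => ?_⟩
  · rw [secondDiff_fwdDiff, add_mul]
    exact (abs_sub _ _).trans (add_le_add (hC _ ε) (hC y ε))
  · simp only [secondDiff_fwdDiff, sub_div]
    exact (h.tendsto (y + a)).sub (h.tendsto y)

lemma HasSecondDiff.tendsto_mollify (h : HasSecondDiff H w H₂) (hH : Continuous H) {B : ℝ}
    (hB : ∀ y, |H y| ≤ B) (ν τ : ℝ) (y : Slice d) :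
    Tendsto (fun ε : ℝ => secondDiff (ε • w) (mollify ν τ H) y / ε ^ 2) (𝓝[>] 0)
      (𝓝 (mollify ν τ H₂ y)) := by
  obtain ⟨C, hC⟩ := h.bound
  simp_rw [← mollify_secondDiff hH hB, mollify, ← integral_div]
  refine tendsto_integral_filter_of_dominated_convergence (fun z => C * gaussDensity z)
    (Eventually.of_forall fun ε => Continuous.aestronglyMeasurable ?_) ?_
    (integrable_gaussDensity.const_mul C) (ae_of_all _ fun z => ?_)
  · unfold secondDiff
    fun_prop
  · filter_upwards [self_mem_nhdsWithin] with ε (hε : 0 < ε)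
    refine ae_of_all _ fun z => ?_
    rw [mul_div_right_comm, norm_mul, norm_div, Real.norm_of_nonneg (gaussDensity_pos z).le,
      Real.norm_of_nonneg (sq_nonneg ε)]
    exact mul_le_mul_of_nonneg_right ((div_le_iff₀ (by positivity)).mpr (hC _ ε))
      (gaussDensity_pos z).le
  · simpa only [mul_div_right_comm] using (h.tendsto (y - spread ν τ z)).mul_const _

variable {P P₁ P₂ : Slice d → ℝ}

lemma integrable_mul_comp_sub (hH : Continuous H) (hs : HasCompactSupport H) (hP : Continuous P)
    (y : Slice d) : Integrable (fun y' => H y' * P (y - y')) :=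
  Continuous.integrable_of_hasCompactSupport (by fun_prop) hs.mul_right

lemma secondDiff_integral_mul_comp_sub (hH : Continuous H) (hs : HasCompactSupport H)
    (hP : Continuous P) (w y : Slice d) :
    secondDiff w (fun y => ∫ y', H y' * P (y - y')) y = ∫ y', H y' * secondDiff w P (y - y') := by
  have hi := integrable_mul_comp_sub hH hs hP
  rw [secondDiff, ← integral_const_mul, ← integral_add (hi _) (hi _),
    ← integral_sub ((hi _).fun_add (hi _)) ((hi _).const_mul 2)]
  congr with z
  rw [secondDiff, add_sub_right_comm y, sub_right_comm y]
  ring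

lemma tendsto_secondDiff_integral_mul_comp_sub (hH : Continuous H) (hs : HasCompactSupport H)
    (hP : Continuous P) (h₁ : ∀ y, HasLineDerivAt ℝ P (P₁ y) y w)
    (h₂ : ∀ y, HasLineDerivAt ℝ P₁ (P₂ y) y w) (hP₂ : Continuous P₂) (y : Slice d) :
    Tendsto (fun ε : ℝ => secondDiff (ε • w) (fun y => ∫ y', H y' * P (y - y')) y / ε ^ 2)
      (𝓝[>] 0) (𝓝 (∫ y', H y' * P₂ (y - y'))) := by
  obtain ⟨K, hK⟩ : ∃ K, ∀ p ∈ tsupport H ×ˢ Icc (-1 : ℝ) 1, ‖P₂ (y - p.1 + p.2 • w)‖ ≤ K :=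
    (hs.isCompact.prod isCompact_Icc).exists_bound_of_continuousOn (by fun_prop)
  simp_rw [secondDiff_integral_mul_comp_sub hH hs hP, ← integral_div, mul_div_assoc]
  refine tendsto_integral_filter_of_dominated_convergence (fun y' => |H y'| * K)
    (Eventually.of_forall fun ε => Continuous.aestronglyMeasurable ?_) ?_
    ((hH.integrable_of_hasCompactSupport hs).abs.mul_const K)
    (ae_of_all _ fun y' => (tendsto_secondDiff h₁ h₂ (by fun_prop)).const_mul _)
  · unfold secondDiff
    fun_prop
  · filter_upwards [Ioo_mem_nhdsGT one_pos] with ε hε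
    refine ae_of_all _ fun y' => ?_
    by_cases hy : y' ∈ tsupport H
    · obtain ⟨ξ, hξ, heq⟩ := exists_secondDiff_eq h₁ h₂ (y - y') hε.1
      rw [norm_mul, heq, mul_div_cancel_left₀ _ (pow_ne_zero 2 hε.1.ne')]
      exact mul_le_mul_of_nonneg_left
        (hK (y', ξ) ⟨hy, by linarith [hξ.1, hε.2], by linarith [hξ.2, hε.2]⟩) (norm_nonneg _)
    · simp [image_eq_zero_of_notMem_tsupport hy]

end SecondLineDerivative

section KernelEquation

variable {d : ℕ}

/-- The direction `(τ e, e)`, along which `∇_v + τ ∇_x` differentiates. -/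
noncomputable def kineticDir (τ : ℝ) (e : Vec d) : Slice d := (τ • e, e)

/-- First derivative of the Kolmogorov kernel along `kineticDir τ e`. -/
noncomputable def kernelDeriv (ν τ : ℝ) (e : Vec d) (y : Slice d) : ℝ :=
  (inner ℝ y.2 e / τ - 3 * inner ℝ y.1 e / τ ^ 2) / ν * kolmogorovKernel ν τ y

/-- Second derivative of the Kolmogorov kernel along `kineticDir τ e`. -/
noncomputable def kernelDeriv₂ (ν τ : ℝ) (e : Vec d) (y : Slice d) : ℝ :=
  (((inner ℝ y.2 e / τ - 3 * inner ℝ y.1 e / τ ^ 2) / ν) ^ 2 - 2 * ‖e‖ ^ 2 / (τ * ν)) *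
    kolmogorovKernel ν τ y

/-- `ν |∇_v + τ ∇_x|²` applied to the Kolmogorov kernel. -/
noncomputable def kernelLaplacian (ν τ : ℝ) (y : Slice d) : ℝ :=
  ν * ∑ i, kernelDeriv₂ ν τ (EuclideanSpace.single i 1) y

lemma continuous_kernelDeriv₂ (ν τ : ℝ) (e : Vec d) : Continuous (kernelDeriv₂ ν τ e) := by
  have := continuous_kolmogorovKernel (d := d) ν τ
  unfold kernelDeriv₂; fun_prop

lemma continuous_kernelLaplacian (ν τ : ℝ) : Continuous (kernelLaplacian (d := d) ν τ) := by
  have := fun e => continuous_kernelDeriv₂ (d := d) ν τ e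
  unfold kernelLaplacian; fun_prop

lemma hasDerivAt_kineticDir_fst (τ : ℝ) (e : Vec d) (y : Slice d) :
    HasDerivAt (fun r : ℝ => (y + r • kineticDir τ e).1) (τ • e) 0 := by
  simpa [kineticDir] using ((hasDerivAt_id (0 : ℝ)).smul_const (τ • e)).const_add y.1

lemma hasDerivAt_kineticDir_snd (τ : ℝ) (e : Vec d) (y : Slice d) :
    HasDerivAt (fun r : ℝ => (y + r • kineticDir τ e).2) e 0 := by
  simpa [kineticDir] using ((hasDerivAt_id (0 : ℝ)).smul_const e).const_add y.2

lemma hasLineDerivAt_kolmogorovKernel {ν τ : ℝ} (hν : 0 < ν) (hτ : 0 < τ) (e : Vec d)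
    (y : Slice d) :
    HasLineDerivAt ℝ (kolmogorovKernel ν τ) (kernelDeriv ν τ e y) y (kineticDir τ e) := by
  have hx := hasDerivAt_kineticDir_fst τ e y
  have hv := hasDerivAt_kineticDir_snd τ e y
  have h := ((((((hv.norm_sq.div_const τ).sub
    (((hv.inner ℝ hx).const_mul 3).div_const (τ ^ 2))).add
    ((hx.norm_sq.const_mul 3).div_const (τ ^ 3))).neg).div_const ν).exp).const_mul
      ((√3 / (2 * Real.pi * ν * τ ^ 2)) ^ d)
  refine h.congr_deriv ?_
  simp only [kernelDeriv, kolmogorovKernel, Pi.add_apply, Pi.sub_apply, Pi.neg_apply, zero_smul,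
    add_zero, inner_smul_right, real_inner_comm y.1 e]
  field_simp
  ring

lemma hasLineDerivAt_kernelDeriv {ν τ : ℝ} (hν : 0 < ν) (hτ : 0 < τ) (e : Vec d) (y : Slice d) :
    HasLineDerivAt ℝ (kernelDeriv ν τ e) (kernelDeriv₂ ν τ e y) y (kineticDir τ e) := by
  have hx := (hasDerivAt_kineticDir_fst τ e y).inner ℝ (hasDerivAt_const 0 e)
  have hv := (hasDerivAt_kineticDir_snd τ e y).inner ℝ (hasDerivAt_const 0 e)
  have h := ((((hv.div_const τ).sub ((hx.const_mul 3).div_const (τ ^ 2))).div_const ν).mul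
    (hasLineDerivAt_kolmogorovKernel hν hτ e y))
  refine h.congr_deriv ?_
  simp only [kernelDeriv₂, kernelDeriv, Pi.sub_apply, inner_zero_right, inner_smul_left,
    real_inner_self_eq_norm_sq, zero_smul, add_zero, zero_add, conj_trivial]
  field_simp
  ring

lemma HasSecondDiff.mollify_eq {ν τ : ℝ} (hν : 0 < ν) (hτ : 0 < τ) {H H₂ : Slice d → ℝ}
    {e : Vec d} (h : HasSecondDiff H (kineticDir τ e) H₂) (hH : Continuous H)
    (hs : HasCompactSupport H) (y : Slice d) :
    mollify ν τ H₂ y = ∫ y', H y' * kernelDeriv₂ ν τ e (y - y') := by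
  obtain ⟨B, hB⟩ := hs.exists_bound_of_continuous hH
  refine tendsto_nhds_unique (h.tendsto_mollify hH hB ν τ y) ?_
  rw [funext (mollify_eq_integral_kernel hν hτ hH hs)]
  exact tendsto_secondDiff_integral_mul_comp_sub hH hs (continuous_kolmogorovKernel ν τ)
    (hasLineDerivAt_kolmogorovKernel hν hτ e) (hasLineDerivAt_kernelDeriv hν hτ e)
    (continuous_kernelDeriv₂ ν τ e) y

lemma kernelLaplacian_eq {ν τ : ℝ} (hν : 0 < ν) (hτ : 0 < τ) (y : Slice d) :
    kernelLaplacian ν τ y =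
      ((‖y.2‖ ^ 2 / τ ^ 2 - 6 * inner ℝ y.2 y.1 / τ ^ 3 + 9 * ‖y.1‖ ^ 2 / τ ^ 4) / ν - 2 * d / τ) *
        kolmogorovKernel ν τ y := by
  have hsq : ∑ i, (inner ℝ y.2 (EuclideanSpace.single i (1 : ℝ)) / τ -
      3 * inner ℝ y.1 (EuclideanSpace.single i (1 : ℝ)) / τ ^ 2) ^ 2 =
      ‖y.2‖ ^ 2 / τ ^ 2 - 6 * inner ℝ y.2 y.1 / τ ^ 3 + 9 * ‖y.1‖ ^ 2 / τ ^ 4 := by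
    have hnorm : ‖y.2‖ ^ 2 / τ ^ 2 - 6 * inner ℝ y.2 y.1 / τ ^ 3 + 9 * ‖y.1‖ ^ 2 / τ ^ 4 =
        ‖τ⁻¹ • y.2 - (3 / τ ^ 2) • y.1‖ ^ 2 := by
      rw [norm_sub_sq_real, norm_smul, norm_smul, inner_smul_left, inner_smul_right, mul_pow,
        mul_pow, Real.norm_eq_abs, Real.norm_eq_abs, sq_abs, sq_abs, conj_trivial]
      field_simp
      ring
    rw [hnorm, EuclideanSpace.real_norm_sq_eq]
    refine Finset.sum_congr rfl fun i _ => ?_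
    simp only [EuclideanSpace.inner_single_right, PiLp.sub_apply, PiLp.smul_apply, smul_eq_mul,
      conj_trivial, one_mul]
    ring
  simp only [kernelLaplacian, kernelDeriv₂, ← Finset.sum_mul, Finset.sum_sub_distrib, div_pow,
    ← Finset.sum_div, hsq, PiLp.norm_single, norm_one, one_pow, Finset.sum_const,
    Finset.card_univ, Fintype.card_fin, nsmul_eq_mul]
  field_simp

lemma hasDerivAt_kernelPrefactor {ν τ : ℝ} (hν : 0 < ν) (hτ : 0 < τ) (n : ℕ) :
    HasDerivAt (fun τ : ℝ => (√3 / (2 * Real.pi * ν * τ ^ 2)) ^ n)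
      (-2 * n / τ * (√3 / (2 * Real.pi * ν * τ ^ 2)) ^ n) τ := by
  have hbase : HasDerivAt (fun τ : ℝ => √3 / (2 * Real.pi * ν * τ ^ 2))
      (-2 / τ * (√3 / (2 * Real.pi * ν * τ ^ 2))) τ := by
    refine ((hasDerivAt_const τ (√3 : ℝ)).fun_div
      ((hasDerivAt_pow 2 τ).const_mul (2 * Real.pi * ν)) (by positivity)).congr_deriv ?_
    simp only [Nat.cast_ofNat, Nat.add_one_sub_one, pow_one]
    field_simp
    ring
  refine (hbase.fun_pow n).congr_deriv ?_
  rcases n with _ | n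
  · simp
  · rw [Nat.add_sub_cancel, pow_succ]
    ring

lemma hasDerivAt_kernelExponent {τ : ℝ} (hτ : 0 < τ) (ν p q r : ℝ) :
    HasDerivAt (fun τ : ℝ => -(p / τ - 3 * q / τ ^ 2 + 3 * r / τ ^ 3) / ν)
      ((p / τ ^ 2 - 6 * q / τ ^ 3 + 9 * r / τ ^ 4) / ν) τ := by
  refine ((((((hasDerivAt_const τ p).fun_div (hasDerivAt_id' τ) hτ.ne').fun_sub
    ((hasDerivAt_const τ (3 * q)).fun_div (hasDerivAt_pow 2 τ) (by positivity))).fun_add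
    ((hasDerivAt_const τ (3 * r)).fun_div (hasDerivAt_pow 3 τ)
      (by positivity))).fun_neg).div_const ν).congr_deriv ?_
  simp only [Nat.cast_ofNat, Nat.add_one_sub_one, pow_one]
  field_simp
  ring

lemma hasDerivAt_kolmogorovKernel_time {ν τ : ℝ} (hν : 0 < ν) (hτ : 0 < τ) (y : Slice d) :
    HasDerivAt (fun τ => kolmogorovKernel ν τ y) (kernelLaplacian ν τ y) τ := by
  refine ((hasDerivAt_kernelPrefactor hν hτ d).fun_mul
    (hasDerivAt_kernelExponent hτ ν (‖y.2‖ ^ 2) (inner ℝ y.2 y.1) (‖y.1‖ ^ 2)).exp).congr_deriv ?_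
  rw [kernelLaplacian_eq hν hτ, kolmogorovKernel]
  ring

end KernelEquation

section StraightSolution

open fwdDiff

variable {d : ℕ}

lemma continuousOn_kolmogorovKernel_uncurry (ν : ℝ) :
    ContinuousOn (fun p : ℝ × Slice d => kolmogorovKernel ν p.1 p.2) (Ioi 0 ×ˢ univ) := by
  simp only [kolmogorovKernel, mul_assoc, div_eq_mul_inv, mul_inv]
  have hinv : ContinuousOn (fun p : ℝ × Slice d => p.1⁻¹) (Ioi 0 ×ˢ univ) :=
    continuousOn_fst.inv₀ fun p hp => ne_of_gt hp.1
  simp only [← inv_pow]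
  fun_prop

lemma continuousOn_kernelLaplacian_uncurry {ν : ℝ} (hν : 0 < ν) :
    ContinuousOn (fun p : ℝ × Slice d => kernelLaplacian ν p.1 p.2) (Ioi 0 ×ˢ univ) := by
  have hinv : ContinuousOn (fun p : ℝ × Slice d => p.1⁻¹) (Ioi 0 ×ˢ univ) :=
    continuousOn_fst.inv₀ fun p hp => ne_of_gt hp.1
  refine ContinuousOn.congr ?_ fun p hp => kernelLaplacian_eq hν hp.1 p.2
  refine ContinuousOn.mul ?_ (continuousOn_kolmogorovKernel_uncurry ν)
  simp only [div_eq_mul_inv, ← inv_pow]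
  fun_prop

lemma exists_kernel_bound {ν τ : ℝ} (hν : 0 < ν) (hτ : 0 < τ) (R : ℝ) (y : Slice d) :
    ∃ A A', ∀ σ ∈ Ioo (τ / 2) (2 * τ), ∀ y' ∈ Metric.closedBall (0 : Slice d) R,
      |kolmogorovKernel ν σ (y - y')| ≤ A ∧ |kernelLaplacian ν σ (y - y')| ≤ A' := by
  have hcpt : IsCompact (Icc (τ / 2) (2 * τ) ×ˢ Metric.closedBall (0 : Slice d) R) :=
    isCompact_Icc.prod (isCompact_closedBall 0 R)
  have hmaps : MapsTo (fun p : ℝ × Slice d => (p.1, y - p.2))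
      (Icc (τ / 2) (2 * τ) ×ˢ Metric.closedBall (0 : Slice d) R) (Ioi 0 ×ˢ univ) := fun p hp =>
    ⟨mem_Ioi.mpr (by linarith [hp.1.1]), mem_univ _⟩
  obtain ⟨A, hA⟩ := hcpt.exists_bound_of_continuousOn
    ((continuousOn_kolmogorovKernel_uncurry ν).comp (by fun_prop) hmaps)
  obtain ⟨A', hA'⟩ := hcpt.exists_bound_of_continuousOn
    ((continuousOn_kernelLaplacian_uncurry hν).comp (by fun_prop) hmaps)
  exact ⟨A, A', fun σ hσ y' hy' => ⟨hA (σ, y') ⟨⟨hσ.1.le, hσ.2.le⟩, hy'⟩,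
    hA' (σ, y') ⟨⟨hσ.1.le, hσ.2.le⟩, hy'⟩⟩⟩

/-- Solutions of the kinetic equation in coordinates straightened along the transport field, with
time counted backwards from a final time: `F τ (x, v) = f (t - τ, x - τ v, v)`. Here `F₁` is the
transport derivative, `F₂ τ e` the second derivative in `v` in direction `e`, and the diffusion
matrix at time `τ` is `ν Id + ∑ k, u τ k ⊗ u τ k`. -/
structure StraightSolution (ν : ℝ) (u : ℝ → Fin d → Vec d) (F F₁ G : ℝ → Slice d → ℝ)
    (F₂ : ℝ → Vec d → Slice d → ℝ) : Prop where
  continuousOn : ContinuousOn (fun p : ℝ × Slice d => F p.1 p.2) (Ici 0 ×ˢ univ)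
  continuous₁ : ∀ τ > 0, Continuous (F₁ τ)
  continuous₂ : ∀ τ > 0, ∀ e, Continuous (F₂ τ e)
  bound : ∃ B, ∀ τ ≥ 0, ∀ y, |F τ y| ≤ B
  bound₁ : ∃ B, ∀ τ > 0, ∀ y, |F₁ τ y| ≤ B
  bound₂ : ∀ e, ∃ B, ∀ τ > 0, ∀ y, |F₂ τ e y| ≤ B
  support : ∃ R, ∀ τ ≥ 0, ∀ y, R < ‖y‖ → F τ y = 0 ∧ F₁ τ y = 0 ∧ ∀ e, F₂ τ e y = 0
  hasDerivAt : ∀ τ > 0, ∀ y, HasDerivAt (fun τ => F τ y) (-F₁ τ y) τ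
  secondDiff : ∀ τ ≥ 0, ∀ e, HasSecondDiff (F τ) (kineticDir τ e) (F₂ τ e)
  equation : ∀ τ > 0, ∀ y, F₁ τ y = ν * ∑ i, F₂ τ (EuclideanSpace.single i 1) y
    + ∑ k, F₂ τ (u τ k) y + G τ y
  initial : ∀ τ ≥ 1, ∀ y, F τ y = 0

namespace StraightSolution

variable {ν : ℝ} {u : ℝ → Fin d → Vec d} {F F₁ G : ℝ → Slice d → ℝ}
  {F₂ : ℝ → Vec d → Slice d → ℝ}

lemma continuous (h : StraightSolution ν u F F₁ G F₂) {τ : ℝ} (hτ : 0 ≤ τ) :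
    Continuous (F τ) :=
  continuousOn_univ.mp <| h.continuousOn.comp (f := fun y : Slice d => (τ, y)) (by fun_prop)
    fun y _ => ⟨hτ, mem_univ _⟩

lemma fwdDiff (h : StraightSolution ν u F F₁ G F₂) (a : Slice d) :
    StraightSolution ν u (fun τ => Δ_[a] (F τ)) (fun τ => Δ_[a] (F₁ τ)) (fun τ => Δ_[a] (G τ))
      (fun τ e => Δ_[a] (F₂ τ e)) where
  continuousOn := by
    refine ContinuousOn.sub ?_ h.continuousOn
    exact h.continuousOn.comp (f := fun p : ℝ × Slice d => (p.1, p.2 + a)) (by fun_prop)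
      fun p hp => ⟨hp.1, mem_univ _⟩
  continuous₁ τ hτ := ((h.continuous₁ τ hτ).comp (continuous_add_const a)).sub (h.continuous₁ τ hτ)
  continuous₂ τ hτ e :=
    ((h.continuous₂ τ hτ e).comp (continuous_add_const a)).sub (h.continuous₂ τ hτ e)
  bound := by
    obtain ⟨B, hB⟩ := h.bound
    exact ⟨B + B, fun τ hτ y => (abs_sub _ _).trans (add_le_add (hB τ hτ _) (hB τ hτ y))⟩
  bound₁ := by
    obtain ⟨B, hB⟩ := h.bound₁
    exact ⟨B + B, fun τ hτ y => (abs_sub _ _).trans (add_le_add (hB τ hτ _) (hB τ hτ y))⟩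
  bound₂ e := by
    obtain ⟨B, hB⟩ := h.bound₂ e
    exact ⟨B + B, fun τ hτ y => (abs_sub _ _).trans (add_le_add (hB τ hτ _) (hB τ hτ y))⟩
  support := by
    obtain ⟨R, hR⟩ := h.support
    refine ⟨R + ‖a‖, fun τ hτ y hy => ?_⟩
    have hya := norm_sub_le (y + a) a
    rw [add_sub_cancel_right] at hya
    obtain ⟨h0, h1, h2⟩ := hR τ hτ y (by linarith [norm_nonneg a])
    obtain ⟨ha0, ha1, ha2⟩ := hR τ hτ (y + a) (by linarith)
    simp only [_root_.fwdDiff, h0, h1, h2, ha0, ha1, ha2, sub_zero, implies_true, and_self]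
  hasDerivAt τ hτ y :=
    ((h.hasDerivAt τ hτ (y + a)).fun_sub (h.hasDerivAt τ hτ y)).congr_deriv
      (by rw [_root_.fwdDiff]; ring)
  secondDiff τ hτ e := (h.secondDiff τ hτ e).fwdDiff a
  equation τ hτ y := by
    simp only [_root_.fwdDiff, h.equation τ hτ, Finset.sum_sub_distrib]
    ring
  initial τ hτ y := by simp only [_root_.fwdDiff, h.initial τ hτ, sub_zero]

lemma hasCompactSupport (h : StraightSolution ν u F F₁ G F₂) {τ : ℝ} (hτ : 0 ≤ τ) :
    HasCompactSupport (F τ) := by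
  obtain ⟨R, hR⟩ := h.support
  exact HasCompactSupport.intro (isCompact_closedBall 0 R) fun y hy =>
    (hR τ hτ y (by simpa using hy)).1

lemma hasCompactSupport₁ (h : StraightSolution ν u F F₁ G F₂) {τ : ℝ} (hτ : 0 ≤ τ) :
    HasCompactSupport (F₁ τ) := by
  obtain ⟨R, hR⟩ := h.support
  exact HasCompactSupport.intro (isCompact_closedBall 0 R) fun y hy =>
    (hR τ hτ y (by simpa using hy)).2.1

lemma continuous_source (h : StraightSolution ν u F F₁ G F₂) {τ : ℝ} (hτ : 0 < τ) :
    Continuous (G τ) := by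
  have hG : G τ = fun y => F₁ τ y - (ν * ∑ i, F₂ τ (EuclideanSpace.single i 1) y
      + ∑ k, F₂ τ (u τ k) y) := by
    ext y
    rw [h.equation τ hτ y, add_sub_cancel_left]
  have h1 := h.continuous₁ τ hτ
  have h2 := h.continuous₂ τ hτ
  rw [hG]
  fun_prop

lemma bound_source (h : StraightSolution ν u F F₁ G F₂) {τ : ℝ} (hτ : 0 < τ) :
    ∃ B, ∀ y, |G τ y| ≤ B := by
  refine HasCompactSupport.exists_bound_of_continuous ?_ (h.continuous_source hτ)
  obtain ⟨R, hR⟩ := h.support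
  refine HasCompactSupport.intro (isCompact_closedBall 0 R) fun y hy => ?_
  obtain ⟨-, h1, h2⟩ := hR τ hτ.le y (by simpa using hy)
  simpa only [h1, h2, Finset.sum_const_zero, mul_zero, zero_add] using (h.equation τ hτ y).symm

lemma mollify_equation (h : StraightSolution ν u F F₁ G F₂) {τ : ℝ} (hτ : 0 < τ)
    (y : Slice d) :
    mollify ν τ (F₁ τ) y = ν * ∑ i, mollify ν τ (F₂ τ (EuclideanSpace.single i 1)) y
      + ∑ k, mollify ν τ (F₂ τ (u τ k)) y + mollify ν τ (G τ) y := by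
  obtain ⟨B, hB⟩ := h.bound_source hτ
  have hiG := integrable_mollify (h.continuous_source hτ) hB ν τ y
  have hi₂ : ∀ e, Integrable fun z => F₂ τ e (y - spread ν τ z) * gaussDensity z := fun e =>
    let ⟨_, hB₂⟩ := h.bound₂ e
    integrable_mollify (h.continuous₂ τ hτ e) (hB₂ τ hτ) ν τ y
  have hiν := (integrable_finsetSum Finset.univ
    fun i _ => hi₂ (EuclideanSpace.single i 1)).const_mul ν
  have hiu := integrable_finsetSum Finset.univ fun k _ => hi₂ (u τ k)
  simp only [mollify, h.equation τ hτ, add_mul, mul_assoc, Finset.sum_mul]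
  rw [integral_add (hiν.fun_add hiu) hiG, integral_add hiν hiu, integral_const_mul,
    integral_finsetSum _ fun i _ => hi₂ _, integral_finsetSum _ fun k _ => hi₂ _]

lemma integral_mul_kernelLaplacian (h : StraightSolution ν u F F₁ G F₂) (hν : 0 < ν) {τ : ℝ}
    (hτ : 0 < τ) (y : Slice d) :
    ∫ y', F τ y' * kernelLaplacian ν τ (y - y') =
      ν * ∑ i, mollify ν τ (F₂ τ (EuclideanSpace.single i 1)) y := by
  have hi : ∀ e, Integrable fun y' => F τ y' * kernelDeriv₂ ν τ e (y - y') := fun e =>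
    integrable_mul_comp_sub (h.continuous hτ.le) (h.hasCompactSupport hτ.le)
      (continuous_kernelDeriv₂ ν τ e) y
  simp_rw [(h.secondDiff τ hτ.le _).mollify_eq hν hτ (h.continuous hτ.le)
    (h.hasCompactSupport hτ.le) y]
  rw [← integral_finsetSum _ fun i _ => hi _, ← integral_const_mul]
  simp only [kernelLaplacian, ← Finset.mul_sum, mul_left_comm ν]

lemma hasDerivAt_integral_mul_kernel (h : StraightSolution ν u F F₁ G F₂) (hν : 0 < ν) {τ : ℝ}
    (hτ : 0 < τ) (y : Slice d) :
    HasDerivAt (fun τ => ∫ y', F τ y' * kolmogorovKernel ν τ (y - y'))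
      (∫ y', (-F₁ τ y' * kolmogorovKernel ν τ (y - y') +
        F τ y' * kernelLaplacian ν τ (y - y'))) τ := by
  obtain ⟨B, hB⟩ := h.bound
  obtain ⟨B₁, hB₁⟩ := h.bound₁
  obtain ⟨R, hR⟩ := h.support
  obtain ⟨A, A', hA⟩ := exists_kernel_bound hν hτ R y
  have hK := fun τ => continuous_kolmogorovKernel (d := d) ν τ
  have hK' := continuous_kernelLaplacian (d := d) ν τ
  have hF₁ := h.continuous₁ τ hτ
  have hF := h.continuous hτ.le
  refine (hasDerivAt_integral_of_dominated_loc_of_deriv_le (μ := volume)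
    (F := fun τ y' => F τ y' * kolmogorovKernel ν τ (y - y'))
    (F' := fun τ y' => -F₁ τ y' * kolmogorovKernel ν τ (y - y') +
      F τ y' * kernelLaplacian ν τ (y - y'))
    (bound := (Metric.closedBall (0 : Slice d) R).indicator fun _ => B₁ * A + B * A')
    (Ioo_mem_nhds (by linarith) (by linarith) : Ioo (τ / 2) (2 * τ) ∈ 𝓝 τ) ?_
    (integrable_mul_comp_sub hF (h.hasCompactSupport hτ.le) (hK τ) y)
    (Continuous.aestronglyMeasurable (by fun_prop)) (ae_of_all _ fun y' σ hσ => ?_) ?_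
    (ae_of_all _ fun y' σ hσ => ?_)).2
  · filter_upwards [Ioi_mem_nhds hτ] with σ (hσ : 0 < σ)
    exact (integrable_mul_comp_sub (h.continuous hσ.le) (h.hasCompactSupport hσ.le) (hK σ)
      y).aestronglyMeasurable
  · have hσ0 : 0 < σ := by linarith [hσ.1]
    by_cases hy : y' ∈ Metric.closedBall (0 : Slice d) R
    · rw [indicator_of_mem hy]
      refine (norm_add_le _ _).trans (add_le_add ?_ ?_)
      · rw [norm_mul, norm_neg]
        exact mul_le_mul (hB₁ σ hσ0 y') (hA σ hσ y' hy).1 (norm_nonneg _)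
          ((abs_nonneg _).trans (hB₁ σ hσ0 y'))
      · rw [norm_mul]
        exact mul_le_mul (hB σ hσ0.le y') (hA σ hσ y' hy).2 (norm_nonneg _)
          ((abs_nonneg _).trans (hB σ hσ0.le y'))
    · obtain ⟨h0, h1, -⟩ := hR σ hσ0.le y' (by simpa using hy)
      simp [indicator_of_notMem hy, h0, h1]
  · exact (integrableOn_const (isCompact_closedBall _ _).measure_lt_top.ne).integrable_indicator
      measurableSet_closedBall
  · have hσ0 : 0 < σ := by linarith [hσ.1]
    exact (h.hasDerivAt σ hσ0 y').fun_mul (hasDerivAt_kolmogorovKernel_time hν hσ0 (y - y'))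

lemma hasDerivAt_mollify (h : StraightSolution ν u F F₁ G F₂) (hν : 0 < ν) {τ : ℝ}
    (hτ : 0 < τ) (y : Slice d) :
    HasDerivAt (fun τ => mollify ν τ (F τ) y)
      (-(∑ k, mollify ν τ (F₂ τ (u τ k)) y + mollify ν τ (G τ) y)) τ := by
  have hker : (fun τ => mollify ν τ (F τ) y) =ᶠ[𝓝 τ]
      fun τ => ∫ y', F τ y' * kolmogorovKernel ν τ (y - y') := by
    filter_upwards [Ioi_mem_nhds hτ] with σ (hσ : 0 < σ)
    exact mollify_eq_integral_kernel hν hσ (h.continuous hσ.le) (h.hasCompactSupport hσ.le) y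
  refine ((h.hasDerivAt_integral_mul_kernel hν hτ y).congr_of_eventuallyEq hker).congr_deriv ?_
  have hi₁ := integrable_mul_comp_sub (h.continuous₁ τ hτ) (h.hasCompactSupport₁ hτ.le)
    (continuous_kolmogorovKernel ν τ) y
  have hi := integrable_mul_comp_sub (h.continuous hτ.le) (h.hasCompactSupport hτ.le)
    (continuous_kernelLaplacian ν τ) y
  simp only [neg_mul]
  rw [integral_add hi₁.fun_neg hi, integral_neg, h.integral_mul_kernelLaplacian hν hτ,
    ← mollify_eq_integral_kernel hν hτ (h.continuous₁ τ hτ) (h.hasCompactSupport₁ hτ.le),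
    h.mollify_equation hτ]
  ring

end StraightSolution

end StraightSolution

section MaximumPrinciple

variable {d : ℕ}

lemma continuous_mollify {H : Slice d → ℝ} (hH : Continuous H) {B : ℝ} (hB : ∀ y, |H y| ≤ B)
    (ν τ : ℝ) : Continuous (mollify ν τ H) := by
  exact continuous_of_dominated (bound := fun z => B * gaussDensity z)
    (fun y => (integrable_mollify hH hB ν τ y).aestronglyMeasurable)
    (fun y => ae_of_all _ fun z => norm_mul_gaussDensity_le (hB _) z)
    (integrable_gaussDensity.const_mul B) (ae_of_all _ fun z => by fun_prop)

lemma tendsto_mollify_cocompact {H : Slice d → ℝ} (hH : Continuous H) (hs : HasCompactSupport H)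
    (ν τ : ℝ) : Tendsto (mollify ν τ H) (cocompact (Slice d)) (𝓝 0) := by
  obtain ⟨B, hB⟩ := hs.exists_bound_of_continuous hH
  have hcg : (cocompact (Slice d)).IsCountablyGenerated := by
    rw [← Metric.cobounded_eq_cocompact, ← comap_norm_atTop]
    infer_instance
  have h0 : (0 : ℝ) = ∫ z : Slice d, (0 : ℝ) * gaussDensity z := by
    simp only [zero_mul, integral_zero]
  rw [h0]
  refine tendsto_integral_filter_of_dominated_convergence (fun z => B * gaussDensity z)
    (Eventually.of_forall fun y => (integrable_mollify hH hB ν τ y).aestronglyMeasurable)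
    (Eventually.of_forall fun y => ae_of_all _ fun z => norm_mul_gaussDensity_le (hB _) z)
    (integrable_gaussDensity.const_mul B) (ae_of_all _ fun z => Tendsto.mul_const _ ?_)
  exact hs.is_zero_at_infty.comp
    (Homeomorph.subRight (spread ν τ z)).isClosedEmbedding.tendsto_cocompact

/-- The positive part of the maximum at time `τ` of a solution averaged against the Kolmogorov
kernel. -/
noncomputable def peak (ν : ℝ) (F : ℝ → Slice d → ℝ) (τ : ℝ) : ℝ :=
  ⨆ y, max (mollify ν τ (F τ) y) 0

lemma peak_nonneg (ν : ℝ) (F : ℝ → Slice d → ℝ) (τ : ℝ) : 0 ≤ peak ν F τ :=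
  Real.iSup_nonneg fun _ => le_max_right _ _

lemma peak_le {ν : ℝ} {F : ℝ → Slice d → ℝ} {τ b : ℝ} (hb : 0 ≤ b)
    (h : ∀ y, mollify ν τ (F τ) y ≤ b) : peak ν F τ ≤ b :=
  ciSup_le fun y => max_le (h y) hb

namespace StraightSolution

variable {ν : ℝ} {u : ℝ → Fin d → Vec d} {F F₁ G : ℝ → Slice d → ℝ}
  {F₂ : ℝ → Vec d → Slice d → ℝ}

lemma le_peak (h : StraightSolution ν u F F₁ G F₂) {τ : ℝ} (hτ : 0 ≤ τ) (y : Slice d) :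
    mollify ν τ (F τ) y ≤ peak ν F τ := by
  obtain ⟨B, hB⟩ := h.bound
  have hbdd : BddAbove (range fun y => max (mollify ν τ (F τ) y) 0) :=
    ⟨max B 0, forall_mem_range.mpr fun y =>
      max_le_max_right 0 ((le_abs_self _).trans (abs_mollify_le (hB τ hτ) ν τ y))⟩
  exact (le_max_left _ 0).trans (le_ciSup hbdd y)

lemma exists_eq_peak (h : StraightSolution ν u F F₁ G F₂) {τ : ℝ} (hτ : 0 ≤ τ)
    (hp : 0 < peak ν F τ) : ∃ y, mollify ν τ (F τ) y = peak ν F τ := by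
  obtain ⟨B, hB⟩ := h.bound
  have hc := continuous_mollify (h.continuous hτ) (hB τ hτ) ν τ
  obtain ⟨y₀, hy₀⟩ : ∃ y₀, 0 < mollify ν τ (F τ) y₀ := by
    by_contra! hcon
    exact absurd (peak_le le_rfl hcon) (not_le.mpr hp)
  have hev : ∀ᶠ y in cocompact (Slice d), mollify ν τ (F τ) y ≤ mollify ν τ (F τ) y₀ :=
    ((tendsto_mollify_cocompact (h.continuous hτ) (h.hasCompactSupport hτ) ν
      τ).eventually_lt_const hy₀).mono fun _ => le_of_lt
  obtain ⟨y, hy⟩ := hc.exists_forall_ge' y₀ hev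
  exact ⟨y, le_antisymm (h.le_peak hτ y) (peak_le (hy₀.le.trans (hy y₀)) hy)⟩

lemma mollify_second_nonpos (h : StraightSolution ν u F F₁ G F₂) {τ : ℝ} (hτ : 0 < τ)
    {y : Slice d} (hy : ∀ y', mollify ν τ (F τ) y' ≤ mollify ν τ (F τ) y) (e : Vec d) :
    mollify ν τ (F₂ τ e) y ≤ 0 := by
  obtain ⟨B, hB⟩ := h.bound
  refine le_of_tendsto ((h.secondDiff τ hτ.le e).tendsto_mollify (h.continuous hτ.le)
    (hB τ hτ.le) ν τ y) (Eventually.of_forall fun ε => ?_)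
  refine div_nonpos_of_nonpos_of_nonneg ?_ (sq_nonneg ε)
  rw [_root_.secondDiff]
  linarith [hy (y + ε • kineticDir τ e), hy (y - ε • kineticDir τ e)]

lemma exists_abs_mollify_sub_le (h : StraightSolution ν u F F₁ G F₂) (hν : 0 < ν) :
    ∃ K ≥ 0, ∀ σ > 0, ∀ τ > 0, ∀ y,
      |mollify ν τ (F τ) y - mollify ν σ (F σ) y| ≤ K * |τ - σ| := by
  obtain ⟨B₁, hB₁⟩ := h.bound₁
  choose B₂ hB₂ using h.bound₂
  have hrate : ∀ τ > 0, ∀ y, |-(∑ k, mollify ν τ (F₂ τ (u τ k)) y + mollify ν τ (G τ) y)| ≤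
      ν * ∑ i, B₂ (EuclideanSpace.single i 1) + B₁ := fun τ hτ y => by
    have heq : -(∑ k, mollify ν τ (F₂ τ (u τ k)) y + mollify ν τ (G τ) y)
        = ν * ∑ i, mollify ν τ (F₂ τ (EuclideanSpace.single i 1)) y - mollify ν τ (F₁ τ) y := by
      rw [h.mollify_equation hτ]
      ring
    rw [heq]
    refine (abs_sub _ _).trans (add_le_add ?_ (abs_mollify_le (hB₁ τ hτ) ν τ y))
    rw [abs_mul, abs_of_pos hν]
    exact mul_le_mul_of_nonneg_left ((Finset.abs_sum_le_sum_abs _ _).trans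
      (Finset.sum_le_sum fun i _ => abs_mollify_le (hB₂ _ τ hτ) ν τ y)) hν.le
  exact ⟨_, (abs_nonneg _).trans (hrate 1 one_pos 0), fun σ hσ τ hτ y =>
    Convex.norm_image_sub_le_of_norm_hasDerivWithin_le
      (fun τ hτ => (h.hasDerivAt_mollify hν hτ y).hasDerivWithinAt) (fun τ hτ => hrate τ hτ y)
      (convex_Ioi 0) hσ hτ⟩

lemma continuousOn_peak (h : StraightSolution ν u F F₁ G F₂) (hν : 0 < ν) :
    ContinuousOn (peak ν F) (Ioi 0) := by
  obtain ⟨K, hK0, hK⟩ := h.exists_abs_mollify_sub_le hν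
  have hlip : ∀ σ > 0, ∀ τ > 0, peak ν F τ ≤ peak ν F σ + K * |τ - σ| := by
    intro σ hσ τ hτ
    refine peak_le (add_nonneg (peak_nonneg _ _ _) (by positivity)) fun y => ?_
    linarith [(abs_le.mp (hK σ hσ τ hτ y)).2, h.le_peak hσ.le y]
  refine (LipschitzOnWith.of_dist_le_mul (K := K.toNNReal) fun σ hσ τ hτ => ?_).continuousOn
  rw [Real.coe_toNNReal K hK0, Real.dist_eq, Real.dist_eq, abs_sub_le_iff]
  have hτσ := hlip σ hσ τ hτ
  rw [abs_sub_comm] at hτσ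
  exact ⟨by linarith [hlip τ hτ σ hσ], by linarith⟩

lemma eventually_slope_neg_peak_lt (h : StraightSolution ν u F F₁ G F₂) (hν : 0 < ν) {τ b r : ℝ}
    (hτ : 0 < τ) (hb : 0 ≤ b) (hbr : b < r) (hG : ∀ y, mollify ν τ (G τ) y ≤ b) :
    ∀ᶠ σ in 𝓝[>] τ, slope (fun τ => -peak ν F τ) τ σ < r := by
  rcases (peak_nonneg ν F τ).eq_or_lt with hp | hp
  · filter_upwards [self_mem_nhdsWithin] with σ hσ
    rw [slope_def_field, ← hp]
    refine lt_of_le_of_lt (div_nonpos_of_nonpos_of_nonneg ?_ (sub_pos.mpr hσ).le)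
      (hb.trans_lt hbr)
    linarith [peak_nonneg ν F σ]
  · obtain ⟨y, hy⟩ := h.exists_eq_peak hτ.le hp
    have hmax : ∀ y', mollify ν τ (F τ) y' ≤ mollify ν τ (F τ) y := fun y' =>
      (h.le_peak hτ.le y').trans_eq hy.symm
    have hlt : -(-(∑ k, mollify ν τ (F₂ τ (u τ k)) y + mollify ν τ (G τ) y)) < r := by
      linarith [hG y, Finset.sum_nonpos fun k (_ : k ∈ Finset.univ) =>
        h.mollify_second_nonpos hτ hmax (u τ k)]
    have hslope := (hasDerivAt_iff_tendsto_slope.mp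
      (h.hasDerivAt_mollify hν hτ y).fun_neg).mono_left (nhdsGT_le_nhdsNE τ)
    filter_upwards [hslope.eventually_lt_const hlt, self_mem_nhdsWithin] with σ hσ hτσ
    refine lt_of_le_of_lt ?_ hσ
    rw [slope_def_field, slope_def_field, hy]
    refine div_le_div_of_nonneg_right ?_ (sub_pos.mpr hτσ).le
    linarith [h.le_peak (hτ.trans hτσ).le y]

lemma peak_le_add (h : StraightSolution ν u F F₁ G F₂) (hν : 0 < ν) {τ₁ τ₂ : ℝ}
    (h1 : 0 < τ₁) (h12 : τ₁ ≤ τ₂) {β β' : ℝ → ℝ}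
    (hβ : ∀ τ ∈ Icc τ₁ τ₂, HasDerivAt β (β' τ) τ) (hβ' : ∀ τ ∈ Icc τ₁ τ₂, 0 ≤ β' τ)
    (hG : ∀ τ ∈ Icc τ₁ τ₂, ∀ y, mollify ν τ (G τ) y ≤ β' τ) :
    peak ν F τ₁ ≤ peak ν F τ₂ + (β τ₂ - β τ₁) := by
  have hend : -peak ν F τ₂ ≤ β τ₂ - (β τ₁ + peak ν F τ₁) := by
    refine image_le_of_liminf_slope_right_le_deriv_boundary (f := fun τ => -peak ν F τ)
      (B := fun τ => β τ - (β τ₁ + peak ν F τ₁)) (B' := β')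
      ((h.continuousOn_peak hν).neg.mono fun τ hτ => h1.trans_le hτ.1) (by linarith)
      (fun τ hτ => ((hβ τ hτ).continuousAt.sub continuousAt_const).continuousWithinAt)
      (fun τ hτ => ((hβ τ ⟨hτ.1, hτ.2.le⟩).sub_const _).hasDerivWithinAt) (fun τ hτ r hr => ?_)
      (right_mem_Icc.mpr h12)
    have hτI : τ ∈ Icc τ₁ τ₂ := ⟨hτ.1, hτ.2.le⟩
    exact (h.eventually_slope_neg_peak_lt hν (h1.trans_le hτ.1) (hβ' τ hτI) hr
      (hG τ hτI)).frequently
  linarith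

lemma peak_eq_zero (h : StraightSolution ν u F F₁ G F₂) {τ : ℝ} (hτ : 1 ≤ τ) :
    peak ν F τ = 0 :=
  le_antisymm (peak_le le_rfl fun y => by simp [mollify, h.initial τ hτ]) (peak_nonneg _ _ _)

lemma tendsto_mollify_zero (h : StraightSolution ν u F F₁ G F₂) (y : Slice d) :
    Tendsto (fun τ => mollify ν τ (F τ) y) (𝓝[>] 0) (𝓝 (F 0 y)) := by
  obtain ⟨B, hB⟩ := h.bound
  have hint : F 0 y = ∫ z : Slice d, F 0 y * gaussDensity z := by
    rw [integral_const_mul, integral_gaussDensity, mul_one]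
  rw [hint]
  refine tendsto_integral_filter_of_dominated_convergence (fun z => B * gaussDensity z)
    ?_ ?_ (integrable_gaussDensity.const_mul B) (ae_of_all _ fun z => Tendsto.mul_const _ ?_)
  · filter_upwards [self_mem_nhdsWithin] with τ (hτ : 0 < τ)
    exact (integrable_mollify (h.continuous hτ.le) (hB τ hτ.le) ν τ y).aestronglyMeasurable
  · filter_upwards [self_mem_nhdsWithin] with τ (hτ : 0 < τ)
    exact ae_of_all _ fun z => norm_mul_gaussDensity_le (hB τ hτ.le _) z
  · have hF : Tendsto (fun p : ℝ × Slice d => F p.1 p.2) (𝓝[Ici 0 ×ˢ univ] (0, y))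
        (𝓝 (F 0 y)) := h.continuousOn (0, y) ⟨self_mem_Ici, mem_univ _⟩
    have hpath : Tendsto (fun τ : ℝ => (τ, y - spread ν τ z)) (𝓝[>] 0) (𝓝 (0, y)) := by
      have hcont : Continuous fun τ : ℝ => (τ, y - spread ν τ z) := by
        simp only [spread_apply]
        fun_prop
      simpa [spread_apply, Prod.mk_zero_zero] using (hcont.tendsto 0).mono_left nhdsWithin_le_nhds
    refine hF.comp (tendsto_nhdsWithin_iff.mpr ⟨hpath, ?_⟩)
    filter_upwards [self_mem_nhdsWithin] with τ hτ
    exact ⟨Ioi_subset_Ici_self hτ, mem_univ _⟩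

lemma le_of_peak_le (h : StraightSolution ν u F F₁ G F₂) {b δ : ℝ} (hδ : 0 < δ)
    (hb : ∀ τ ∈ Ioo 0 δ, peak ν F τ ≤ b) (y : Slice d) : F 0 y ≤ b := by
  refine le_of_tendsto (h.tendsto_mollify_zero y) ?_
  filter_upwards [Ioo_mem_nhdsGT hδ] with τ hτ
  exact (h.le_peak hτ.1.le y).trans (hb τ hτ)

end StraightSolution

end MaximumPrinciple

section GaussianDifferences

open fwdDiff

variable {d : ℕ}

/-- The Euclidean inner product with `a` on `ℝᵈ × ℝᵈ`, whose own norm is the sup norm. -/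
noncomputable def sliceInner (a : Slice d) : Slice d →L[ℝ] ℝ :=
  (innerSL ℝ a.1).coprod (innerSL ℝ a.2)

lemma sliceInner_apply (a z : Slice d) :
    sliceInner a z = inner ℝ a.1 z.1 + inner ℝ a.2 z.2 := rfl

lemma abs_sliceInner_le (a z : Slice d) : |sliceInner a z| ≤ 2 * ‖a‖ * ‖z‖ := by
  have h₁ : |inner ℝ a.1 z.1| ≤ ‖a‖ * ‖z‖ := (abs_real_inner_le_norm _ _).trans
    (mul_le_mul (norm_fst_le a) (norm_fst_le z) (norm_nonneg _) (norm_nonneg _))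
  have h₂ : |inner ℝ a.2 z.2| ≤ ‖a‖ * ‖z‖ := (abs_real_inner_le_norm _ _).trans
    (mul_le_mul (norm_snd_le a) (norm_snd_le z) (norm_nonneg _) (norm_nonneg _))
  rw [sliceInner_apply]
  linarith [abs_add_le (inner ℝ a.1 z.1) (inner ℝ a.2 z.2)]

/-- The derivative of `gaussDensity` in direction `k`. -/
noncomputable def gaussDeriv (k z : Slice d) : ℝ :=
  -2 * sliceInner k z * gaussDensity z

/-- The second derivative of `gaussDensity` in directions `k` and `a`. -/
noncomputable def gaussDeriv₂ (k a z : Slice d) : ℝ :=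
  (4 * sliceInner k z * sliceInner a z - 2 * sliceInner k a) * gaussDensity z

/-- The third derivative of `gaussDensity` in directions `k`, `a` and `a`. -/
noncomputable def gaussDeriv₃ (k a z : Slice d) : ℝ :=
  (8 * sliceInner k a * sliceInner a z + 4 * sliceInner k z * sliceInner a a -
    8 * sliceInner k z * sliceInner a z ^ 2) * gaussDensity z

lemma hasLineDerivAt_gaussDensity (k z : Slice d) :
    HasLineDerivAt ℝ gaussDensity (gaussDeriv k z) z k := by
  have hx : HasDerivAt (fun r : ℝ => (z + r • k).1) k.1 0 := by
    simpa using ((hasDerivAt_id (0 : ℝ)).smul_const k.1).const_add z.1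
  have hv : HasDerivAt (fun r : ℝ => (z + r • k).2) k.2 0 := by
    simpa using ((hasDerivAt_id (0 : ℝ)).smul_const k.2).const_add z.2
  refine HasDerivAt.congr_deriv
    ((hx.norm_sq.fun_add hv.norm_sq).fun_neg.exp.const_mul (Real.pi ^ d)⁻¹) ?_
  simp only [gaussDeriv, gaussDensity, sliceInner_apply, zero_smul, add_zero,
    real_inner_comm k.1, real_inner_comm k.2]
  ring

lemma hasLineDerivAt_gaussDeriv (k a z : Slice d) :
    HasLineDerivAt ℝ (gaussDeriv k) (gaussDeriv₂ k a z) z a := by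
  have hk : HasDerivAt _ _ _ := ((sliceInner k).hasFDerivAt (x := z)).hasLineDerivAt a
  have hg : HasDerivAt _ _ _ := hasLineDerivAt_gaussDensity a z
  refine ((hk.const_mul (-2)).fun_mul hg).congr_deriv ?_
  simp only [gaussDeriv₂, gaussDeriv, zero_smul, add_zero]
  ring

lemma hasLineDerivAt_gaussDeriv₂ (k a z : Slice d) :
    HasLineDerivAt ℝ (gaussDeriv₂ k a) (gaussDeriv₃ k a z) z a := by
  have hk : HasDerivAt _ _ _ := ((sliceInner k).hasFDerivAt (x := z)).hasLineDerivAt a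
  have ha : HasDerivAt _ _ _ := ((sliceInner a).hasFDerivAt (x := z)).hasLineDerivAt a
  have hg : HasDerivAt _ _ _ := hasLineDerivAt_gaussDensity a z
  refine ((((hk.const_mul 4).fun_mul ha).sub_const _).fun_mul hg).congr_deriv ?_
  simp only [gaussDeriv₃, gaussDeriv, zero_smul, add_zero]
  ring

lemma abs_gaussDeriv_le (k z : Slice d) :
    |gaussDeriv k z| ≤ 64 * (1 + ‖z‖) ^ 3 * gaussDensity z * ‖k‖ := by
  have hpoly : 4 * ‖z‖ ≤ 64 * (1 + ‖z‖) ^ 3 := by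
    nlinarith [norm_nonneg z, pow_nonneg (norm_nonneg z) 2, pow_nonneg (norm_nonneg z) 3]
  calc |gaussDeriv k z| = 2 * |sliceInner k z| * gaussDensity z := by
        rw [gaussDeriv, abs_mul, abs_mul, abs_neg, abs_two, abs_of_pos (gaussDensity_pos z)]
    _ ≤ 2 * (2 * ‖k‖ * ‖z‖) * gaussDensity z :=
        mul_le_mul_of_nonneg_right
          (mul_le_mul_of_nonneg_left (abs_sliceInner_le k z) zero_le_two) (gaussDensity_pos z).le
    _ = 4 * ‖z‖ * (gaussDensity z * ‖k‖) := by ring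
    _ ≤ 64 * (1 + ‖z‖) ^ 3 * (gaussDensity z * ‖k‖) :=
        mul_le_mul_of_nonneg_right hpoly (mul_nonneg (gaussDensity_pos z).le (norm_nonneg k))
    _ = 64 * (1 + ‖z‖) ^ 3 * gaussDensity z * ‖k‖ := (mul_assoc _ _ _).symm

lemma abs_gaussDeriv₂_le (k a z : Slice d) :
    |gaussDeriv₂ k a z| ≤ 64 * (1 + ‖z‖) ^ 3 * gaussDensity z * (‖k‖ * ‖a‖) := by
  have hpoly : 16 * ‖z‖ ^ 2 + 4 ≤ 64 * (1 + ‖z‖) ^ 3 := by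
    nlinarith [norm_nonneg z, pow_nonneg (norm_nonneg z) 2, pow_nonneg (norm_nonneg z) 3]
  have hinner : |4 * sliceInner k z * sliceInner a z - 2 * sliceInner k a| ≤
      (16 * ‖z‖ ^ 2 + 4) * (‖k‖ * ‖a‖) := by
    have h := abs_sub (4 * sliceInner k z * sliceInner a z) (2 * sliceInner k a)
    simp only [abs_mul, Nat.abs_ofNat] at h
    calc |4 * sliceInner k z * sliceInner a z - 2 * sliceInner k a|
        ≤ 4 * |sliceInner k z| * |sliceInner a z| + 2 * |sliceInner k a| := h
      _ ≤ 4 * (2 * ‖k‖ * ‖z‖) * (2 * ‖a‖ * ‖z‖) + 2 * (2 * ‖k‖ * ‖a‖) := by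
          gcongr <;> exact abs_sliceInner_le _ _
      _ = (16 * ‖z‖ ^ 2 + 4) * (‖k‖ * ‖a‖) := by ring
  rw [gaussDeriv₂, abs_mul, abs_of_pos (gaussDensity_pos z), mul_right_comm _ (gaussDensity z)]
  exact mul_le_mul_of_nonneg_right
    (hinner.trans (mul_le_mul_of_nonneg_right hpoly (by positivity))) (gaussDensity_pos z).le

lemma abs_gaussDeriv₃_le (k a z : Slice d) :
    |gaussDeriv₃ k a z| ≤ 64 * (1 + ‖z‖) ^ 3 * gaussDensity z * (‖k‖ * ‖a‖ ^ 2) := by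
  have hpoly : 48 * ‖z‖ + 64 * ‖z‖ ^ 3 ≤ 64 * (1 + ‖z‖) ^ 3 := by
    nlinarith [norm_nonneg z, pow_nonneg (norm_nonneg z) 2]
  have hinner : |8 * sliceInner k a * sliceInner a z + 4 * sliceInner k z * sliceInner a a -
      8 * sliceInner k z * sliceInner a z ^ 2| ≤
      (48 * ‖z‖ + 64 * ‖z‖ ^ 3) * (‖k‖ * ‖a‖ ^ 2) := by
    have h := (abs_sub (8 * sliceInner k a * sliceInner a z + 4 * sliceInner k z * sliceInner a a)
      (8 * sliceInner k z * sliceInner a z ^ 2)).trans (add_le_add_left (abs_add_le _ _) _)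
    simp only [abs_mul, abs_pow (sliceInner a z), Nat.abs_ofNat] at h
    refine h.trans ?_
    calc 8 * |sliceInner k a| * |sliceInner a z| + 4 * |sliceInner k z| * |sliceInner a a| +
          8 * |sliceInner k z| * |sliceInner a z| ^ 2
        ≤ 8 * (2 * ‖k‖ * ‖a‖) * (2 * ‖a‖ * ‖z‖) + 4 * (2 * ‖k‖ * ‖z‖) * (2 * ‖a‖ * ‖a‖) +
          8 * (2 * ‖k‖ * ‖z‖) * (2 * ‖a‖ * ‖z‖) ^ 2 := by
          gcongr <;> exact abs_sliceInner_le _ _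
      _ = (48 * ‖z‖ + 64 * ‖z‖ ^ 3) * (‖k‖ * ‖a‖ ^ 2) := by ring
  rw [gaussDeriv₃, abs_mul, abs_of_pos (gaussDensity_pos z), mul_right_comm _ (gaussDensity z)]
  exact mul_le_mul_of_nonneg_right
    (hinner.trans (mul_le_mul_of_nonneg_right hpoly (by positivity))) (gaussDensity_pos z).le

lemma one_add_norm_pow_mul_gaussDensity_le (z : Slice d) :
    (1 + ‖z‖) ^ 4 * gaussDensity z ≤
      (Real.pi ^ d)⁻¹ * Real.exp (8 - (‖z.1‖ ^ 2 + ‖z.2‖ ^ 2) / 2) := by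
  have hpow : (1 + ‖z‖) ^ 4 ≤ Real.exp (4 * ‖z‖) := by
    have hexp : Real.exp (4 * ‖z‖) = Real.exp ‖z‖ ^ 4 := by exact_mod_cast Real.exp_nat_mul ‖z‖ 4
    rw [hexp, add_comm]
    gcongr
    exact Real.add_one_le_exp _
  have hnorm : ‖z‖ ^ 2 ≤ ‖z.1‖ ^ 2 + ‖z.2‖ ^ 2 := by
    rcases max_choice ‖z.1‖ ‖z.2‖ with h | h <;> rw [Prod.norm_def, h] <;>
      linarith [sq_nonneg ‖z.1‖, sq_nonneg ‖z.2‖]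
  calc (1 + ‖z‖) ^ 4 * gaussDensity z
      ≤ Real.exp (4 * ‖z‖) * gaussDensity z :=
        mul_le_mul_of_nonneg_right hpow (gaussDensity_pos z).le
    _ = (Real.pi ^ d)⁻¹ * Real.exp (4 * ‖z‖ + -(‖z.1‖ ^ 2 + ‖z.2‖ ^ 2)) := by
        rw [gaussDensity, Real.exp_add]
        ring
    _ ≤ (Real.pi ^ d)⁻¹ * Real.exp (8 - (‖z.1‖ ^ 2 + ‖z.2‖ ^ 2) / 2) := by
        gcongr
        linarith [sq_nonneg (‖z‖ - 4)]

lemma half_norm_sq_sub_le {E : Type*} [SeminormedAddCommGroup E] (z s : E) :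
    ‖z‖ ^ 2 / 2 - ‖s‖ ^ 2 ≤ ‖z + s‖ ^ 2 := by
  have h := norm_sub_le (z + s) s
  rw [add_sub_cancel_right] at h
  nlinarith [norm_nonneg z, norm_nonneg s, norm_nonneg (z + s), sq_nonneg (‖z + s‖ - ‖s‖)]

/-- A dominating function for the weighted differences of `gaussDensity` with increments of size
at most `R`. -/
noncomputable def gaussEnvelope (R : ℝ) (z : Slice d) : ℝ :=
  64 * (1 + 2 * R) * (Real.pi ^ d)⁻¹ * Real.exp (8 + 4 * R ^ 2) *
    Real.exp (-(1 / 4) * (‖z.1‖ ^ 2 + ‖z.2‖ ^ 2))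

lemma integrable_gaussEnvelope (R : ℝ) : Integrable (gaussEnvelope (d := d) R) :=
  (integrable_exp_neg_mul_sq_add_sq (by norm_num)).const_mul _

lemma gaussEnvelope_pos {R : ℝ} (hR : 0 ≤ R) (z : Slice d) : 0 < gaussEnvelope R z := by
  unfold gaussEnvelope; positivity

lemma one_add_norm_mul_le_gaussEnvelope {R : ℝ} {s : Slice d} (hs : ‖s‖ ≤ 2 * R) (z : Slice d) :
    (1 + ‖z‖) * (64 * (1 + ‖z + s‖) ^ 3 * gaussDensity (z + s)) ≤ gaussEnvelope R z := by
  have hweight : 1 + ‖z‖ ≤ (1 + 2 * R) * (1 + ‖z + s‖) := by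
    have h := norm_sub_le (z + s) s
    rw [add_sub_cancel_right] at h
    nlinarith [norm_nonneg (z + s), norm_nonneg s]
  have hR : 0 ≤ 1 + 2 * R := by linarith [norm_nonneg s]
  have hsq : ∀ {x : ℝ}, 0 ≤ x → x ≤ ‖s‖ → x ^ 2 ≤ 4 * R ^ 2 := fun hx hxs => by
    nlinarith [hxs.trans hs]
  calc (1 + ‖z‖) * (64 * (1 + ‖z + s‖) ^ 3 * gaussDensity (z + s))
      ≤ (1 + 2 * R) * (1 + ‖z + s‖) * (64 * (1 + ‖z + s‖) ^ 3 * gaussDensity (z + s)) :=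
        mul_le_mul_of_nonneg_right hweight
          (mul_nonneg (by positivity) (gaussDensity_pos _).le)
    _ = 64 * (1 + 2 * R) * ((1 + ‖z + s‖) ^ 4 * gaussDensity (z + s)) := by ring
    _ ≤ 64 * (1 + 2 * R) * ((Real.pi ^ d)⁻¹ *
          Real.exp (8 + 4 * R ^ 2 + -(1 / 4) * (‖z.1‖ ^ 2 + ‖z.2‖ ^ 2))) := by
        refine mul_le_mul_of_nonneg_left ((one_add_norm_pow_mul_gaussDensity_le _).trans ?_)
          (by positivity)
        gcongr
        rw [Prod.fst_add, Prod.snd_add]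
        linarith [half_norm_sq_sub_le z.1 s.1, half_norm_sq_sub_le z.2 s.2,
          hsq (norm_nonneg _) (norm_fst_le s), hsq (norm_nonneg _) (norm_snd_le s)]
    _ = gaussEnvelope R z := by
        rw [gaussEnvelope, Real.exp_add]
        ring

lemma one_add_norm_mul_abs_le {R c D : ℝ} {s z : Slice d} (hs : ‖s‖ ≤ 2 * R) (hc : 0 ≤ c)
    (hD : |D| ≤ 64 * (1 + ‖z + s‖) ^ 3 * gaussDensity (z + s) * c) :
    (1 + ‖z‖) * |D| ≤ gaussEnvelope R z * c :=
  calc (1 + ‖z‖) * |D|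
      ≤ (1 + ‖z‖) * (64 * (1 + ‖z + s‖) ^ 3 * gaussDensity (z + s) * c) := by gcongr
    _ = (1 + ‖z‖) * (64 * (1 + ‖z + s‖) ^ 3 * gaussDensity (z + s)) * c := by ring
    _ ≤ gaussEnvelope R z * c :=
        mul_le_mul_of_nonneg_right (one_add_norm_mul_le_gaussEnvelope hs z) hc

lemma norm_smul_le_of_mem_Ioo {E : Type*} [SeminormedAddCommGroup E] [NormedSpace ℝ E] {ξ R : ℝ}
    (hξ : ξ ∈ Ioo (-1) 1) {k : E} (hk : ‖k‖ ≤ R) : ‖ξ • k‖ ≤ R := by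
  rw [norm_smul]
  exact (mul_le_of_le_one_left (norm_nonneg k) (abs_lt.mpr hξ).le).trans hk

lemma one_add_norm_mul_abs_fwdDiff_gaussDensity_le {R : ℝ} {k : Slice d} (hk : ‖k‖ ≤ R)
    (z : Slice d) : (1 + ‖z‖) * |Δ_[k] gaussDensity z| ≤ gaussEnvelope R z * ‖k‖ := by
  obtain ⟨ξ, hξ, hξeq⟩ := exists_fwdDiff_eq (hasLineDerivAt_gaussDensity k) z
  have hs := norm_smul_le_of_mem_Ioo ⟨by linarith [hξ.1], hξ.2⟩ hk
  rw [hξeq]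
  exact one_add_norm_mul_abs_le (by linarith [norm_nonneg k]) (norm_nonneg _)
    (abs_gaussDeriv_le _ _)

lemma one_add_norm_mul_abs_secondDiff_gaussDensity_le {R : ℝ} {a : Slice d} (ha : ‖a‖ ≤ R)
    (z : Slice d) : (1 + ‖z‖) * |secondDiff a gaussDensity z| ≤ gaussEnvelope R z * ‖a‖ ^ 2 := by
  obtain ⟨ξ, hξ, hξeq⟩ := exists_secondDiff_eq (hasLineDerivAt_gaussDensity a)
    (hasLineDerivAt_gaussDeriv a a) z one_pos
  rw [one_smul, one_pow, one_mul] at hξeq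
  have hs := norm_smul_le_of_mem_Ioo hξ ha
  rw [hξeq, sq]
  exact one_add_norm_mul_abs_le (by linarith [norm_nonneg a]) (by positivity)
    (abs_gaussDeriv₂_le _ _ _)

lemma one_add_norm_mul_abs_secondDiff_fwdDiff_gaussDensity_le {R : ℝ} {k a : Slice d}
    (hk : ‖k‖ ≤ R) (ha : ‖a‖ ≤ R) (z : Slice d) :
    (1 + ‖z‖) * |secondDiff a (Δ_[k] gaussDensity) z| ≤
      gaussEnvelope R z * (‖k‖ * ‖a‖ ^ 2) := by
  obtain ⟨ξ, hξ, hξeq⟩ := exists_fwdDiff_eq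
    (hasLineDerivAt_secondDiff (hasLineDerivAt_gaussDensity k) a) z
  obtain ⟨η, hη, hηeq⟩ := exists_secondDiff_eq (hasLineDerivAt_gaussDeriv k a)
    (hasLineDerivAt_gaussDeriv₂ k a) (z + ξ • k) one_pos
  rw [one_smul, one_pow, one_mul] at hηeq
  have hs : ‖ξ • k + η • a‖ ≤ 2 * R := by
    linarith [norm_add_le (ξ • k) (η • a), norm_smul_le_of_mem_Ioo hη ha,
      norm_smul_le_of_mem_Ioo ⟨by linarith [hξ.1], hξ.2⟩ hk]
  rw [secondDiff_fwdDiff, ← fwdDiff, hξeq, hηeq, add_assoc]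
  exact one_add_norm_mul_abs_le hs (by positivity) (abs_gaussDeriv₃_le _ _ _)

end GaussianDifferences

section HolderSource

open fwdDiff

variable {d : ℕ}

/-- Hölder continuity of `G` in coordinates straightened along the transport field for a time `τ`:
constant `N`, exponent `α / 3` in the physical position `x - τ v`, and `α` in the velocity. -/
def ShearHolder (α N τ : ℝ) (G : Slice d → ℝ) : Prop :=
  ∀ y h : Slice d, |G (y + h) - G y| ≤ N * (‖h.1 - τ • h.2‖ ^ (α / 3) + ‖h.2‖ ^ α)

lemma rpow_le_rpow_mul_one_add {τ r s x p : ℝ} (hτ : 0 < τ) (hs : 0 ≤ s) (hx₀ : 0 ≤ x)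
    (hx : x ≤ τ ^ r * s) (hp : 0 ≤ p) (hp₁ : p ≤ 1) : x ^ p ≤ τ ^ (r * p) * (1 + s) :=
  calc x ^ p ≤ (τ ^ r * s) ^ p := Real.rpow_le_rpow hx₀ hx hp
    _ = τ ^ (r * p) * s ^ p := by
        rw [Real.mul_rpow (Real.rpow_nonneg hτ.le r) hs, Real.rpow_mul hτ.le]
    _ ≤ τ ^ (r * p) * (1 + s) := by
        gcongr
        calc s ^ p ≤ (1 + s) ^ p := Real.rpow_le_rpow hs (by linarith) hp
          _ ≤ 1 + s := Real.rpow_le_self_of_one_le (by linarith) hp₁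

lemma norm_spread_snd_le {ν τ : ℝ} (hτ : 0 < τ) (hν : ν ≤ 1) (z : Slice d) :
    ‖(spread ν τ z).2‖ ≤ τ ^ (1 / 2 : ℝ) * (2 * ‖z‖) := by
  rw [← Real.sqrt_eq_rpow, spread_apply, norm_smul, Real.norm_of_nonneg (by positivity),
    mul_comm 2, mul_assoc]
  gcongr
  · exact mul_le_of_le_one_left hτ.le hν
  · exact norm_fst_le z

lemma norm_shear_spread_le {ν τ : ℝ} (hτ : 0 < τ) (hν : 0 ≤ ν) (hν₁ : ν ≤ 1) (z : Slice d) :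
    ‖(spread ν τ z).1 - τ • (spread ν τ z).2‖ ≤ τ ^ (3 / 2 : ℝ) * (2 * ‖z‖) := by
  have hsqrt : √(ν * τ) ≤ √τ := Real.sqrt_le_sqrt (mul_le_of_le_one_left hτ.le hν₁)
  have hsqrt₃ : √(ν * τ / 3) ≤ √τ :=
    (Real.sqrt_le_sqrt (div_le_self (by positivity) (by norm_num))).trans hsqrt
  have hpow : τ ^ (3 / 2 : ℝ) = τ * √τ := by
    rw [Real.sqrt_eq_rpow, ← Real.rpow_one_add' hτ.le (by norm_num)]
    norm_num
  calc ‖(spread ν τ z).1 - τ • (spread ν τ z).2‖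
      = ‖(τ * √(ν * τ / 3)) • z.2 - (τ * √(ν * τ)) • z.1‖ := by
        rw [spread_apply]
        congr 1
        module
    _ ≤ τ * √(ν * τ / 3) * ‖z.2‖ + τ * √(ν * τ) * ‖z.1‖ := by
        refine (norm_sub_le _ _).trans_eq ?_
        rw [norm_smul, norm_smul, Real.norm_of_nonneg (by positivity),
          Real.norm_of_nonneg (by positivity)]
    _ ≤ τ * √τ * ‖z‖ + τ * √τ * ‖z‖ := by
        gcongr
        exacts [norm_snd_le z, norm_fst_le z]
    _ = τ ^ (3 / 2 : ℝ) * (2 * ‖z‖) := by rw [hpow]; ring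

lemma ShearHolder.abs_sub_spread_le {ν τ α N : ℝ} (hν : 0 ≤ ν) (hν₁ : ν ≤ 1) (hτ : 0 < τ)
    (hα : 0 ≤ α) (hα₁ : α ≤ 1) (hN : 0 ≤ N) {G : Slice d → ℝ} (hG : ShearHolder α N τ G)
    (y z : Slice d) :
    |G (y - spread ν τ z) - G y| ≤ 4 * N * τ ^ (α / 2) * (1 + ‖z‖) := by
  have hx : ‖(spread ν τ (-z)).1 - τ • (spread ν τ (-z)).2‖ ^ (α / 3) ≤
      τ ^ (α / 2) * (1 + 2 * ‖z‖) := by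
    have h := rpow_le_rpow_mul_one_add hτ (by positivity) (norm_nonneg _)
      (norm_shear_spread_le hτ hν hν₁ (-z)) (p := α / 3) (by positivity) (by linarith)
    rwa [norm_neg, show (3 / 2 : ℝ) * (α / 3) = α / 2 by ring] at h
  have hv : ‖(spread ν τ (-z)).2‖ ^ α ≤ τ ^ (α / 2) * (1 + 2 * ‖z‖) := by
    have h := rpow_le_rpow_mul_one_add hτ (by positivity) (norm_nonneg _)
      (norm_spread_snd_le hτ hν₁ (-z)) hα hα₁
    rwa [norm_neg, one_div_mul_eq_div] at h
  have hpow : 0 ≤ τ ^ (α / 2) := by positivity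
  calc |G (y - spread ν τ z) - G y|
      = |G (y + spread ν τ (-z)) - G y| := by rw [map_neg, sub_eq_add_neg y]
    _ ≤ N * (τ ^ (α / 2) * (1 + 2 * ‖z‖) + τ ^ (α / 2) * (1 + 2 * ‖z‖)) :=
        (hG y _).trans (mul_le_mul_of_nonneg_left (add_le_add hx hv) hN)
    _ ≤ 4 * N * τ ^ (α / 2) * (1 + ‖z‖) := by nlinarith [mul_nonneg hN hpow]

lemma ShearHolder.mollify {ν τ α N : ℝ} {G : Slice d → ℝ} (hG : ShearHolder α N τ G)
    (hGc : Continuous G) {B : ℝ} (hB : ∀ y, |G y| ≤ B) (σ : ℝ) :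
    ShearHolder α N τ (mollify ν σ G) := fun y h => by
  rw [← mollify_translate, ← mollify_sub (by fun_prop) hGc (fun y => hB _) hB]
  exact abs_mollify_le (fun y => hG y h) ν σ y

/-- The average of `G` against the signed density `Ψ`, scaled by `spread` like the Kolmogorov
kernel; `mollify` is the case of the Gaussian density. -/
noncomputable def kernelAverage (ν τ : ℝ) (G Ψ : Slice d → ℝ) (y : Slice d) : ℝ :=
  ∫ z, G (y - spread ν τ z) * Ψ z

lemma kernelAverage_add_spread (ν τ : ℝ) (G Ψ : Slice d → ℝ) (y k : Slice d) :
    kernelAverage ν τ G Ψ (y + spread ν τ k) = kernelAverage ν τ G (fun z => Ψ (z + k)) y := by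
  unfold kernelAverage
  rw [← integral_add_right_eq_self _ k]
  simp only [map_add, add_sub_add_right_eq_sub]

lemma integrable_comp_sub_spread_mul {G : Slice d → ℝ} (hG : Continuous G) {B : ℝ}
    (hB : ∀ y, |G y| ≤ B) {Ψ : Slice d → ℝ} (hΨ : Integrable Ψ) (ν τ : ℝ) (y : Slice d) :
    Integrable (fun z => G (y - spread ν τ z) * Ψ z) :=
  hΨ.bdd_mul (Continuous.aestronglyMeasurable (by fun_prop)) (ae_of_all _ fun _ => hB _)

lemma integrable_fwdDiff {Ψ : Slice d → ℝ} (hΨ : Integrable Ψ) (k : Slice d) :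
    Integrable (Δ_[k] Ψ) :=
  (hΨ.comp_add_right k).sub hΨ

lemma integral_fwdDiff {Ψ : Slice d → ℝ} (hΨ : Integrable Ψ) (k : Slice d) :
    ∫ z, (Δ_[k] Ψ) z = 0 := by
  unfold fwdDiff
  rw [integral_sub (hΨ.comp_add_right k) hΨ, integral_add_right_eq_self, sub_self]

lemma integrable_secondDiff {Ψ : Slice d → ℝ} (hΨ : Integrable Ψ) (a : Slice d) :
    Integrable (secondDiff a Ψ) := by
  simpa only [← secondDiff_eq_fwdDiff_fwdDiff] using
    (integrable_fwdDiff (integrable_fwdDiff hΨ a) a).comp_sub_right a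

lemma integral_secondDiff {Ψ : Slice d → ℝ} (hΨ : Integrable Ψ) (a : Slice d) :
    ∫ z, secondDiff a Ψ z = 0 := by
  simp only [secondDiff_eq_fwdDiff_fwdDiff]
  rw [integral_sub_right_eq_self, integral_fwdDiff (integrable_fwdDiff hΨ a)]

section Differences

variable {G : Slice d → ℝ} (hG : Continuous G) {B : ℝ} (hB : ∀ y, |G y| ≤ B)

include hG hB

lemma fwdDiff_kernelAverage {Ψ : Slice d → ℝ} (hΨ : Integrable Ψ) (ν τ : ℝ) (k : Slice d) :
    Δ_[spread ν τ k] (kernelAverage ν τ G Ψ) = kernelAverage ν τ G (Δ_[k] Ψ) := by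
  ext y
  rw [fwdDiff, kernelAverage_add_spread]
  simp only [kernelAverage, fwdDiff, mul_sub]
  exact (integral_sub (integrable_comp_sub_spread_mul hG hB (hΨ.comp_add_right k) ν τ y)
    (integrable_comp_sub_spread_mul hG hB hΨ ν τ y)).symm

lemma secondDiff_kernelAverage {Ψ : Slice d → ℝ} (hΨ : Integrable Ψ) (ν τ : ℝ) (a : Slice d) :
    secondDiff (spread ν τ a) (kernelAverage ν τ G Ψ) = kernelAverage ν τ G (secondDiff a Ψ) := by
  ext y
  rw [secondDiff_eq_fwdDiff_fwdDiff, fwdDiff_kernelAverage hG hB hΨ,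
    fwdDiff_kernelAverage hG hB (integrable_fwdDiff hΨ a), sub_eq_add_neg, ← map_neg,
    kernelAverage_add_spread]
  simp only [← sub_eq_add_neg, ← secondDiff_eq_fwdDiff_fwdDiff]

end Differences

/-- The constant in the gain of regularity by mollification, for increments of size at most `R`
relative to the width of the kernel. -/
noncomputable def mollifyConst (d : ℕ) (R : ℝ) : ℝ :=
  4 * ∫ z : Slice d, gaussEnvelope R z

lemma mollifyConst_nonneg (d : ℕ) {R : ℝ} (hR : 0 ≤ R) : 0 ≤ mollifyConst d R :=
  mul_nonneg zero_le_four (integral_nonneg fun z => (gaussEnvelope_pos hR z).le)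

namespace ShearHolder

variable {ν τ α N : ℝ} (hν : 0 ≤ ν) (hν₁ : ν ≤ 1) (hτ : 0 < τ) (hα : 0 ≤ α) (hα₁ : α ≤ 1)
  (hN : 0 ≤ N) {G : Slice d → ℝ} (hGc : Continuous G) {B : ℝ} (hB : ∀ y, |G y| ≤ B)
  (hG : ShearHolder α N τ G)

include hν hν₁ hτ hα hα₁ hN hGc hB hG

/-- Since `Ψ` has mean zero, `G` may be replaced by its oscillation over the width of the
kernel. -/
lemma abs_kernelAverage_le {Ψ : Slice d → ℝ} (hΨ : Integrable Ψ) (hΨ₀ : ∫ z, Ψ z = 0) {R m : ℝ}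
    (hΨR : ∀ z, (1 + ‖z‖) * |Ψ z| ≤ gaussEnvelope R z * m) (y : Slice d) :
    |kernelAverage ν τ G Ψ y| ≤ N * mollifyConst d R * τ ^ (α / 2) * m := by
  have hosc : kernelAverage ν τ G Ψ y = ∫ z, (G (y - spread ν τ z) - G y) * Ψ z := by
    simp only [sub_mul]
    rw [integral_sub (integrable_comp_sub_spread_mul hGc hB hΨ ν τ y) (hΨ.const_mul _),
      integral_const_mul, hΨ₀, mul_zero, sub_zero, kernelAverage]
  have hbound : ∀ z, ‖(G (y - spread ν τ z) - G y) * Ψ z‖ ≤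
      4 * N * τ ^ (α / 2) * (gaussEnvelope R z * m) := fun z =>
    calc ‖(G (y - spread ν τ z) - G y) * Ψ z‖
        ≤ 4 * N * τ ^ (α / 2) * (1 + ‖z‖) * |Ψ z| := by
          rw [norm_mul]
          exact mul_le_mul_of_nonneg_right (hG.abs_sub_spread_le hν hν₁ hτ hα hα₁ hN y z)
            (abs_nonneg _)
      _ = 4 * N * τ ^ (α / 2) * ((1 + ‖z‖) * |Ψ z|) := mul_assoc _ _ _
      _ ≤ 4 * N * τ ^ (α / 2) * (gaussEnvelope R z * m) :=
          mul_le_mul_of_nonneg_left (hΨR z) (by positivity)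
  calc |kernelAverage ν τ G Ψ y|
      = ‖∫ z, (G (y - spread ν τ z) - G y) * Ψ z‖ := by rw [hosc, Real.norm_eq_abs]
    _ ≤ ∫ z, 4 * N * τ ^ (α / 2) * (gaussEnvelope R z * m) :=
        norm_integral_le_of_norm_le (((integrable_gaussEnvelope R).mul_const m).const_mul _)
          (ae_of_all _ hbound)
    _ = N * mollifyConst d R * τ ^ (α / 2) * m := by
        rw [integral_const_mul, integral_mul_const, mollifyConst]
        ring

lemma abs_fwdDiff_mollify_le {R : ℝ} {k : Slice d} (hk : ‖k‖ ≤ R) (y : Slice d) :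
    |Δ_[spread ν τ k] (_root_.mollify ν τ G) y| ≤ N * mollifyConst d R * τ ^ (α / 2) * ‖k‖ := by
  have hg := integrable_gaussDensity (d := d)
  rw [show _root_.mollify ν τ G = kernelAverage ν τ G gaussDensity from rfl,
    fwdDiff_kernelAverage hGc hB hg]
  exact abs_kernelAverage_le hν hν₁ hτ hα hα₁ hN hGc hB hG (integrable_fwdDiff hg k)
    (integral_fwdDiff hg k) (one_add_norm_mul_abs_fwdDiff_gaussDensity_le hk) y

lemma abs_secondDiff_mollify_le {R : ℝ} {a : Slice d} (ha : ‖a‖ ≤ R) (y : Slice d) :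
    |secondDiff (spread ν τ a) (_root_.mollify ν τ G) y| ≤
      N * mollifyConst d R * τ ^ (α / 2) * ‖a‖ ^ 2 := by
  have hg := integrable_gaussDensity (d := d)
  rw [show _root_.mollify ν τ G = kernelAverage ν τ G gaussDensity from rfl,
    secondDiff_kernelAverage hGc hB hg]
  exact abs_kernelAverage_le hν hν₁ hτ hα hα₁ hN hGc hB hG (integrable_secondDiff hg a)
    (integral_secondDiff hg a) (one_add_norm_mul_abs_secondDiff_gaussDensity_le ha) y

lemma abs_secondDiff_fwdDiff_mollify_le {R : ℝ} {k a : Slice d} (hk : ‖k‖ ≤ R) (ha : ‖a‖ ≤ R)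
    (y : Slice d) :
    |secondDiff (spread ν τ a) (Δ_[spread ν τ k] (_root_.mollify ν τ G)) y| ≤
      N * mollifyConst d R * τ ^ (α / 2) * (‖k‖ * ‖a‖ ^ 2) := by
  have hg := integrable_gaussDensity (d := d)
  rw [show _root_.mollify ν τ G = kernelAverage ν τ G gaussDensity from rfl,
    fwdDiff_kernelAverage hGc hB hg, secondDiff_kernelAverage hGc hB (integrable_fwdDiff hg k)]
  exact abs_kernelAverage_le hν hν₁ hτ hα hα₁ hN hGc hB hG
    (integrable_secondDiff (integrable_fwdDiff hg k) a)
    (integral_secondDiff (integrable_fwdDiff hg k) a)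
    (one_add_norm_mul_abs_secondDiff_fwdDiff_gaussDensity_le hk ha) y

end ShearHolder

/-- The inverse of `spread`. -/
noncomputable def unspread (ν τ : ℝ) : Slice d →L[ℝ] Slice d :=
  ((2 * √(ν * τ))⁻¹ • ContinuousLinearMap.snd ℝ (Vec d) (Vec d)).prod
    ((√(ν * τ / 3))⁻¹ • (τ⁻¹ • ContinuousLinearMap.fst ℝ (Vec d) (Vec d) -
      (2⁻¹ : ℝ) • ContinuousLinearMap.snd ℝ (Vec d) (Vec d)))

lemma unspread_apply (ν τ : ℝ) (h : Slice d) : unspread ν τ h =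
    ((2 * √(ν * τ))⁻¹ • h.2, (√(ν * τ / 3))⁻¹ • (τ⁻¹ • h.1 - (2⁻¹ : ℝ) • h.2)) := rfl

lemma spread_unspread {ν τ : ℝ} (hν : 0 < ν) (hτ : 0 < τ) (h : Slice d) :
    spread ν τ (unspread ν τ h) = h := by
  rw [spread_apply, unspread_apply]
  ext1
  · match_scalars <;> field_simp
    ring
  · exact smul_inv_smul₀ (by positivity) h.2

lemma norm_unspread_le {ν τ : ℝ} (hν : 0 < ν) (hτ : 0 < τ) (h : Slice d) :
    ‖unspread ν τ h‖ ≤ 2 / (√ν * √τ) * (‖h.1‖ / τ + ‖h.2‖) := by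
  have hsqrt : √(ν * τ / 3) = √ν * √τ / √3 := by
    rw [Real.sqrt_div (by positivity), Real.sqrt_mul hν.le]
  have hsqrt₃ : √(3 : ℝ) ≤ 2 := Real.sqrt_le_iff.mpr ⟨by norm_num, by norm_num⟩
  rw [unspread_apply]
  refine norm_prod_le_iff.mpr ⟨?_, ?_⟩
  · dsimp only
    rw [norm_smul, Real.norm_of_nonneg (by positivity), Real.sqrt_mul hν.le, mul_inv,
      ← div_eq_mul_inv]
    gcongr
    · norm_num
    · exact le_add_of_nonneg_left (by positivity)
  · have hnorm : ‖τ⁻¹ • h.1 - (2⁻¹ : ℝ) • h.2‖ ≤ ‖h.1‖ / τ + ‖h.2‖ := by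
      refine (norm_sub_le _ _).trans ?_
      rw [norm_smul, norm_smul, Real.norm_of_nonneg (by positivity),
        Real.norm_of_nonneg (by positivity), inv_mul_eq_div]
      linarith [norm_nonneg h.2]
    dsimp only
    rw [norm_smul, Real.norm_of_nonneg (by positivity), hsqrt, inv_div]
    gcongr

end HolderSource

section Schauder

open fwdDiff

variable {d : ℕ}

lemma norm_unspread_le_div_sqrt {ν τ ρ : ℝ} (hν : 0 < ν) (hρ : 0 < ρ) (hτ : ρ ^ 2 ≤ τ)
    {h : Slice d} (h₁ : ‖h.1‖ ≤ ρ ^ 3) (h₂ : ‖h.2‖ ≤ ρ) :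
    ‖unspread ν τ h‖ ≤ 4 / √ν * (ρ / √τ) := by
  have hτ₀ : 0 < τ := (by positivity : 0 < ρ ^ 2).trans_le hτ
  have hx : ‖h.1‖ / τ ≤ ρ := by
    rw [div_le_iff₀ hτ₀]
    exact h₁.trans (by nlinarith)
  calc ‖unspread ν τ h‖ ≤ 2 / (√ν * √τ) * (‖h.1‖ / τ + ‖h.2‖) := norm_unspread_le hν hτ₀ h
    _ ≤ 2 / (√ν * √τ) * (ρ + ρ) := by gcongr
    _ = 4 / √ν * (ρ / √τ) := by field_simp; ring

lemma norm_unspread_le_const {ν τ ρ : ℝ} (hν : 0 < ν) (hρ : 0 < ρ) (hτ : ρ ^ 2 ≤ τ)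
    {h : Slice d} (h₁ : ‖h.1‖ ≤ ρ ^ 3) (h₂ : ‖h.2‖ ≤ ρ) : ‖unspread ν τ h‖ ≤ 4 / √ν :=
  (norm_unspread_le_div_sqrt hν hρ hτ h₁ h₂).trans <|
    mul_le_of_le_one_right (by positivity) (div_le_one_of_le₀ (Real.le_sqrt_of_sq_le hτ)
      (Real.sqrt_nonneg τ))

lemma norm_unspread_position_le {ν τ : ℝ} (hν : 0 < ν) (hτ : 0 < τ) (h : Vec d) :
    ‖unspread ν τ ((h, 0) : Slice d)‖ ≤ 2 * ‖h‖ / √ν * (τ * √τ)⁻¹ := by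
  refine (norm_unspread_le hν hτ _).trans_eq ?_
  simp only [norm_zero, add_zero]
  field_simp

lemma norm_unspread_velocity_sq_le {ν τ : ℝ} (hν : 0 < ν) (hτ : 0 < τ) (e : Vec d) :
    ‖unspread ν τ ((0, e) : Slice d)‖ ^ 2 ≤ 4 * ‖e‖ ^ 2 / ν * τ⁻¹ := by
  refine (pow_le_pow_left₀ (norm_nonneg _) (norm_unspread_le hν hτ _) 2).trans_eq ?_
  rw [norm_zero, zero_div, zero_add, mul_pow, div_pow, mul_pow, Real.sq_sqrt hν.le,
    Real.sq_sqrt hτ.le]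
  field_simp
  ring

lemma rpow_half_mul_inv_mul_sqrt {τ : ℝ} (hτ : 0 < τ) (α : ℝ) :
    τ ^ (α / 2) * (τ * √τ)⁻¹ = τ ^ ((α - 1) / 2 - 1) := by
  rw [sub_div, Real.rpow_sub_one hτ.ne', Real.rpow_sub hτ, ← Real.sqrt_eq_rpow]
  field_simp

lemma sq_rpow_half {x : ℝ} (hx : 0 ≤ x) (p : ℝ) : (x ^ 2) ^ (p / 2) = x ^ p := by
  rw [← Real.rpow_natCast_mul hx, Nat.cast_two, mul_div_cancel₀ _ two_ne_zero]

lemma pow_three_rpow_div_three {x : ℝ} (hx : 0 ≤ x) (α : ℝ) : (x ^ 3) ^ (α / 3) = x ^ α := by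
  rw [← Real.rpow_natCast_mul hx, Nat.cast_ofNat, mul_div_cancel₀ _ three_ne_zero]

namespace ShearHolder

variable {ν τ α N : ℝ} {G : Slice d → ℝ} {B : ℝ}

lemma abs_fwdDiff_position_le (hα : 0 < α) (hN : 0 ≤ N) (hG : ShearHolder α N τ G) {ρ : ℝ}
    (hρ : 0 ≤ ρ) {h : Vec d} (hh : ‖h‖ ≤ ρ ^ 3) (y : Slice d) :
    |Δ_[((h, 0) : Slice d)] G y| ≤ N * ρ ^ α := by
  refine (hG y (h, 0)).trans (mul_le_mul_of_nonneg_left ?_ hN)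
  rw [smul_zero, sub_zero, norm_zero, Real.zero_rpow hα.ne', add_zero,
    ← pow_three_rpow_div_three hρ]
  exact Real.rpow_le_rpow (norm_nonneg h) hh (by positivity)

lemma abs_secondDiff_velocity_le (hα : 0 < α) (hN : 0 ≤ N) (hG : ShearHolder α N τ G) {e : Vec d}
    (hτ : 0 ≤ τ) (he : τ ≤ ‖e‖ ^ 2) (y : Slice d) :
    |secondDiff ((0, e) : Slice d) G y| ≤ 4 * N * ‖e‖ ^ α := by
  have hdiff : ∀ e' : Vec d, ‖e'‖ = ‖e‖ →
      |G (y + ((0, e') : Slice d)) - G y| ≤ 2 * N * ‖e‖ ^ α := fun e' he' => by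
    have hshear : ‖τ • e'‖ ^ (α / 3) ≤ ‖e‖ ^ α := by
      rw [← pow_three_rpow_div_three (norm_nonneg e), norm_smul, Real.norm_of_nonneg hτ, he']
      gcongr
      calc τ * ‖e‖ ≤ ‖e‖ ^ 2 * ‖e‖ := by gcongr
        _ = ‖e‖ ^ 3 := by ring
    have h := hG y (0, e')
    rw [zero_sub, norm_neg, he'] at h
    nlinarith
  have hplus := abs_le.mp (hdiff e rfl)
  have hminus := abs_le.mp (hdiff (-e) (norm_neg e))
  rw [show ((0, -e) : Slice d) = -(0, e) by simp, ← sub_eq_add_neg] at hminus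
  rw [secondDiff, abs_le]
  constructor <;> linarith [hplus.1, hplus.2, hminus.1, hminus.2]

section Rates

variable (hν : 0 < ν) (hν₁ : ν ≤ 1) (hα : 0 ≤ α) (hα₁ : α ≤ 1) (hN : 0 ≤ N)
  (hGc : Continuous G) (hB : ∀ y, |G y| ≤ B) (hG : ShearHolder α N τ G)

include hν hν₁ hα hα₁ hN hGc hB hG

lemma abs_fwdDiff_position_mollify_le {ρ : ℝ} (hρ : 0 < ρ) (hτ : ρ ^ 2 ≤ τ) {h : Vec d}
    (hh : ‖h‖ ≤ ρ ^ 3) (y : Slice d) :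
    |Δ_[((h, 0) : Slice d)] (_root_.mollify ν τ G) y| ≤
      N * mollifyConst d (4 / √ν) * (2 * ρ ^ 3 / √ν) * τ ^ ((α - 1) / 2 - 1) := by
  have hτ₀ : 0 < τ := (by positivity : 0 < ρ ^ 2).trans_le hτ
  have hM := mollifyConst_nonneg d (R := 4 / √ν) (by positivity)
  have hdiff := abs_fwdDiff_mollify_le hν.le hν₁ hτ₀ hα hα₁ hN hGc hB hG
    (norm_unspread_le_const hν hρ hτ (h := (h, 0)) hh (norm_zero.trans_le hρ.le)) y
  rw [spread_unspread hν hτ₀] at hdiff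
  calc |Δ_[((h, 0) : Slice d)] (_root_.mollify ν τ G) y|
      ≤ N * mollifyConst d (4 / √ν) * τ ^ (α / 2) * (2 * ρ ^ 3 / √ν * (τ * √τ)⁻¹) := by
        refine hdiff.trans (mul_le_mul_of_nonneg_left ?_ (by positivity))
        refine (norm_unspread_position_le hν hτ₀ h).trans ?_
        gcongr
    _ = N * mollifyConst d (4 / √ν) * (2 * ρ ^ 3 / √ν) * (τ ^ (α / 2) * (τ * √τ)⁻¹) := by ring
    _ = N * mollifyConst d (4 / √ν) * (2 * ρ ^ 3 / √ν) * τ ^ ((α - 1) / 2 - 1) := by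
        rw [rpow_half_mul_inv_mul_sqrt hτ₀]

lemma abs_secondDiff_velocity_mollify_le {e : Vec d} (he : e ≠ 0) (hτ : ‖e‖ ^ 2 ≤ τ)
    (y : Slice d) :
    |secondDiff ((0, e) : Slice d) (_root_.mollify ν τ G) y| ≤
      N * mollifyConst d (4 / √ν) * (4 * ‖e‖ ^ 2 / ν) * τ ^ (α / 2 - 1) := by
  have he₀ : 0 < ‖e‖ := norm_pos_iff.mpr he
  have hτ₀ : 0 < τ := (by positivity : 0 < ‖e‖ ^ 2).trans_le hτ
  have hM := mollifyConst_nonneg d (R := 4 / √ν) (by positivity)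
  have hdiff := abs_secondDiff_mollify_le hν.le hν₁ hτ₀ hα hα₁ hN hGc hB hG
    (norm_unspread_le_const hν he₀ hτ (h := (0, e)) (norm_zero.trans_le (by positivity)) le_rfl) y
  rw [spread_unspread hν hτ₀] at hdiff
  calc |secondDiff ((0, e) : Slice d) (_root_.mollify ν τ G) y|
      ≤ N * mollifyConst d (4 / √ν) * τ ^ (α / 2) * (4 * ‖e‖ ^ 2 / ν * τ⁻¹) :=
        hdiff.trans (mul_le_mul_of_nonneg_left (norm_unspread_velocity_sq_le hν hτ₀ e)
          (by positivity))
    _ = N * mollifyConst d (4 / √ν) * (4 * ‖e‖ ^ 2 / ν) * τ ^ (α / 2 - 1) := by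
        rw [Real.rpow_sub_one hτ₀.ne']
        ring

lemma abs_secondDiff_velocity_fwdDiff_mollify_le {e : Vec d} (he : e ≠ 0) {ρ : ℝ} (heρ : ‖e‖ ≤ ρ)
    (hτ : ρ ^ 2 ≤ τ) {h : Slice d} (h₁ : ‖h.1‖ ≤ ρ ^ 3) (h₂ : ‖h.2‖ ≤ ρ) (y : Slice d) :
    |secondDiff ((0, e) : Slice d) (Δ_[h] (_root_.mollify ν τ G)) y| ≤
      N * mollifyConst d (4 / √ν) * (16 * ρ * ‖e‖ ^ 2 / (ν * √ν)) * τ ^ ((α - 1) / 2 - 1) := by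
  have he₀ : 0 < ‖e‖ := norm_pos_iff.mpr he
  have hρ : 0 < ρ := he₀.trans_le heρ
  have hτ₀ : 0 < τ := (by positivity : 0 < ρ ^ 2).trans_le hτ
  have heτ : ‖e‖ ^ 2 ≤ τ := (by gcongr : ‖e‖ ^ 2 ≤ ρ ^ 2).trans hτ
  have hM := mollifyConst_nonneg d (R := 4 / √ν) (by positivity)
  have hdiff := abs_secondDiff_fwdDiff_mollify_le hν.le hν₁ hτ₀ hα hα₁ hN hGc hB hG
    (norm_unspread_le_const hν hρ hτ h₁ h₂)
    (norm_unspread_le_const hν he₀ heτ (h := (0, e)) (norm_zero.trans_le (by positivity)) le_rfl) y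
  rw [spread_unspread hν hτ₀, spread_unspread hν hτ₀] at hdiff
  calc |secondDiff ((0, e) : Slice d) (Δ_[h] (_root_.mollify ν τ G)) y|
      ≤ N * mollifyConst d (4 / √ν) * τ ^ (α / 2) *
          (4 / √ν * (ρ / √τ) * (4 * ‖e‖ ^ 2 / ν * τ⁻¹)) := by
        refine hdiff.trans (mul_le_mul_of_nonneg_left ?_ (by positivity))
        exact mul_le_mul (norm_unspread_le_div_sqrt hν hρ hτ h₁ h₂)
          (norm_unspread_velocity_sq_le hν hτ₀ e) (by positivity) (by positivity)
    _ = N * mollifyConst d (4 / √ν) * (16 * ρ * ‖e‖ ^ 2 / (ν * √ν)) *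
          (τ ^ (α / 2) * (τ * √τ)⁻¹) := by
        field_simp
        ring
    _ = N * mollifyConst d (4 / √ν) * (16 * ρ * ‖e‖ ^ 2 / (ν * √ν)) *
          τ ^ ((α - 1) / 2 - 1) := by
        rw [rpow_half_mul_inv_mul_sqrt hτ₀]

end Rates

end ShearHolder

/-- The constant of the Hölder estimate in the position variable. -/
noncomputable def positionConst (d : ℕ) (ν α : ℝ) : ℝ :=
  1 + 4 * mollifyConst d (4 / √ν) / ((1 - α) * √ν)

/-- The constant of the Hölder estimate for the second velocity derivatives. -/
noncomputable def velocityConst (d : ℕ) (ν α : ℝ) : ℝ :=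
  8 + 16 * mollifyConst d (4 / √ν) / (α * ν) +
    32 * mollifyConst d (4 / √ν) / ((1 - α) * (ν * √ν))

lemma positionConst_nonneg (d : ℕ) {α : ℝ} (ν : ℝ) (hα₁ : α < 1) : 0 ≤ positionConst d ν α := by
  have hM := mollifyConst_nonneg d (R := 4 / √ν) (by positivity)
  have := sub_pos.mpr hα₁
  unfold positionConst
  positivity

lemma velocityConst_nonneg (d : ℕ) {ν α : ℝ} (hν : 0 < ν) (hα : 0 < α) (hα₁ : α < 1) :
    0 ≤ velocityConst d ν α := by
  have hM := mollifyConst_nonneg d (R := 4 / √ν) (by positivity)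
  have := sub_pos.mpr hα₁
  unfold velocityConst
  positivity

lemma velocity_rates_le (d : ℕ) {ν α N ε ρ : ℝ} (hν : 0 < ν) (hα : 0 < α) (hα₁ : α < 1)
    (hN : 0 ≤ N) (hε : 0 < ε) (hερ : ε ≤ ρ) :
    8 * N * ε ^ α / 1 * (ε ^ 2) ^ (1 : ℝ) +
      2 * N * mollifyConst d (4 / √ν) * (4 * ε ^ 2 / ν) / (α / 2) * (ρ ^ 2) ^ (α / 2) +
      N * mollifyConst d (4 / √ν) * (16 * ρ * ε ^ 2 / (ν * √ν)) / -((α - 1) / 2) *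
        (ρ ^ 2) ^ ((α - 1) / 2) ≤ velocityConst d ν α * N * ρ ^ α * ε ^ 2 := by
  have hρ : 0 < ρ := hε.trans_le hερ
  have hα' : 1 - α ≠ 0 := by linarith
  set M := mollifyConst d (4 / √ν)
  calc 8 * N * ε ^ α / 1 * (ε ^ 2) ^ (1 : ℝ) +
        2 * N * M * (4 * ε ^ 2 / ν) / (α / 2) * (ρ ^ 2) ^ (α / 2) +
        N * M * (16 * ρ * ε ^ 2 / (ν * √ν)) / -((α - 1) / 2) * (ρ ^ 2) ^ ((α - 1) / 2)
      = 8 * N * ε ^ α * ε ^ 2 +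
        (16 * M / (α * ν) + 32 * M / ((1 - α) * (ν * √ν))) * N * ρ ^ α * ε ^ 2 := by
        rw [sq_rpow_half hρ.le, sq_rpow_half hρ.le, Real.rpow_sub_one hρ.ne', Real.rpow_one,
          div_one, show -((α - 1) / 2) = (1 - α) / 2 by ring]
        field_simp
        ring
    _ ≤ 8 * N * ρ ^ α * ε ^ 2 +
        (16 * M / (α * ν) + 32 * M / ((1 - α) * (ν * √ν))) * N * ρ ^ α * ε ^ 2 := by gcongr
    _ = velocityConst d ν α * N * ρ ^ α * ε ^ 2 := by rw [velocityConst]; ring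

namespace StraightSolution

variable {ν : ℝ} {u : ℝ → Fin d → Vec d} {F F₁ G : ℝ → Slice d → ℝ}
  {F₂ : ℝ → Vec d → Slice d → ℝ}

lemma mollify_fwdDiff_source (h : StraightSolution ν u F F₁ G F₂) {τ : ℝ} (hτ : 0 < τ)
    (a : Slice d) : mollify ν τ (Δ_[a] (G τ)) = Δ_[a] (mollify ν τ (G τ)) := by
  obtain ⟨B, hB⟩ := h.bound_source hτ
  exact mollify_fwdDiff (h.continuous_source hτ) hB ν τ a

lemma mollify_secondDiff_fwdDiff_source (hF : StraightSolution ν u F F₁ G F₂) {τ : ℝ}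
    (hτ : 0 < τ) (w h y : Slice d) : mollify ν τ (Δ_[w] (Δ_[w] (Δ_[h] (G τ)))) y =
      _root_.secondDiff w (Δ_[h] (mollify ν τ (G τ))) (y + w) := by
  rw [((hF.fwdDiff h).fwdDiff w).mollify_fwdDiff_source hτ,
    (hF.fwdDiff h).mollify_fwdDiff_source hτ, hF.mollify_fwdDiff_source hτ,
    secondDiff_eq_fwdDiff_fwdDiff, add_sub_cancel_right]

lemma mollify_secondDiff_fwdDiff_source_le (hF : StraightSolution ν u F F₁ G F₂) {τ : ℝ}
    (hτ : 0 < τ) {w : Slice d} {c : ℝ} (hc : ∀ y, |_root_.secondDiff w (mollify ν τ (G τ)) y| ≤ c)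
    (h y : Slice d) : mollify ν τ (Δ_[w] (Δ_[w] (Δ_[h] (G τ)))) y ≤ 2 * c := by
  rw [hF.mollify_secondDiff_fwdDiff_source hτ, secondDiff_fwdDiff]
  linarith [(abs_le.mp (hc (y + w + h))).2, (abs_le.mp (hc (y + w))).1]

lemma peak_le_add_of_rpow_rate (hF : StraightSolution ν u F F₁ G F₂) (hν : 0 < ν)
    {τ₁ τ₂ c p : ℝ} (hτ₁ : 0 < τ₁) (hτ : τ₁ ≤ τ₂) (hc : 0 ≤ c) (hp : p ≠ 0)
    (hG : ∀ τ ∈ Icc τ₁ τ₂, ∀ y, mollify ν τ (G τ) y ≤ c * τ ^ (p - 1)) :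
    peak ν F τ₁ ≤ peak ν F τ₂ + (c / p * τ₂ ^ p - c / p * τ₁ ^ p) := by
  have hpos : ∀ {τ}, τ ∈ Icc τ₁ τ₂ → 0 < τ := fun hτ => hτ₁.trans_le hτ.1
  refine hF.peak_le_add hν hτ₁ hτ (β := fun τ => c / p * τ ^ p) (fun τ hτ => ?_)
    (fun τ hτ => mul_nonneg hc (Real.rpow_nonneg (hpos hτ).le _)) hG
  refine ((Real.hasDerivAt_rpow_const (Or.inl (hpos hτ).ne')).const_mul (c / p)).congr_deriv ?_
  field_simp

lemma peak_le_add_of_integrable_rate (hF : StraightSolution ν u F F₁ G F₂) (hν : 0 < ν)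
    {τ₁ τ₂ c p : ℝ} (hτ₁ : 0 < τ₁) (hτ : τ₁ ≤ τ₂) (hc : 0 ≤ c) (hp : 0 < p)
    (hG : ∀ τ ∈ Icc τ₁ τ₂, ∀ y, mollify ν τ (G τ) y ≤ c * τ ^ (p - 1)) :
    peak ν F τ₁ ≤ peak ν F τ₂ + c / p * τ₂ ^ p := by
  have hstart : 0 ≤ c / p * τ₁ ^ p := by positivity
  linarith [hF.peak_le_add_of_rpow_rate hν hτ₁ hτ hc hp.ne' hG]

lemma peak_le_of_singular_rate (hF : StraightSolution ν u F F₁ G F₂) (hν : 0 < ν)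
    {δ c p : ℝ} (hδ : 0 < δ) (hδ₁ : δ ≤ 1) (hc : 0 ≤ c) (hp : p < 0)
    (hG : ∀ τ, δ ≤ τ → ∀ y, mollify ν τ (G τ) y ≤ c * τ ^ (p - 1)) :
    peak ν F δ ≤ c / -p * δ ^ p := by
  have h := hF.peak_le_add_of_rpow_rate hν hδ hδ₁ hc hp.ne fun τ hτ => hG τ hτ.1
  have hend : c / p ≤ 0 := div_nonpos_of_nonneg_of_nonpos hc hp.le
  rw [hF.peak_eq_zero le_rfl, Real.one_rpow] at h
  rw [div_neg]
  linarith

section Estimates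

variable (hF : StraightSolution ν u F F₁ G F₂) (hν : 0 < ν) (hν₁ : ν ≤ 1) {α N : ℝ}
  (hα : 0 < α) (hα₁ : α < 1) (hN : 0 ≤ N) (hG : ∀ τ > 0, ShearHolder α N τ (G τ)) {ρ : ℝ}
  (hρ₁ : ρ ≤ 1)

include hF hν hν₁ hα hα₁ hN hG hρ₁

/-- The averaged source difference is bounded by its Hölder modulus up to time `ρ ^ 2` and by the
decay of the kernel's derivative afterwards. -/
lemma fwdDiff_position_le (hρ : 0 < ρ) {h : Vec d} (hh : ‖h‖ ≤ ρ ^ 3) (y : Slice d) :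
    Δ_[((h, 0) : Slice d)] (F 0) y ≤ positionConst d ν α * N * ρ ^ (2 + α) := by
  have hM := mollifyConst_nonneg d (R := 4 / √ν) (by positivity)
  have hdiff := hF.fwdDiff ((h, 0) : Slice d)
  refine hdiff.le_of_peak_le (δ := ρ ^ 2) (by positivity) (fun τ hτ => ?_) y
  have hshort : peak ν (fun τ => Δ_[((h, 0) : Slice d)] (F τ)) τ ≤
      peak ν (fun τ => Δ_[((h, 0) : Slice d)] (F τ)) (ρ ^ 2) + N * ρ ^ α / 1 * (ρ ^ 2) ^ (1 : ℝ) :=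
    hdiff.peak_le_add_of_integrable_rate hν hτ.1 hτ.2.le (by positivity) one_pos
      fun σ hσ y => by
        have hσ₀ : 0 < σ := hτ.1.trans_le hσ.1
        obtain ⟨B, hB⟩ := hF.bound_source hσ₀
        rw [hF.mollify_fwdDiff_source hσ₀, sub_self, Real.rpow_zero, mul_one]
        exact (le_abs_self _).trans <| ((hG σ hσ₀).mollify (hF.continuous_source hσ₀) hB
          σ).abs_fwdDiff_position_le hα hN hρ.le hh y
  have hlong : peak ν (fun τ => Δ_[((h, 0) : Slice d)] (F τ)) (ρ ^ 2) ≤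
      N * mollifyConst d (4 / √ν) * (2 * ρ ^ 3 / √ν) / -((α - 1) / 2) *
        (ρ ^ 2) ^ ((α - 1) / 2) :=
    hdiff.peak_le_of_singular_rate hν (by positivity) (pow_le_one₀ hρ.le hρ₁) (by positivity)
      (by linarith) fun σ hσ y => by
        have hσ₀ : 0 < σ := (by positivity : 0 < ρ ^ 2).trans_le hσ
        obtain ⟨B, hB⟩ := hF.bound_source hσ₀
        rw [hF.mollify_fwdDiff_source hσ₀]
        exact (le_abs_self _).trans <| (hG σ hσ₀).abs_fwdDiff_position_mollify_le hν hν₁ hα.le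
          hα₁.le hN (hF.continuous_source hσ₀) hB hρ hσ hh y
  have hα' : 1 - α ≠ 0 := by linarith
  calc peak ν (fun τ => Δ_[((h, 0) : Slice d)] (F τ)) τ
      ≤ N * mollifyConst d (4 / √ν) * (2 * ρ ^ 3 / √ν) / -((α - 1) / 2) *
          (ρ ^ 2) ^ ((α - 1) / 2) + N * ρ ^ α / 1 * (ρ ^ 2) ^ (1 : ℝ) := by linarith
    _ = positionConst d ν α * N * ρ ^ (2 + α) := by
        rw [sq_rpow_half hρ.le, Real.rpow_sub_one hρ.ne', positionConst, Real.rpow_one,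
          Real.rpow_add hρ, Real.rpow_two,
          show -((α - 1) / 2) = (1 - α) / 2 by ring]
        field_simp
        ring

/-- The source of the second difference is bounded by its Hölder modulus up to time `‖e‖ ^ 2`, by
the decay of the kernel's second derivatives up to time `ρ ^ 2`, and by that of its third
derivatives afterwards. -/
lemma secondDiff_velocity_fwdDiff_le {h : Slice d} (h₁ : ‖h.1‖ ≤ ρ ^ 3) (h₂ : ‖h.2‖ ≤ ρ)
    {e : Vec d} (he : e ≠ 0) (heρ : ‖e‖ ≤ ρ) (y : Slice d) :
    _root_.secondDiff ((0, e) : Slice d) (Δ_[h] (F 0)) y ≤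
      velocityConst d ν α * N * ρ ^ α * ‖e‖ ^ 2 := by
  have he₀ : 0 < ‖e‖ := norm_pos_iff.mpr he
  have hρ : 0 < ρ := he₀.trans_le heρ
  have hM := mollifyConst_nonneg d (R := 4 / √ν) (by positivity)
  set w : Slice d := (0, e)
  have hdiff := ((hF.fwdDiff h).fwdDiff w).fwdDiff w
  let P := peak ν (fun τ => Δ_[w] (Δ_[w] (Δ_[h] (F τ))))
  rw [secondDiff_eq_fwdDiff_fwdDiff]
  refine hdiff.le_of_peak_le (δ := ‖e‖ ^ 2) (by positivity) (fun τ hτ => ?_) (y - w)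
  have hshort : P τ ≤ P (‖e‖ ^ 2) + 8 * N * ‖e‖ ^ α / 1 * (‖e‖ ^ 2) ^ (1 : ℝ) :=
    hdiff.peak_le_add_of_integrable_rate hν hτ.1 hτ.2.le (by positivity) one_pos fun σ hσ y => by
      have hσ₀ : 0 < σ := hτ.1.trans_le hσ.1
      obtain ⟨B, hB⟩ := hF.bound_source hσ₀
      rw [sub_self, Real.rpow_zero, mul_one]
      refine (hF.mollify_secondDiff_fwdDiff_source_le hσ₀ (fun y =>
        ((hG σ hσ₀).mollify (ν := ν) (hF.continuous_source hσ₀) hB σ).abs_secondDiff_velocity_le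
          hα hN hσ₀.le hσ.2 y) h y).trans_eq (by ring)
  have hmid : P (‖e‖ ^ 2) ≤ P (ρ ^ 2) +
      2 * N * mollifyConst d (4 / √ν) * (4 * ‖e‖ ^ 2 / ν) / (α / 2) * (ρ ^ 2) ^ (α / 2) :=
    hdiff.peak_le_add_of_integrable_rate hν (by positivity) (by gcongr) (by positivity)
      (by positivity) fun σ hσ y => by
        have hσ₀ : 0 < σ := (by positivity : 0 < ‖e‖ ^ 2).trans_le hσ.1
        obtain ⟨B, hB⟩ := hF.bound_source hσ₀
        refine (hF.mollify_secondDiff_fwdDiff_source_le hσ₀ (fun y =>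
          (hG σ hσ₀).abs_secondDiff_velocity_mollify_le hν hν₁ hα.le hα₁.le hN
            (hF.continuous_source hσ₀) hB he hσ.1 y) h y).trans_eq (by ring)
  have hlong : P (ρ ^ 2) ≤ N * mollifyConst d (4 / √ν) * (16 * ρ * ‖e‖ ^ 2 / (ν * √ν)) /
      -((α - 1) / 2) * (ρ ^ 2) ^ ((α - 1) / 2) :=
    hdiff.peak_le_of_singular_rate hν (by positivity) (pow_le_one₀ hρ.le hρ₁) (by positivity)
      (by linarith) fun σ hσ y => by
        have hσ₀ : 0 < σ := (by positivity : 0 < ρ ^ 2).trans_le hσ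
        obtain ⟨B, hB⟩ := hF.bound_source hσ₀
        rw [hF.mollify_secondDiff_fwdDiff_source hσ₀]
        exact (le_abs_self _).trans <| (hG σ hσ₀).abs_secondDiff_velocity_fwdDiff_mollify_le hν
          hν₁ hα.le hα₁.le hN (hF.continuous_source hσ₀) hB he heρ hσ h₁ h₂ (y + w)
  linarith [velocity_rates_le d hν hα hα₁ hN he₀ heρ]

lemma secondDeriv_fwdDiff_le (hρ : 0 < ρ) {h : Slice d} (h₁ : ‖h.1‖ ≤ ρ ^ 3) (h₂ : ‖h.2‖ ≤ ρ)
    (e : Vec d) (y : Slice d) :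
    Δ_[h] (F₂ 0 e) y ≤ velocityConst d ν α * N * ρ ^ α * ‖e‖ ^ 2 := by
  refine le_of_tendsto (((hF.secondDiff 0 le_rfl e).fwdDiff h).tendsto y) ?_
  have hsmall : Tendsto (fun ε : ℝ => ‖ε • e‖) (𝓝[>] 0) (𝓝 0) := by
    have hcont : Continuous fun ε : ℝ => ‖ε • e‖ := by fun_prop
    simpa using (hcont.tendsto 0).mono_left nhdsWithin_le_nhds
  filter_upwards [self_mem_nhdsWithin, hsmall.eventually_lt_const hρ] with ε (hε : 0 < ε) hερ
  rcases eq_or_ne e 0 with rfl | he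
  · simp [kineticDir, _root_.secondDiff, two_mul, ← Prod.zero_eq_mk]
  have hquot := hF.secondDiff_velocity_fwdDiff_le hν hν₁ hα hα₁ hN hG hρ₁ h₁ h₂
    (smul_ne_zero hε.ne' he) hερ.le y
  rw [div_le_iff₀ (by positivity)]
  simpa [kineticDir, norm_smul, mul_pow, mul_assoc, mul_comm (ε ^ 2)] using hquot

end Estimates

end StraightSolution

end Schauder

section GlobalHolder

lemma dist_le_mul_of_steps {E X : Type*} [AddCommGroup E] [Module ℝ E] [PseudoMetricSpace X]
    {s : Set E} (hs : Convex ℝ s) {G : E → X} {y y' : E} (hy : y ∈ s) (hy' : y' ∈ s) {n : ℕ}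
    (hn : n ≠ 0) {c : ℝ}
    (hstep : ∀ z ∈ s, ∀ z' ∈ s, z' - z = (n : ℝ)⁻¹ • (y' - y) → dist (G z) (G z') ≤ c) :
    dist (G y) (G y') ≤ n * c := by
  have hn₀ : (0 : ℝ) < n := by positivity
  have hmem : ∀ k ≤ n, y + (k / n : ℝ) • (y' - y) ∈ s := fun k hk =>
    hs.add_smul_sub_mem hy hy' ⟨by positivity, div_le_one_of_le₀ (by exact_mod_cast hk) hn₀.le⟩
  have hsum := dist_le_range_sum_of_dist_le (f := fun k : ℕ => G (y + (k / n : ℝ) • (y' - y))) n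
    (d := fun _ => c) fun {k} hk => hstep _ (hmem k hk.le) _ (hmem (k + 1) hk) (by
      push_cast
      rw [add_div, add_smul, one_div]
      abel)
  simpa [div_self hn₀.ne'] using hsum

lemma exists_mem_segment_diff {E : Type*} [AddCommGroup E] [Module ℝ E] [TopologicalSpace E]
    [ContinuousAdd E] [ContinuousSMul ℝ E] {K s : Set E} (hK : IsClosed K) (hs : IsOpen s)
    (hKs : K ⊆ s) {y y' : E} (hy : y ∈ K) (hy' : y' ∉ s) : ∃ z ∈ segment ℝ y y', z ∈ s \ K := by
  by_contra! hcon
  have hcover : segment ℝ y y' ⊆ K ∪ sᶜ := fun z hz => by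
    by_contra hz'
    rw [mem_union, not_or, notMem_compl_iff] at hz'
    exact hcon z hz ⟨hz'.2, hz'.1⟩
  obtain ⟨z, -, hzK, hzs⟩ := isPreconnected_closed_iff.mp
    (convex_segment (𝕜 := ℝ) y y').isPreconnected K sᶜ hK hs.isClosed_compl hcover
    ⟨y, left_mem_segment ℝ y y', hy⟩ ⟨y', right_mem_segment ℝ y y', hy'⟩
  exact hzs (hKs hzK)

variable {d : ℕ}

/-- The modulus `|z₁| ^ p + |z₂| ^ q` of the anisotropic Hölder conditions. -/
noncomputable def holderGauge (p q : ℝ) (z : Slice d) : ℝ := ‖z.1‖ ^ p + ‖z.2‖ ^ q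

lemma holderGauge_nonneg (p q : ℝ) (z : Slice d) : 0 ≤ holderGauge p q z := by
  unfold holderGauge; positivity

lemma holderGauge_pos (p q : ℝ) {z : Slice d} (hz : z ≠ 0) : 0 < holderGauge p q z := by
  rcases not_and_or.mp (mt Prod.ext_iff.mpr hz) with hx | hv
  · exact add_pos_of_pos_of_nonneg (Real.rpow_pos_of_pos (norm_pos_iff.mpr hx) p)
      (Real.rpow_nonneg (norm_nonneg _) q)
  · exact add_pos_of_nonneg_of_pos (Real.rpow_nonneg (norm_nonneg _) p)
      (Real.rpow_pos_of_pos (norm_pos_iff.mpr hv) q)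

lemma holderGauge_sub_comm (p q : ℝ) (y y' : Slice d) :
    holderGauge p q (y - y') = holderGauge p q (y' - y) := by
  simp only [holderGauge, Prod.fst_sub, Prod.snd_sub, norm_sub_rev]

lemma holderGauge_smul_le {p q r : ℝ} (hp : 0 ≤ p) (hq : 0 ≤ q) (hr : r ∈ Icc (0 : ℝ) 1)
    (z : Slice d) : holderGauge p q (r • z) ≤ holderGauge p q z := by
  have hle : ∀ w : Vec d, ‖r • w‖ ≤ ‖w‖ := fun w => by
    rw [norm_smul, Real.norm_of_nonneg hr.1]
    exact mul_le_of_le_one_left (norm_nonneg w) hr.2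
  rw [holderGauge, holderGauge, Prod.smul_fst, Prod.smul_snd]
  gcongr <;> exact hle _

variable {p q N : ℝ} {G : Slice d → ℝ} {y y' : Slice d}

lemma dist_le_of_holder_half (hp : 0 ≤ p) (hq : 0 ≤ q) (hN : 0 ≤ N)
    (hG : ∀ y ∈ Metric.ball (0 : Slice d) 1, ∀ y' ∈ Metric.ball (0 : Slice d) 1,
      dist y y' < 1 / 2 → dist (G y) (G y') ≤ N * holderGauge p q (y - y'))
    (hy : y ∈ Metric.ball (0 : Slice d) 1) (hy' : y' ∈ Metric.ball (0 : Slice d) 1) :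
    dist (G y) (G y') ≤ 4 * N * holderGauge p q (y - y') := by
  rw [mul_assoc]
  refine dist_le_mul_of_steps (n := 4) (convex_ball 0 1) hy hy' (by norm_num)
    fun z hz z' hz' hzz => ?_
  have hdist : dist y' y < 2 := (dist_triangle_right y' y 0).trans_lt
    (by linarith [Metric.mem_ball.mp hy, Metric.mem_ball.mp hy'])
  have hsmall : dist z z' < 1 / 2 := by
    rw [dist_comm, dist_eq_norm, hzz, norm_smul, ← dist_eq_norm]
    norm_num
    linarith
  calc dist (G z) (G z') ≤ N * holderGauge p q (z - z') := hG z hz z' hz' hsmall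
    _ ≤ N * holderGauge p q (y - y') := by
      rw [holderGauge_sub_comm, hzz, holderGauge_sub_comm p q y]
      exact mul_le_mul_of_nonneg_left (holderGauge_smul_le hp hq (by norm_num) _) hN

lemma dist_le_of_holder_half_of_eq_zero (hp : 0 ≤ p) (hq : 0 ≤ q) (hN : 0 ≤ N)
    {K : Set (Slice d)} (hK : IsCompact K) (hKB : K ⊆ Metric.ball 0 1)
    (hG₀ : ∀ y, y ∉ K → G y = 0)
    (hG : ∀ y ∈ Metric.ball (0 : Slice d) 1, ∀ y' ∈ Metric.ball (0 : Slice d) 1,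
      dist y y' < 1 / 2 → dist (G y) (G y') ≤ N * holderGauge p q (y - y')) (y y' : Slice d) :
    dist (G y) (G y') ≤ 4 * N * holderGauge p q (y - y') := by
  wlog hy : y ∈ K generalizing y y'
  · by_cases hy' : y' ∈ K
    · rw [dist_comm, holderGauge_sub_comm]
      exact this y' y hy'
    · rw [hG₀ y hy, hG₀ y' hy', dist_self]
      exact mul_nonneg (by positivity) (holderGauge_nonneg p q _)
  by_cases hy' : y' ∈ Metric.ball (0 : Slice d) 1
  · exact dist_le_of_holder_half hp hq hN hG (hKB hy) hy'
  obtain ⟨z, hz, hzB, hzK⟩ := exists_mem_segment_diff hK.isClosed Metric.isOpen_ball hKB hy hy'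
  obtain ⟨r, hr, rfl⟩ := (segment_eq_image' ℝ y y').subset hz
  have hyz := dist_le_of_holder_half hp hq hN hG (hKB hy) hzB
  rw [hG₀ _ hzK] at hyz
  rw [hG₀ y' fun h => hy' (hKB h)]
  refine hyz.trans (mul_le_mul_of_nonneg_left ?_ (by positivity))
  rw [holderGauge_sub_comm, add_sub_cancel_left, holderGauge_sub_comm p q y]
  exact holderGauge_smul_le hp hq hr _

end GlobalHolder

section MatrixSquareRoot

open scoped Matrix

variable {d : ℕ}

open scoped MatrixOrder Matrix.Norms.L2Operator in
lemma exists_eq_transpose_mul_self {S : Matrix (Fin d) (Fin d) ℝ} (hS : S.PosSemidef) :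
    ∃ B : Matrix (Fin d) (Fin d) ℝ, S = Bᵀ * B := by
  obtain ⟨B, hB⟩ := CStarAlgebra.nonneg_iff_eq_star_mul_self.mp hS.nonneg
  exact ⟨B, by rw [hB, Matrix.star_eq_conjTranspose, Matrix.conjTranspose_eq_transpose_of_trivial]⟩

/-- The matrix of a bilinear form on `ℝᵈ` in the standard basis. -/
noncomputable def formMatrix (H : Vec d →L[ℝ] Vec d →L[ℝ] ℝ) : Matrix (Fin d) (Fin d) ℝ :=
  Matrix.of fun i j => H (EuclideanSpace.single i 1) (EuclideanSpace.single j 1)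

lemma apply_self_eq_dotProduct_formMatrix (H : Vec d →L[ℝ] Vec d →L[ℝ] ℝ) (w : Fin d → ℝ) :
    H (WithLp.toLp 2 w) (WithLp.toLp 2 w) = w ⬝ᵥ formMatrix H *ᵥ w := by
  have hw : WithLp.toLp 2 w = ∑ i, w i • (EuclideanSpace.single i 1 : Vec d) := by
    ext j
    simp [Finset.sum_apply, Pi.single_apply]
  simp only [hw, map_sum, map_smul, sum_apply, smul_apply, smul_eq_mul, dotProduct,
    Matrix.mulVec, formMatrix, Matrix.of_apply, Finset.mul_sum]
  rw [Finset.sum_comm]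
  simp only [mul_comm, mul_left_comm]

lemma trace_transpose_mul_self_mul_formMatrix (B : Matrix (Fin d) (Fin d) ℝ)
    (H : Vec d →L[ℝ] Vec d →L[ℝ] ℝ) :
    (Bᵀ * B * formMatrix H).trace = ∑ k, H (WithLp.toLp 2 (B k)) (WithLp.toLp 2 (B k)) := by
  simp_rw [apply_self_eq_dotProduct_formMatrix]
  rw [Matrix.mul_assoc, Matrix.trace_mul_comm, Matrix.mul_assoc]
  simp only [Matrix.trace, Matrix.diag_apply, Matrix.mul_apply, dotProduct, Matrix.mulVec,
    Matrix.transpose_apply]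

variable {A : Matrix (Fin d) (Fin d) ℝ} {c C : ℝ}

lemma posSemidef_symmetrization_sub_smul_one (hA : ∀ ξ, c * (ξ ⬝ᵥ ξ) ≤ ξ ⬝ᵥ A *ᵥ ξ) :
    ((1 / 2 : ℝ) • (A + Aᵀ) - c • 1).PosSemidef := by
  refine Matrix.PosSemidef.of_dotProduct_mulVec_nonneg ?_ fun ξ => ?_
  · simp [Matrix.IsHermitian, add_comm]
  · have ht : ξ ⬝ᵥ Aᵀ *ᵥ ξ = ξ ⬝ᵥ A *ᵥ ξ := by
      rw [Matrix.mulVec_transpose, dotProduct_comm, ← Matrix.dotProduct_mulVec]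
    simp only [star_trivial, Matrix.sub_mulVec, Matrix.smul_mulVec, Matrix.add_mulVec,
      Matrix.one_mulVec, dotProduct_sub, dotProduct_smul, dotProduct_add, ht, smul_eq_mul]
    linarith [hA ξ]

lemma trace_symmetrization_mul {M : Matrix (Fin d) (Fin d) ℝ} (hM : Mᵀ = M) :
    ((1 / 2 : ℝ) • (A + Aᵀ) * M).trace = (A * M).trace := by
  have ht : (Aᵀ * M).trace = (A * M).trace := by
    rw [← Matrix.trace_transpose, Matrix.transpose_mul, hM, Matrix.transpose_transpose,
      Matrix.trace_mul_comm]
  rw [Matrix.smul_mul, Matrix.add_mul, Matrix.trace_smul, Matrix.trace_add, ht, smul_eq_mul]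
  ring

/-- `A` acts on symmetric forms as `c Id + ∑ k, u k ⊗ u k`. -/
def HasSquareDecomposition (A : Matrix (Fin d) (Fin d) ℝ) (c : ℝ) (u : Fin d → Vec d) : Prop :=
  ∀ H : Vec d →L[ℝ] Vec d →L[ℝ] ℝ, (∀ x y, H x y = H y x) → (A * formMatrix H).trace =
    c * ∑ i, H (EuclideanSpace.single i 1) (EuclideanSpace.single i 1) + ∑ k, H (u k) (u k)

lemma exists_hasSquareDecomposition (hA : ∀ ξ, c * (ξ ⬝ᵥ ξ) ≤ ξ ⬝ᵥ A *ᵥ ξ) :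
    ∃ u, HasSquareDecomposition A c u := by
  obtain ⟨B, hB⟩ := exists_eq_transpose_mul_self (posSemidef_symmetrization_sub_smul_one hA)
  refine ⟨fun k => WithLp.toLp 2 (B k), fun H hH => ?_⟩
  have hM : (formMatrix H)ᵀ = formMatrix H := Matrix.ext fun i j => hH _ _
  rw [← trace_symmetrization_mul hM, ← trace_transpose_mul_self_mul_formMatrix, ← hB,
    Matrix.sub_mul, Matrix.trace_sub, Matrix.smul_mul c, Matrix.one_mul, Matrix.trace_smul,
    smul_eq_mul]
  exact (add_sub_cancel _ _).symm

lemma trace_le_of_quadratic_le (hA : ∀ ξ, ξ ⬝ᵥ A *ᵥ ξ ≤ C * (ξ ⬝ᵥ ξ)) : A.trace ≤ d * C := by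
  have hdiag : ∀ i, A i i ≤ C := fun i => by simpa using hA (Pi.single i 1)
  simpa [Matrix.trace] using Finset.sum_le_sum fun i (_ : i ∈ Finset.univ) => hdiag i

lemma HasSquareDecomposition.norm_sq_le {u : Fin d → Vec d} (hu : HasSquareDecomposition A c u)
    (hc : 0 ≤ c) (hA : ∀ ξ, ξ ⬝ᵥ A *ᵥ ξ ≤ C * (ξ ⬝ᵥ ξ)) (k : Fin d) : ‖u k‖ ^ 2 ≤ d * C := by
  let inner₂ : Vec d →L[ℝ] Vec d →L[ℝ] ℝ := innerSL ℝ
  have hinner : ∀ x y, inner₂ x y = inner ℝ x y := fun _ _ => rfl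
  have hone : formMatrix inner₂ = 1 := by
    ext i j
    rw [formMatrix, Matrix.of_apply, hinner,
      orthonormal_iff_ite.mp EuclideanSpace.orthonormal_single, Matrix.one_apply]
  have htrace := hu inner₂ fun x y => real_inner_comm y x
  simp only [hone, Matrix.mul_one, hinner, real_inner_self_eq_norm_sq] at htrace
  calc ‖u k‖ ^ 2 ≤ ∑ k, ‖u k‖ ^ 2 :=
        Finset.single_le_sum (f := fun k => ‖u k‖ ^ 2) (fun _ _ => sq_nonneg _) (Finset.mem_univ k)
    _ ≤ A.trace := htrace ▸ le_add_of_nonneg_left (by positivity)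
    _ ≤ d * C := trace_le_of_quadratic_le hA

end MatrixSquareRoot

section ZeroExtension

/-- `φ`, as a function on `Q`, is supported in the compact subset `K` of `Q` (values off `Q` are
ignored). This is `CompactSupportIn` with the compact set named, for functions with values in any
space. -/
structure SupportedBy {X E : Type*} [TopologicalSpace X] [Zero E] (Q K : Set X) (φ : X → E) :
    Prop where
  isCompact : IsCompact K
  subset : K ⊆ Q
  eq_zero : ∀ z ∈ Q, z ∉ K → φ z = 0

section Indicator

variable {X E : Type*} [TopologicalSpace X] {Q S K : Set X} {z : X}

lemma SupportedBy.indicator_eq_zero [Zero E] {φ : X → E} (h : SupportedBy Q K φ) (hz : z ∉ K) :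
    Q.indicator φ z = 0 :=
  indicator_apply_eq_zero.mpr fun hQ => h.eq_zero z hQ hz

lemma SupportedBy.exists_norm_indicator_le [NormedAddCommGroup E] {φ : X → E}
    (h : SupportedBy Q K φ) (hφ : ContinuousOn φ Q) : ∃ B, ∀ z, ‖Q.indicator φ z‖ ≤ B := by
  obtain ⟨B, hB⟩ := h.isCompact.exists_bound_of_continuousOn (hφ.mono h.subset)
  refine ⟨max B 0, fun z => ?_⟩
  by_cases hz : z ∈ K
  · exact indicator_of_mem (h.subset hz) φ ▸ (hB z hz).trans (le_max_left _ _)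
  · simp [h.indicator_eq_zero hz]

variable [T2Space X]

lemma SupportedBy.eventually_notMem [Zero E] {φ : X → E} (h : SupportedBy Q K φ) (hz : z ∉ K) :
    ∀ᶠ w in 𝓝 z, w ∉ K :=
  h.isCompact.isClosed.isOpen_compl.mem_nhds hz

lemma SupportedBy.continuousOn_indicator [Zero E] [TopologicalSpace E] {φ : X → E}
    (h : SupportedBy Q K φ) (hφ : ContinuousOn φ Q) (hQ : ∀ z ∈ Q, Q ∈ 𝓝[S] z) :
    ContinuousOn (Q.indicator φ) S := by
  intro z _
  by_cases hz : z ∈ Q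
  · exact ((hφ z hz).mono_of_mem_nhdsWithin (hQ z hz)).congr_of_eventuallyEq
      (eventually_of_mem (hQ z hz) fun _ hw => indicator_of_mem hw φ) (indicator_of_mem hz φ)
  · refine (continuousAt_const.congr (f := fun _ => (0 : E)) ?_).continuousWithinAt
    filter_upwards [h.eventually_notMem fun hzK => hz (h.subset hzK)] with w hw
    exact (h.indicator_eq_zero hw).symm

end Indicator

variable {d : ℕ} {r : ℝ} {f : Phase d → ℝ} {K : Set (Phase d)} {z : Phase d}

lemma mem_kineticCylinder : z ∈ kineticCylinder d r ↔
    (-r ^ 2 < z.1 ∧ z.1 ≤ 0) ∧ ‖z.2.1‖ < r ^ 3 ∧ ‖z.2.2‖ < r := by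
  simp [kineticCylinder, Set.mem_prod]

lemma kineticCylinder_mem_nhdsWithin (hz : z ∈ kineticCylinder d r) :
    kineticCylinder d r ∈ 𝓝[Iic 0 ×ˢ univ] z := by
  rw [kineticCylinder, ← Ioi_inter_Iic, nhdsWithin_prod_eq, nhdsWithin_univ]
  exact prod_mem_prod
    (inter_mem (mem_nhdsWithin_of_mem_nhds (Ioi_mem_nhds hz.1.1)) self_mem_nhdsWithin)
    (prod_mem_nhds (Metric.isOpen_ball.mem_nhds hz.2.1) (Metric.isOpen_ball.mem_nhds hz.2.2))

lemma eventually_mem_kineticCylinder (hz : z ∈ kineticCylinder d r) :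
    ∀ᶠ v in 𝓝 z.2.2, (z.1, z.2.1, v) ∈ kineticCylinder d r := by
  filter_upwards [Metric.isOpen_ball.mem_nhds hz.2.2] with v hv
  exact ⟨hz.1, hz.2.1, hv⟩

lemma SupportedBy.eventually_velocity_notMem {Q : Set (Phase d)} (h : SupportedBy Q K f)
    (hz : z ∉ K) : ∀ᶠ v in 𝓝 z.2.2, (z.1, z.2.1, v) ∉ K :=
  (by fun_prop : Continuous fun v : Vec d => ((z.1, z.2.1, v) : Phase d)).continuousAt.eventually
    (h.eventually_notMem hz)

lemma continuous_transportCurve (z : Phase d) : Continuous (transportCurve z) := by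
  unfold transportCurve
  fun_prop

lemma transportCurve_zero (z : Phase d) : transportCurve z 0 = z := by
  simp [transportCurve]

lemma tendsto_transportCurve (z : Phase d) : Tendsto (transportCurve z) (𝓝 0) (𝓝 z) := by
  simpa only [transportCurve_zero] using (continuous_transportCurve z).tendsto 0

lemma SupportedBy.transportDeriv {Q : Set (Phase d)} (h : SupportedBy Q K f) :
    SupportedBy Q K (transportDeriv Q f) where
  isCompact := h.isCompact
  subset := h.subset
  eq_zero z hzQ hz := by
    have hev : (fun s => f (transportCurve z s)) =ᶠ[𝓝[{s | transportCurve z s ∈ Q}] 0]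
        fun _ => 0 := by
      filter_upwards [mem_nhdsWithin_of_mem_nhds ((tendsto_transportCurve z).eventually
        (h.eventually_notMem hz)), self_mem_nhdsWithin] with s hs hsQ
      exact h.eq_zero _ hsQ hs
    rw [_root_.transportDeriv, hev.derivWithin_eq ?_, derivWithin_fun_const, Pi.zero_apply]
    simpa only [transportCurve_zero] using h.eq_zero z hzQ hz

lemma hessV_congr {f g : Phase d → ℝ}
    (h : ∀ᶠ v in 𝓝 z.2.2, f (z.1, z.2.1, v) = g (z.1, z.2.1, v)) : hessV f z = hessV g z :=
  (EventuallyEq.fderiv h).fderiv_eq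

lemma hessV_eq_zero (h : ∀ᶠ v in 𝓝 z.2.2, f (z.1, z.2.1, v) = 0) : hessV f z = 0 := by
  rw [hessV_congr (g := fun _ => 0) h]
  simp [hessV]

lemma SupportedBy.hessV (h : SupportedBy (kineticCylinder d r) K f) :
    SupportedBy (kineticCylinder d r) K (hessV f) where
  isCompact := h.isCompact
  subset := h.subset
  eq_zero z hzQ hz := by
    refine hessV_eq_zero ?_
    filter_upwards [eventually_mem_kineticCylinder hzQ, h.eventually_velocity_notMem hz]
      with v hvQ hv
    exact h.eq_zero _ hvQ hv

lemma SupportedBy.hessV_indicator (h : SupportedBy (kineticCylinder d r) K f) (z : Phase d) :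
    _root_.hessV ((kineticCylinder d r).indicator f) z =
      (kineticCylinder d r).indicator (_root_.hessV f) z := by
  by_cases hz : z ∈ kineticCylinder d r
  · rw [indicator_of_mem hz]
    refine hessV_congr ?_
    filter_upwards [eventually_mem_kineticCylinder hz] with v hv
    exact indicator_of_mem hv f
  · rw [indicator_of_notMem hz]
    refine hessV_eq_zero ?_
    filter_upwards [h.eventually_velocity_notMem fun hzK => hz (h.subset hzK)] with v hv
    exact h.indicator_eq_zero hv

lemma KineticC2.contDiffAt_velocity (hf : KineticC2 r f) (hz : z ∈ kineticCylinder d r) :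
    ContDiffAt ℝ 2 (fun v => f (z.1, z.2.1, v)) z.2.2 :=
  (hf.contDiffOn_v z.1 hz.1 z.2.1 hz.2.1).contDiffAt (Metric.isOpen_ball.mem_nhds hz.2.2)

lemma contDiff_indicator (hf : KineticC2 r f) (h : SupportedBy (kineticCylinder d r) K f)
    (t : ℝ) (x : Vec d) : ContDiff ℝ 2 fun v => (kineticCylinder d r).indicator f (t, x, v) := by
  refine contDiff_iff_contDiffAt.mpr fun v => ?_
  by_cases hz : (t, x, v) ∈ kineticCylinder d r
  · refine (hf.contDiffAt_velocity hz).congr_of_eventuallyEq ?_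
    filter_upwards [eventually_mem_kineticCylinder hz] with w hw
    exact indicator_of_mem hw f
  · refine (contDiffAt_const (c := (0 : ℝ))).congr_of_eventuallyEq ?_
    filter_upwards [h.eventually_velocity_notMem fun hzK => hz (h.subset hzK)] with w hw
    exact h.indicator_eq_zero hw

lemma hasDerivAt_indicator_transportCurve (hf : KineticC2 r f)
    (h : SupportedBy (kineticCylinder d r) K f) (hz : z.1 < 0) :
    HasDerivAt (fun s => (kineticCylinder d r).indicator f (transportCurve z s))
      ((kineticCylinder d r).indicator (transportDeriv (kineticCylinder d r) f) z) 0 := by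
  by_cases hzQ : z ∈ kineticCylinder d r
  · rw [indicator_of_mem hzQ]
    have hnhds : {s | transportCurve z s ∈ kineticCylinder d r} ∈ 𝓝 (0 : ℝ) := by
      have hQ := kineticCylinder_mem_nhdsWithin hzQ
      rw [nhdsWithin_eq_nhds.mpr (prod_mem_nhds (Iic_mem_nhds hz) univ_mem)] at hQ
      exact tendsto_transportCurve z hQ
    refine ((hf.transport_differentiable z hzQ).hasDerivWithinAt.hasDerivAt
      hnhds).congr_of_eventuallyEq ?_
    filter_upwards [hnhds] with s hs
    exact indicator_of_mem hs f
  · rw [indicator_of_notMem hzQ]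
    refine (hasDerivAt_const 0 (0 : ℝ)).congr_of_eventuallyEq ?_
    filter_upwards [(tendsto_transportCurve z).eventually
      (h.eventually_notMem fun hzK => hzQ (h.subset hzK))] with s hs
    exact h.indicator_eq_zero hs

lemma hessV_symm (hf : ContDiffAt ℝ 2 (fun v => f (z.1, z.2.1, v)) z.2.2) (e e' : Vec d) :
    hessV f z e e' = hessV f z e' e :=
  (hf.isSymmSndFDerivAt (by simp)).eq e e'

end ZeroExtension

section Straightening

variable {d : ℕ}

/-- A function of `(t, x, v)` along the transport field, backwards from time `t`. -/
def straighten {E : Type*} (t : ℝ) (φ : Phase d → E) (τ : ℝ) (y : Slice d) : E :=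
  φ (t - τ, y.1 - τ • y.2, y.2)

lemma straighten_zero {E : Type*} (t : ℝ) (φ : Phase d → E) (y : Slice d) :
    straighten t φ 0 y = φ (t, y) := by
  simp [straighten]

section Continuity

variable {E : Type*} [TopologicalSpace E] {φ : Phase d → E} {t : ℝ}

lemma continuousOn_straighten (hφ : ContinuousOn φ (Iic 0 ×ˢ univ)) (ht : t ≤ 0) :
    ContinuousOn (fun p : ℝ × Slice d => straighten t φ p.1 p.2) (Ici 0 ×ˢ univ) :=
  hφ.comp (f := fun p : ℝ × Slice d => (t - p.1, p.2.1 - p.1 • p.2.2, p.2.2)) (by fun_prop)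
    fun _ hp => ⟨sub_nonpos_of_le (ht.trans hp.1), mem_univ _⟩

lemma continuous_straighten (hφ : ContinuousOn φ (Iic 0 ×ˢ univ)) (ht : t ≤ 0) {τ : ℝ}
    (hτ : 0 ≤ τ) : Continuous (straighten t φ τ) :=
  continuousOn_univ.mp <| (continuousOn_straighten hφ ht).comp (f := fun y : Slice d => (τ, y))
    (by fun_prop) fun _ _ => ⟨hτ, mem_univ _⟩

end Continuity

section Support

variable {E : Type*} [Zero E] {r t τ : ℝ} (φ : Phase d → E) (ht : t ≤ 0)

include ht

lemma straighten_indicator_eq_zero_of_le (hτ : r ^ 2 ≤ τ) (y : Slice d) :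
    straighten t ((kineticCylinder d r).indicator φ) τ y = 0 :=
  indicator_of_notMem (fun hy => by linarith [(mem_kineticCylinder.mp hy).1.1]) φ

lemma straighten_indicator_eq_zero_of_lt_norm (hτ : 0 ≤ τ) {y : Slice d}
    (hy : r + 2 * r ^ 3 < ‖y‖) : straighten t ((kineticCylinder d r).indicator φ) τ y = 0 := by
  refine indicator_of_notMem (fun hyQ => hy.not_ge ?_) φ
  obtain ⟨⟨ht₁ : -r ^ 2 < t - τ, -⟩, hx : ‖y.1 - τ • y.2‖ < r ^ 3, hv : ‖y.2‖ < r⟩ :=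
    mem_kineticCylinder.mp hyQ
  have hr : 0 ≤ r := (norm_nonneg _).trans hv.le
  refine max_le ?_ (by linarith [pow_nonneg hr 3])
  calc ‖y.1‖ ≤ ‖y.1 - τ • y.2‖ + ‖τ • y.2‖ := norm_le_norm_sub_add _ _
    _ ≤ r ^ 3 + r ^ 2 * r := by
        rw [norm_smul, Real.norm_of_nonneg hτ]
        gcongr
        linarith
    _ ≤ r + 2 * r ^ 3 := by linarith

end Support

variable {r t τ : ℝ} {f : Phase d → ℝ} {K : Set (Phase d)}

lemma hasDerivAt_straighten_indicator (hf : KineticC2 r f)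
    (h : SupportedBy (kineticCylinder d r) K f) (hτ : t < τ) (y : Slice d) :
    HasDerivAt (fun τ => straighten t ((kineticCylinder d r).indicator f) τ y)
      (-straighten t ((kineticCylinder d r).indicator (transportDeriv (kineticCylinder d r) f))
        τ y) τ := by
  have hcurve := hasDerivAt_indicator_transportCurve hf h
    (z := (t - τ, y.1 - τ • y.2, y.2)) (sub_neg_of_lt hτ)
  rw [← sub_self τ] at hcurve
  refine ((hcurve.comp τ ((hasDerivAt_id τ).const_sub τ)).congr_of_eventuallyEq
    (Eventually.of_forall fun σ => ?_)).congr_deriv (mul_neg_one _)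
  have hpoint : transportCurve (t - τ, y.1 - τ • y.2, y.2) (τ - σ) =
      (t - σ, y.1 - σ • y.2, y.2) :=
    Prod.ext (sub_add_sub_cancel t τ σ) (Prod.ext (by simp only [transportCurve]; module) rfl)
  simp only [Function.comp_apply, hpoint, straighten]

lemma hasLineDerivAt_straighten {φ φ' : Phase d → ℝ} {e : Vec d}
    (h : ∀ z : Phase d, HasLineDerivAt ℝ (fun v => φ (z.1, z.2.1, v)) (φ' z) z.2.2 e)
    (t τ : ℝ) (y : Slice d) :
    HasLineDerivAt ℝ (straighten t φ τ) (straighten t φ' τ y) y (kineticDir τ e) := by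
  refine HasDerivAt.congr_of_eventuallyEq (h (t - τ, y.1 - τ • y.2, y.2))
    (Eventually.of_forall fun s => ?_)
  have hx : y.1 + s • τ • e - τ • (y.2 + s • e) = y.1 - τ • y.2 := by module
  simp only [straighten, kineticDir, Prod.fst_add, Prod.snd_add, Prod.smul_fst, Prod.smul_snd, hx]

lemma exists_abs_indicator_hessV_le (hf : KineticC2 r f)
    (h : SupportedBy (kineticCylinder d r) K f) (e : Vec d) :
    ∃ B, ∀ z, |(kineticCylinder d r).indicator (hessV f) z e e| ≤ B := by
  obtain ⟨B, hB⟩ := h.hessV.exists_norm_indicator_le (φ := hessV f) hf.hess_continuousOn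
  exact ⟨B * ‖e‖ * ‖e‖, fun z =>
    (((kineticCylinder d r).indicator (hessV f) z).le_opNorm₂ e e).trans (by gcongr; exact hB z)⟩

lemma continuous_straighten_hessV (hf : KineticC2 r f)
    (h : SupportedBy (kineticCylinder d r) K f) (ht : t ≤ 0) (hτ : 0 ≤ τ) (e : Vec d) :
    Continuous fun y => straighten t ((kineticCylinder d r).indicator (hessV f)) τ y e e := by
  have := continuous_straighten (h.hessV.continuousOn_indicator hf.hess_continuousOn
    fun z => kineticCylinder_mem_nhdsWithin) ht hτ
  fun_prop

lemma hasSecondDiff_straighten_indicator (hf : KineticC2 r f)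
    (h : SupportedBy (kineticCylinder d r) K f) (ht : t ≤ 0) (hτ : 0 ≤ τ) (e : Vec d) :
    HasSecondDiff (straighten t ((kineticCylinder d r).indicator f) τ) (kineticDir τ e)
      fun y => straighten t ((kineticCylinder d r).indicator (hessV f)) τ y e e := by
  have hφ := contDiff_indicator hf h
  refine .of_hasLineDerivAt
    (H₁ := straighten t (fun z => fderiv ℝ
      (fun v => (kineticCylinder d r).indicator f (z.1, z.2.1, v)) z.2.2 e) τ)
    (hasLineDerivAt_straighten (fun z => ?_) t τ)
    (hasLineDerivAt_straighten (φ' := fun z => (kineticCylinder d r).indicator (hessV f) z e e)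
      (fun z => ?_) t τ) ?_ ?_
  · exact ((hφ z.1 z.2.1).differentiable two_ne_zero _).hasFDerivAt.hasLineDerivAt e
  · rw [← h.hessV_indicator]
    exact ((ContinuousLinearMap.apply ℝ ℝ e).hasFDerivAt.comp _ (((hφ z.1 z.2.1).fderiv_right
      (m := 1) (by norm_num)).differentiable one_ne_zero _).hasFDerivAt).hasLineDerivAt e
  · exact continuous_straighten_hessV hf h ht hτ e
  · exact let ⟨B, hB⟩ := exists_abs_indicator_hessV_le hf h e; ⟨B, fun _ => hB _⟩

/-- The source term with which `f` solves, relative to `Q`, the equation with diffusion matrix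
`ν Id + ∑ k, w k ⊗ w k`. -/
noncomputable def sourceTerm (Q : Set (Phase d)) (ν : ℝ) (w : Fin d → Vec d) (f : Phase d → ℝ)
    (z : Phase d) : ℝ :=
  transportDeriv Q f z - (ν * ∑ i, hessV f z (EuclideanSpace.single i 1) (EuclideanSpace.single i 1)
    + ∑ k, hessV f z (w k) (w k))

lemma indicator_transportDeriv_eq (Q : Set (Phase d)) (ν : ℝ) (w : Fin d → Vec d)
    (f : Phase d → ℝ) (z : Phase d) :
    Q.indicator (transportDeriv Q f) z =
      ν * ∑ i, Q.indicator (hessV f) z (EuclideanSpace.single i 1) (EuclideanSpace.single i 1)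
        + ∑ k, Q.indicator (hessV f) z (w k) (w k) + Q.indicator (sourceTerm Q ν w f) z := by
  by_cases hz : z ∈ Q
  · simp only [indicator_of_mem hz, sourceTerm, add_sub_cancel]
  · simp [indicator_of_notMem hz]

lemma straightSolution_straighten (hf : KineticC2 1 f)
    (h : SupportedBy (kineticCylinder d 1) K f) (ht : t ≤ 0) (ν : ℝ) (u : ℝ → Fin d → Vec d) :
    StraightSolution ν u (straighten t ((kineticCylinder d 1).indicator f))
      (straighten t ((kineticCylinder d 1).indicator (transportDeriv (kineticCylinder d 1) f)))
      (fun τ => straighten t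
        ((kineticCylinder d 1).indicator (sourceTerm (kineticCylinder d 1) ν (u τ) f)) τ)
      fun τ e y => straighten t ((kineticCylinder d 1).indicator (hessV f)) τ y e e where
  continuousOn := continuousOn_straighten
    (h.continuousOn_indicator hf.continuousOn fun z => kineticCylinder_mem_nhdsWithin) ht
  continuous₁ τ hτ := continuous_straighten (h.transportDeriv.continuousOn_indicator
    hf.transport_continuousOn fun z => kineticCylinder_mem_nhdsWithin) ht hτ.le
  continuous₂ τ hτ e := continuous_straighten_hessV hf h ht hτ.le e
  bound := let ⟨B, hB⟩ := h.exists_norm_indicator_le hf.continuousOn; ⟨B, fun _ _ _ => hB _⟩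
  bound₁ := let ⟨B, hB⟩ := h.transportDeriv.exists_norm_indicator_le hf.transport_continuousOn
    ⟨B, fun _ _ _ => hB _⟩
  bound₂ e := let ⟨B, hB⟩ := exists_abs_indicator_hessV_le hf h e; ⟨B, fun _ _ _ => hB _⟩
  support := ⟨_, fun τ hτ y hy => ⟨straighten_indicator_eq_zero_of_lt_norm f ht hτ hy,
    straighten_indicator_eq_zero_of_lt_norm _ ht hτ hy, fun e => by
      rw [straighten_indicator_eq_zero_of_lt_norm _ ht hτ hy, zero_apply, zero_apply]⟩⟩
  hasDerivAt τ hτ := hasDerivAt_straighten_indicator hf h (ht.trans_lt hτ)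
  secondDiff τ hτ := hasSecondDiff_straighten_indicator hf h ht hτ
  equation τ _ y := indicator_transportDeriv_eq _ ν (u τ) f _
  initial τ hτ := straighten_indicator_eq_zero_of_le f ht (by simpa using hτ)

end Straightening

section LimitSource

variable {d : ℕ}

lemma dist_le_of_holderXV {F : Type*} [NormedAddCommGroup F] {p q t : ℝ} {Q : Set (Phase d)}
    {g : Phase d → F} (hg : holderXV p q Q g < ∞) {y y' : Slice d} (hy : (t, y) ∈ Q)
    (hy' : (t, y') ∈ Q) (hd : dist y y' < 1 / 2) :
    dist (g (t, y)) (g (t, y')) ≤ (holderXV p q Q g).toReal * holderGauge p q (y - y') := by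
  obtain ⟨x, v⟩ := y
  obtain ⟨x', v'⟩ := y'
  rw [dist_eq_norm, Prod.norm_def, max_lt_iff] at hd
  rcases eq_or_ne (x, v) (x', v') with hne | hne
  · rw [hne, dist_self]
    exact mul_nonneg ENNReal.toReal_nonneg (holderGauge_nonneg _ _ _)
  rw [← div_le_iff₀ (holderGauge_pos p q (sub_ne_zero.mpr hne)),
    ← ENNReal.ofReal_le_iff_le_toReal hg.ne, dist_eq_norm]
  exact le_iSup_of_le t <| le_iSup_of_le x <| le_iSup_of_le v <| le_iSup_of_le x' <|
    le_iSup_of_le v' <| le_iSup_of_le hy <| le_iSup_of_le hy' <| le_iSup_of_le hne <|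
    le_iSup_of_le hd.1 <| le_iSup_of_le hd.2 le_rfl

lemma exists_seq_tendsto_of_ae {P : ℝ → Prop} (hP : ∀ᵐ t, P t) {a b s : ℝ} (hs : s ∈ Ioc a b) :
    ∃ t : ℕ → ℝ, (∀ n, t n ∈ Ioo a b ∧ P (t n)) ∧ Tendsto t atTop (𝓝 s) := by
  have hcl : s ∈ closure (Ioo a b) := by
    rw [closure_Ioo (hs.1.trans_le hs.2).ne]
    exact Ioc_subset_Icc_self hs
  exact mem_closure_iff_seq_limit.mp <| closure_minimal
    ((Measure.dense_of_ae hP).open_subset_closure_inter isOpen_Ioo) isClosed_closure hcl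

variable {r : ℝ} {f : Phase d → ℝ}

lemma continuousOn_sourceTerm (hf : KineticC2 r f) (ν : ℝ) :
    ContinuousOn (fun p : (Fin d → Vec d) × Phase d =>
      sourceTerm (kineticCylinder d r) ν p.1 f p.2) (univ ×ˢ kineticCylinder d r) := by
  have hsnd : ContinuousOn Prod.snd ((univ : Set (Fin d → Vec d)) ×ˢ kineticCylinder d r) :=
    continuousOn_snd
  have hT := hf.transport_continuousOn.comp hsnd fun p hp => hp.2
  have hH := hf.hess_continuousOn.comp hsnd fun p hp => hp.2
  simp only [Function.comp_def] at hT hH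
  simp only [sourceTerm]
  fun_prop

lemma sourceTerm_eq_of_trace_eq (hf : KineticC2 r f) {A : Matrix (Fin d) (Fin d) ℝ} {ν b : ℝ}
    {w : Fin d → Vec d} (hw : HasSquareDecomposition A ν w) {z : Phase d}
    (hz : z ∈ kineticCylinder d r)
    (hA : transportDeriv (kineticCylinder d r) f z = (A * hessVMatrix f z).trace + b) :
    sourceTerm (kineticCylinder d r) ν w f z = b := by
  have hsymm := hessV_symm (hf.contDiffAt_velocity hz)
  rw [sourceTerm, hA, ← hw (hessV f z) hsymm]
  exact add_sub_cancel_left _ b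

/-- The equation at exceptional times: it is inherited in the limit from nearby times, with some
limit of the diffusion matrices there, since both sides but for the matrix and the source are
continuous in time. -/
lemma exists_dist_sourceTerm_le {Λ p q : ℝ} (hΛ : 0 < Λ) {a : ℝ → Matrix (Fin d) (Fin d) ℝ}
    {g : Phase d → ℝ} (ha : IsEllipticCoeff Λ a) (hf : KineticC2 r f)
    (hg : holderXV p q (kineticCylinder d r) g < ∞) (heq : SolvesHomogeneousKFP r a f g) {s : ℝ}
    (hs : s ∈ Ioc (-r ^ 2) 0) :
    ∃ w : Fin d → Vec d, ∀ y y' : Slice d, (s, y) ∈ kineticCylinder d r →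
      (s, y') ∈ kineticCylinder d r → dist y y' < 1 / 2 →
      dist (sourceTerm (kineticCylinder d r) Λ⁻¹ w f (s, y))
        (sourceTerm (kineticCylinder d r) Λ⁻¹ w f (s, y')) ≤
        (holderXV p q (kineticCylinder d r) g).toReal * holderGauge p q (y - y') := by
  obtain ⟨t, ht, hts⟩ := exists_seq_tendsto_of_ae heq hs
  choose w hw using fun n => exists_hasSquareDecomposition fun ξ => (ha.2 (t n) ξ).1
  have hwb : ∀ n, w n ∈ Metric.closedBall (0 : Fin d → Vec d) √(d * Λ) := fun n => by
    rw [mem_closedBall_zero_iff, pi_norm_le_iff_of_nonneg (Real.sqrt_nonneg _)]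
    exact fun k => Real.le_sqrt_of_sq_le <|
      (hw n).norm_sq_le (inv_nonneg.mpr hΛ.le) (fun ξ => (ha.2 (t n) ξ).2) k
  obtain ⟨w₀, -, σ, hσ, hlim⟩ := (isCompact_closedBall _ _).tendsto_subseq hwb
  have hmem : ∀ n {y : Slice d}, (s, y) ∈ kineticCylinder d r →
      (t n, y) ∈ kineticCylinder d r := fun n _ hy => ⟨Ioo_subset_Ioc_self (ht n).1, hy.2⟩
  have hsource : ∀ y : Slice d, (s, y) ∈ kineticCylinder d r →
      Tendsto (fun n => g (t (σ n), y)) atTop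
        (𝓝 (sourceTerm (kineticCylinder d r) Λ⁻¹ w₀ f (s, y))) := fun y hy => by
    have hpoint : Tendsto (fun n => (w (σ n), (t (σ n), y))) atTop
        (𝓝[univ ×ˢ kineticCylinder d r] (w₀, (s, y))) :=
      tendsto_nhdsWithin_iff.mpr ⟨hlim.prodMk_nhds
        ((hts.comp hσ.tendsto_atTop).prodMk_nhds tendsto_const_nhds),
        Eventually.of_forall fun n => ⟨mem_univ _, hmem _ hy⟩⟩
    refine ((continuousOn_sourceTerm hf Λ⁻¹ _ ⟨mem_univ _, hy⟩).tendsto.comp hpoint).congr fun n =>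
      sourceTerm_eq_of_trace_eq hf (hw _) (hmem _ hy) ((ht _).2 _ _ (hmem _ hy))
  exact ⟨w₀, fun y y' hy hy' hd => le_of_tendsto ((hsource y hy).dist (hsource y' hy'))
    (Eventually.of_forall fun n => dist_le_of_holderXV hg (hmem _ hy) (hmem _ hy') hd)⟩

lemma SupportedBy.sourceTerm {K : Set (Phase d)} (h : SupportedBy (kineticCylinder d r) K f)
    (ν : ℝ) (w : Fin d → Vec d) :
    SupportedBy (kineticCylinder d r) K (sourceTerm (kineticCylinder d r) ν w f) where
  isCompact := h.isCompact
  subset := h.subset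
  eq_zero z hzQ hz := by
    simp [_root_.sourceTerm, h.transportDeriv.eq_zero z hzQ hz, h.hessV.eq_zero z hzQ hz]

lemma exists_shearHolder_straighten_sourceTerm {Λ α : ℝ} (hΛ : 0 < Λ) (hα : 0 ≤ α)
    {a : ℝ → Matrix (Fin d) (Fin d) ℝ} {g : Phase d → ℝ} (ha : IsEllipticCoeff Λ a)
    (hf : KineticC2 1 f) (hg : holderXV (α / 3) α (kineticCylinder d 1) g < ∞)
    (heq : SolvesHomogeneousKFP 1 a f g) {K : Set (Phase d)}
    (h : SupportedBy (kineticCylinder d 1) K f) {t : ℝ} (ht : t ≤ 0) :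
    ∃ u : ℝ → Fin d → Vec d, ∀ τ > 0,
      ShearHolder α (4 * (holderXV (α / 3) α (kineticCylinder d 1) g).toReal) τ
        (straighten t ((kineticCylinder d 1).indicator
          (sourceTerm (kineticCylinder d 1) Λ⁻¹ (u τ) f)) τ) := by
  set N := (holderXV (α / 3) α (kineticCylinder d 1) g).toReal
  suffices hslice : ∀ s ≤ (0 : ℝ), ∃ w : Fin d → Vec d, ∀ y y' : Slice d,
      dist ((kineticCylinder d 1).indicator (sourceTerm (kineticCylinder d 1) Λ⁻¹ w f) (s, y))
        ((kineticCylinder d 1).indicator (sourceTerm (kineticCylinder d 1) Λ⁻¹ w f) (s, y')) ≤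
        4 * N * holderGauge (α / 3) α (y - y') by
    choose! w hw using hslice
    refine ⟨fun τ => w (t - τ), fun τ hτ y h => ?_⟩
    have hshear : ((y + h).1 - τ • (y + h).2, (y + h).2) - (y.1 - τ • y.2, y.2) =
        (h.1 - τ • h.2, h.2) :=
      Prod.ext (by simp only [Prod.fst_add, Prod.snd_add, Prod.fst_sub]; module)
        (add_sub_cancel_left _ _)
    have hstep := hw (t - τ) (by linarith) ((y + h).1 - τ • (y + h).2, (y + h).2)
      (y.1 - τ • y.2, y.2)
    rw [hshear] at hstep
    exact hstep
  intro s hs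
  have hball : ∀ {y : Slice d}, -1 < s → y ∈ Metric.ball 0 1 → (s, y) ∈ kineticCylinder d 1 :=
    fun hs₁ hy => by simpa [mem_kineticCylinder, hs₁, hs, Prod.norm_def] using hy
  rcases lt_or_ge (-1) s with hs₁ | hs₁
  · obtain ⟨w, hw⟩ := exists_dist_sourceTerm_le hΛ ha hf hg heq (by simpa using ⟨hs₁, hs⟩)
    refine ⟨w, dist_le_of_holder_half_of_eq_zero (by positivity) hα ENNReal.toReal_nonneg
      (h.isCompact.image continuous_snd) ?_ (fun y hy => ?_) fun y hy y' hy' hd => ?_⟩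
    · rintro _ ⟨z, hz, rfl⟩
      simpa [mem_kineticCylinder, Prod.norm_def] using (mem_kineticCylinder.mp (h.subset hz)).2
    · exact (h.sourceTerm _ w).indicator_eq_zero fun hK => hy ⟨_, hK, rfl⟩
    · rw [indicator_of_mem (hball hs₁ hy), indicator_of_mem (hball hs₁ hy')]
      exact hw y y' (hball hs₁ hy) (hball hs₁ hy') hd
  · refine ⟨0, fun y y' => ?_⟩
    have hs₀ : ∀ y : Slice d, (s, y) ∉ kineticCylinder d 1 := fun y hy =>
      hs₁.not_gt (by simpa using (mem_kineticCylinder.mp hy).1.1)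
    rw [indicator_of_notMem (hs₀ y), indicator_of_notMem (hs₀ y'), dist_self]
    exact mul_nonneg (by positivity) (holderGauge_nonneg _ _ _)

end LimitSource

section Estimates

open fwdDiff

variable {d : ℕ}

lemma opNorm_le_of_quadratic_le {E : Type*} [NormedAddCommGroup E] [InnerProductSpace ℝ E]
    {D : E →L[ℝ] E →L[ℝ] ℝ} (hD : ∀ e e', D e e' = D e' e) {B : ℝ} (hB : 0 ≤ B)
    (h : ∀ e, |D e e| ≤ B * ‖e‖ ^ 2) : ‖D‖ ≤ B := by
  refine ContinuousLinearMap.opNorm_le_of_unit_norm hB fun e he =>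
    ContinuousLinearMap.opNorm_le_of_unit_norm hB fun e' he' => ?_
  have hpolar : 4 * D e e' = D (e + e') (e + e') - D (e - e') (e - e') := by
    simp only [map_add, map_sub, add_apply, sub_apply, hD e' e]
    ring
  have hbound : 4 * |D e e'| ≤ 4 * B := by
    calc 4 * |D e e'| = |D (e + e') (e + e') - D (e - e') (e - e')| := by
          rw [← hpolar, abs_mul, Nat.abs_ofNat]
      _ ≤ B * ‖e + e'‖ ^ 2 + B * ‖e - e'‖ ^ 2 := (abs_sub _ _).trans (add_le_add (h _) (h _))
      _ = B * (2 * (‖e‖ ^ 2 + ‖e'‖ ^ 2)) := by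
          rw [← parallelogram_law_with_norm ℝ e e']
          ring
      _ = 4 * B := by
          rw [he, he']
          ring
  exact le_of_mul_le_mul_left hbound (by norm_num)

/-- The norm `max (|x| ^ (1 / 3)) |v|`, homogeneous under the kinetic scalings
`(x, v) ↦ (r³ x, r v)`. -/
noncomputable def kineticNorm (z : Slice d) : ℝ := max (‖z.1‖ ^ (3⁻¹ : ℝ)) ‖z.2‖

lemma kineticNorm_pos {z : Slice d} (hz : z ≠ 0) : 0 < kineticNorm z := by
  rcases not_and_or.mp (mt Prod.ext_iff.mpr hz) with hx | hv
  · exact lt_max_of_lt_left (Real.rpow_pos_of_pos (norm_pos_iff.mpr hx) _)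
  · exact lt_max_of_lt_right (norm_pos_iff.mpr hv)

lemma kineticNorm_le_one {z : Slice d} (hz : ‖z‖ ≤ 1) : kineticNorm z ≤ 1 :=
  max_le (Real.rpow_le_one (norm_nonneg _) ((norm_fst_le z).trans hz) (by norm_num))
    ((norm_snd_le z).trans hz)

lemma norm_fst_le_kineticNorm_pow (z : Slice d) : ‖z.1‖ ≤ kineticNorm z ^ 3 :=
  calc ‖z.1‖ = (‖z.1‖ ^ (3⁻¹ : ℝ)) ^ 3 := by
        simpa using (Real.rpow_inv_natCast_pow (norm_nonneg z.1) three_ne_zero).symm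
    _ ≤ kineticNorm z ^ 3 := by
        gcongr
        exact le_max_left _ _

lemma kineticNorm_position_rpow (x : Vec d) (p : ℝ) :
    kineticNorm ((x, 0) : Slice d) ^ p = ‖x‖ ^ (p / 3) := by
  rw [kineticNorm, norm_zero, max_eq_left (by positivity), ← Real.rpow_mul (norm_nonneg x),
    inv_mul_eq_div]

lemma kineticNorm_rpow_le (p : ℝ) (z : Slice d) : kineticNorm z ^ p ≤ holderGauge (p / 3) p z := by
  have hx : (‖z.1‖ ^ (3⁻¹ : ℝ)) ^ p = ‖z.1‖ ^ (p / 3) := by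
    rw [← Real.rpow_mul (norm_nonneg _), inv_mul_eq_div]
  rcases max_choice (‖z.1‖ ^ (3⁻¹ : ℝ)) ‖z.2‖ with hmax | hmax
  · rw [kineticNorm, hmax, hx]
    exact le_add_of_nonneg_right (by positivity)
  · rw [kineticNorm, hmax]
    exact le_add_of_nonneg_left (by positivity)

lemma holderX_le {F : Type*} [NormedAddCommGroup F] {β C : ℝ} {Q : Set (Phase d)}
    {f : Phase d → F}
    (h : ∀ t x x' v, (t, x, v) ∈ Q → (t, x', v) ∈ Q → x ≠ x' → ‖x - x'‖ < 1 / 2 →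
      ‖f (t, x, v) - f (t, x', v)‖ ≤ C * ‖x - x'‖ ^ β) : holderX β Q f ≤ ENNReal.ofReal C := by
  simp only [holderX, iSup_le_iff]
  intro t x x' v hx hx' hne hd
  refine ENNReal.ofReal_le_ofReal ((div_le_iff₀ ?_).mpr (h t x x' v hx hx' hne hd))
  exact Real.rpow_pos_of_pos (norm_sub_pos_iff.mpr hne) β

lemma holderXV_le {F : Type*} [NormedAddCommGroup F] {p q C : ℝ} {Q : Set (Phase d)}
    {f : Phase d → F}
    (h : ∀ t (y y' : Slice d), (t, y) ∈ Q → (t, y') ∈ Q → y ≠ y' → ‖y - y'‖ < 1 / 2 →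
      ‖f (t, y) - f (t, y')‖ ≤ C * holderGauge p q (y - y')) :
    holderXV p q Q f ≤ ENNReal.ofReal C := by
  simp only [holderXV, iSup_le_iff]
  intro t x v x' v' hy hy' hne hx hv
  exact ENNReal.ofReal_le_ofReal <| (div_le_iff₀ (holderGauge_pos p q (sub_ne_zero.mpr hne))).mpr <|
    h t (x, v) (x', v') hy hy' hne (max_lt hx hv)

variable {Λ α : ℝ} {a : ℝ → Matrix (Fin d) (Fin d) ℝ} {f g : Phase d → ℝ} {K : Set (Phase d)}
  (hΛ : 1 ≤ Λ) (hα : 0 < α) (hα₁ : α < 1) (ha : IsEllipticCoeff Λ a) (hf : KineticC2 1 f)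
  (hg : holderXV (α / 3) α (kineticCylinder d 1) g < ∞) (heq : SolvesHomogeneousKFP 1 a f g)
  (h : SupportedBy (kineticCylinder d 1) K f)

include hΛ hα hα₁ ha hf hg heq h

lemma indicator_sub_le {t : ℝ} (ht : t ≤ 0) {x x' : Vec d} (v : Vec d) (hne : x ≠ x')
    (hd : ‖x - x'‖ ≤ 1) :
    (kineticCylinder d 1).indicator f (t, x, v) - (kineticCylinder d 1).indicator f (t, x', v) ≤
      positionConst d Λ⁻¹ α * (4 * (holderXV (α / 3) α (kineticCylinder d 1) g).toReal) *
        ‖x - x'‖ ^ ((2 + α) / 3) := by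
  have hΛ₀ : 0 < Λ := zero_lt_one.trans_le hΛ
  have hz : ((x - x', 0) : Slice d) ≠ 0 := fun hz => hne (sub_eq_zero.mp (Prod.ext_iff.mp hz).1)
  obtain ⟨u, hu⟩ := exists_shearHolder_straighten_sourceTerm hΛ₀ hα.le ha hf hg heq h ht
  have hbound := (straightSolution_straighten hf h ht Λ⁻¹ u).fwdDiff_position_le
    (inv_pos.mpr hΛ₀) (inv_le_one_of_one_le₀ hΛ) hα hα₁ (by positivity) hu
    (kineticNorm_le_one (by simpa [Prod.norm_def] using hd)) (kineticNorm_pos hz)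
    (norm_fst_le_kineticNorm_pow ((x - x', 0) : Slice d)) (x', v)
  simpa only [fwdDiff, straighten_zero, Prod.mk_add_mk, add_sub_cancel, add_zero,
    kineticNorm_position_rpow] using hbound

lemma indicator_hessV_sub_le {t : ℝ} (ht : t ≤ 0) {y y' : Slice d} (hne : y ≠ y')
    (hd : ‖y - y'‖ ≤ 1) (e : Vec d) :
    (kineticCylinder d 1).indicator (hessV f) (t, y) e e -
        (kineticCylinder d 1).indicator (hessV f) (t, y') e e ≤
      velocityConst d Λ⁻¹ α * (4 * (holderXV (α / 3) α (kineticCylinder d 1) g).toReal) *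
        holderGauge (α / 3) α (y - y') * ‖e‖ ^ 2 := by
  have hΛ₀ : 0 < Λ := zero_lt_one.trans_le hΛ
  have hC := velocityConst_nonneg d (inv_pos.mpr hΛ₀) hα hα₁
  obtain ⟨u, hu⟩ := exists_shearHolder_straighten_sourceTerm hΛ₀ hα.le ha hf hg heq h ht
  have hbound := (straightSolution_straighten hf h ht Λ⁻¹ u).secondDeriv_fwdDiff_le
    (inv_pos.mpr hΛ₀) (inv_le_one_of_one_le₀ hΛ) hα hα₁ (by positivity) hu
    (kineticNorm_le_one hd) (kineticNorm_pos (sub_ne_zero.mpr hne))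
    (norm_fst_le_kineticNorm_pow (y - y')) (le_max_right _ _) e y'
  simp only [fwdDiff, straighten_zero, add_sub_cancel] at hbound
  refine hbound.trans ?_
  gcongr
  exact kineticNorm_rpow_le α _

lemma holderX_le_holderXV :
    holderX ((2 + α) / 3) (kineticCylinder d 1) f ≤
      ENNReal.ofReal (4 * positionConst d Λ⁻¹ α) *
        holderXV (α / 3) α (kineticCylinder d 1) g := by
  have hC := positionConst_nonneg d Λ⁻¹ hα₁
  rw [← ENNReal.ofReal_toReal hg.ne, ← ENNReal.ofReal_mul (by positivity), mul_comm 4, mul_assoc]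
  refine holderX_le fun t x x' v hx hx' hne hd => ?_
  have hle := fun {x x' : Vec d} => indicator_sub_le hΛ hα hα₁ ha hf hg heq h
    (mem_kineticCylinder.mp hx).1.2 (x := x) (x' := x') v
  rw [Real.norm_eq_abs, ← indicator_of_mem hx f, ← indicator_of_mem hx' f, abs_sub_le_iff]
  refine ⟨hle hne (by linarith), ?_⟩
  rw [norm_sub_rev] at hd ⊢
  exact hle hne.symm (by linarith)

lemma holderXV_hessV_le_holderXV :
    holderXV (α / 3) α (kineticCylinder d 1) (hessV f) ≤
      ENNReal.ofReal (4 * velocityConst d Λ⁻¹ α) *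
        holderXV (α / 3) α (kineticCylinder d 1) g := by
  have hC := velocityConst_nonneg d (inv_pos.mpr (zero_lt_one.trans_le hΛ)) hα hα₁
  rw [← ENNReal.ofReal_toReal hg.ne, ← ENNReal.ofReal_mul (by positivity), mul_comm 4, mul_assoc]
  refine holderXV_le fun t y y' hy hy' hne hd => ?_
  have hsymm : ∀ z ∈ kineticCylinder d 1, ∀ e e', hessV f z e e' = hessV f z e' e := fun z hz =>
    hessV_symm (hf.contDiffAt_velocity hz)
  have hle := fun {y y' : Slice d} => indicator_hessV_sub_le hΛ hα hα₁ ha hf hg heq h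
    (mem_kineticCylinder.mp hy).1.2 (y := y) (y' := y')
  refine opNorm_le_of_quadratic_le (fun e e' => ?_)
    (mul_nonneg (by positivity) (holderGauge_nonneg _ _ _)) fun e => ?_
  · simp only [sub_apply, hsymm _ hy e e', hsymm _ hy' e e']
  · rw [sub_apply, sub_apply, ← indicator_of_mem hy (hessV f), ← indicator_of_mem hy' (hessV f),
      abs_sub_le_iff]
    refine ⟨hle hne (by linarith) e, ?_⟩
    rw [norm_sub_rev] at hd
    rw [holderGauge_sub_comm]
    exact hle hne.symm (by linarith) e

end Estimates

theorem proposition2p3 (d : ℕ) (α : ℝ) (hα : α ∈ Ioo (0 : ℝ) 1) (Λ : ℝ) (hΛ : 1 ≤ Λ) :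
    ∃ C : ℝ≥0, ∀ (a : ℝ → Matrix (Fin d) (Fin d) ℝ) (f g : Phase d → ℝ),
      IsEllipticCoeff Λ a →
      KineticC2 1 f →
      MemHolderXV (α / 3) α (kineticCylinder d 1) g →
      CompactSupportIn (kineticCylinder d 1) f →
      CompactSupportIn (kineticCylinder d 1) g →
      SolvesHomogeneousKFP 1 a f g →
      holderX ((2 + α) / 3) (kineticCylinder d 1) f
          + holderXV (α / 3) α (kineticCylinder d 1) (hessV f)
        ≤ C * holderXV (α / 3) α (kineticCylinder d 1) g := by
  have hC₁ := positionConst_nonneg d Λ⁻¹ hα.2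
  have hC₂ := velocityConst_nonneg d (inv_pos.mpr (zero_lt_one.trans_le hΛ)) hα.1 hα.2
  refine ⟨(4 * positionConst d Λ⁻¹ α + 4 * velocityConst d Λ⁻¹ α).toNNReal,
    fun a f g ha hf hg ⟨K, hK, hKQ, hfK⟩ _ heq => ?_⟩
  have hsupp : SupportedBy (kineticCylinder d 1) K f := ⟨hK, hKQ, hfK⟩
  change _ ≤ ENNReal.ofReal _ * _
  rw [ENNReal.ofReal_add (by positivity) (by positivity), add_mul]
  exact add_le_add (holderX_le_holderXV hΛ hα.1 hα.2 ha hf hg.2 heq hsupp)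
    (holderXV_hessV_le_holderXV hΛ hα.1 hα.2 ha hf hg.2 heq hsupp)
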